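/- **Conventions.** A crossed module $(H,G,\mu)$ is a group homomorphism $\mu\colon H\to G$ together with an action of $G$ on the group $H$ such that $\mu({}^gh)=g\mu(h)g^{-1}$ and ${}^{\mu(h)}h'=hh'h^{-1}$. It is abelian if $H$ and $G$ are abelian and $G$ acts trivially on $H$. An action of $(H,G,\mu)$ on an abelian crossed module $(C,A,\nu)$ (written additively) consists of actions of the group $G$ on $C$ and $A$ by automorphisms such that $\nu$ is $G$-equivariant, and of a map $\xi\colon H\times A\to C$ with $$\nu\xi(h,a)={}^{\mu(h)}a-a,\quad \xi(h,\nu(c))={}^{\mu(h)}c-c,\quad {}^g\xi(h,a)=\xi({}^gh,{}^ga),$$ $$\xi(hh',a)={}^{\mu(h)}\xi(h',a)+\xi(h,a),\quad \xi(h,a+a')=\xi(h,a)+\xi(h,a').$$ The nerve $\mathrm{Nerve}_*(H,G,\mu)$ is the simplicial group obtained as the nerve of the internal category in groups with objects $G$ and arrows $(h,g)\colon g\to\mu(h)g$ in $H\rtimes G$. An action as above induces a degreewise action of $\mathrm{Nerve}_*(H,G,\mu)$ on the abelian simplicial group $\mathrm{Nerve}_*(C,A,\nu)$, given on arrows by $(h,g)\cdot(c,a)=({}^{\mu(h)g}c+\xi(h,{}^ga),{}^ga)$.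 For a group $G$ let $B_*(G)$ be the standard resolution of $\mathbb Z$, viewed as a complex of right $G$-modules by $bg=g^{-1}b$. For a simplicial group $G_*$ acting on an abelian simplicial group $A_*$, let $H_n(G_*,A_*)$ be the $n$th homology group of the total complex of the bicomplex $B_q(G_p)\otimes_{G_p}A_p$ (horizontal differential: the alternating sum of the face maps), and let $\mathcal H_q(G_*,A_*)$ be the abelian simplicial group $n\mapsto H_q(G_n,A_n)$ (ordinary group homology). Put $$H_n((H,G,\mu),(C,A,\nu))=H_n(\mathrm{Nerve}_*(H,G,\mu),\mathrm{Nerve}_*(C,A,\nu)).$$ If $1\to\Gamma_*\to\Pi_*\to G_*\to 1$ is a short exact sequence of simplicial groups and $\Pi_*$ acts on $A_*$, then $G_*$ acts on $\mathcal H_q(\Gamma_*,A_*)$: the action $x(b\otimes a)=bx^{-1}\otimes xa$ of $\Pi_n$ on $B_*(\Pi_n)\otimes_{\Gamma_n}A_n$ factors through $G_n$, and the homology of this complex is identified with $H_q(\Gamma_n,A_n)$ by the map induced by the inclusion $B_*(\Gamma_n)\to B_*(\Pi_n)$. **Theorem.** Let $(H,G,\mu)$ be a crossed module acting on an abelian crossed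 module $(C,A,\nu)$. Then for every short exact sequence of crossed modules $$0\to(H',G',\mu')\to(H,G,\mu)\to(H'',G'',\mu'')\to 0$$ (that is, $1\to H'\to H\to H''\to 1$ and $1\to G'\to G\to G''\to 1$ are short exact sequences of groups) there is a first quadrant spectral sequence of abelian groups, with differentials $d^r\colon E^r_{pq}\to E^r_{p-r,q+r-1}$ for $r\ge 2$, $$E^2_{pq}\cong H_p\big(\mathrm{Nerve}_*(H'',G'',\mu''),\mathcal H_q(\mathrm{Nerve}_*(H',G',\mu'),\mathrm{Nerve}_*(C,A,\nu))\big)\Rightarrow H_{p+q}((H,G,\mu),(C,A,\nu)).$$ Here $\mathrm{Nerve}_*(H',G',\mu')$ acts on $\mathrm{Nerve}_*(C,A,\nu)$ through $\mathrm{Nerve}_*(H,G,\mu)$, and convergence means that every $H_n=H_n((H,G,\mu),(C,A,\nu))$ has a filtration $0=F_{-1}\subseteq F_0\subseteq\cdots\subseteq F_n=H_n$ with $F_p/F_{p-1}\cong E^\infty_{p,n-p}$ for $0\le p\le n$. -/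

import Mathlib

open CategoryTheory Opposite AlgebraicTopology
open scoped Simplicial

universe u

noncomputable section

/-! ## Bar complexes -/

/-- A group `Γ`, a left `Γ`-set `X` and a `Γ`-module `A`. -/
structure BarDatum : Type (u + 1) where
  Γ : Type u
  X : Type u
  A : Type u
  [grp : Group Γ]
  [act : MulAction Γ X]
  [ab : AddCommGroup A]
  ρ : Γ →* AddMonoid.End A

namespace BarDatum

attribute [instance] grp act ab

/-- The subgroup of `ℤ[Xᵐ⁺¹] ⊗ A` (seen as `Xᵐ⁺¹ →₀ A`) whose quotient is
`ℤ[Xᵐ⁺¹] ⊗_Γ A`, for the right action `x · γ = γ⁻¹ • x` on `Xᵐ⁺¹`. -/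
def rel (D : BarDatum.{u}) (m : ℕ) : AddSubgroup ((Fin (m + 1) → D.X) →₀ D.A) :=
  AddSubgroup.closure {z | ∃ (γ : D.Γ) (x : Fin (m + 1) → D.X) (a : D.A),
    z = Finsupp.single (γ • x) (D.ρ γ a) - Finsupp.single x a}

/-- The group `ℤ[Xᵐ⁺¹] ⊗_Γ A`. -/
abbrev Chain (D : BarDatum.{u}) (m : ℕ) : Type u :=
  ((Fin (m + 1) → D.X) →₀ D.A) ⧸ D.rel m

/-- The element `x ⊗ a` of `ℤ[Xᵐ⁺¹] ⊗_Γ A`. -/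
def Chain.tmul (D : BarDatum.{u}) {m : ℕ} (x : Fin (m + 1) → D.X) (a : D.A) : D.Chain m :=
  QuotientAddGroup.mk (Finsupp.single x a)

lemma Chain.tmul_smul (D : BarDatum.{u}) {m : ℕ} (γ : D.Γ) (x : Fin (m + 1) → D.X) (a : D.A) :
    Chain.tmul D (γ • x) (D.ρ γ a) = Chain.tmul D x a := by
  refine (QuotientAddGroup.eq_iff_sub_mem).2 ?_
  exact AddSubgroup.subset_closure ⟨γ, x, a, rfl⟩

lemma Chain.hom_ext {D : BarDatum.{u}} {m : ℕ} {B : Type*} [AddCommGroup B]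
    {f g : D.Chain m →+ B} (h : ∀ x a, f (Chain.tmul D x a) = g (Chain.tmul D x a)) : f = g := by
  refine QuotientAddGroup.addMonoidHom_ext _ (Finsupp.addHom_ext fun x a => h x a)

/-- The map `x ⊗ a ↦ t x ⊗ α a`. -/
def Chain.map {D E : BarDatum.{u}} {m k : ℕ} (t : (Fin (m + 1) → D.X) → (Fin (k + 1) → E.X))
    (α : D.A →+ E.A)
    (h : ∀ γ : D.Γ, ∃ γ' : E.Γ, (∀ x, t (γ • x) = γ' • t x) ∧
      ∀ a, α (D.ρ γ a) = E.ρ γ' (α a)) : D.Chain m →+ E.Chain k :=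
  QuotientAddGroup.map _ _
    ((Finsupp.mapRange.addMonoidHom α).comp (Finsupp.mapDomain.addMonoidHom t)) (by
      rw [rel, AddSubgroup.closure_le]
      rintro _ ⟨γ, x, a, rfl⟩
      obtain ⟨γ', h₁, h₂⟩ := h γ
      simp only [SetLike.mem_coe, AddSubgroup.mem_comap, map_sub, AddMonoidHom.comp_apply,
        Finsupp.mapDomain.addMonoidHom_apply, Finsupp.mapDomain_single,
        Finsupp.mapRange.addMonoidHom_apply, Finsupp.mapRange_single, h₁, h₂]
      exact AddSubgroup.subset_closure ⟨γ', t x, α a, rfl⟩)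

@[simp]
lemma Chain.map_tmul {D E : BarDatum.{u}} {m k : ℕ}
    (t : (Fin (m + 1) → D.X) → (Fin (k + 1) → E.X)) (α : D.A →+ E.A) (h)
    (x : Fin (m + 1) → D.X) (a : D.A) :
    Chain.map t α h (Chain.tmul D x a) = Chain.tmul E (t x) (α a) := by
  simp [Chain.map, Chain.tmul]

/-- `ℤ[Xᵐ⁺¹] ⊗_Γ A` as an object of the category of abelian groups. -/
def chainObj (D : BarDatum.{u}) (m : ℕ) : AddCommGrpCat.{u} := AddCommGrpCat.of (D.Chain m)

/-- `Chain.map` as a morphism of abelian groups. -/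
def chainHom {D E : BarDatum.{u}} {m k : ℕ} (t : (Fin (m + 1) → D.X) → (Fin (k + 1) → E.X))
    (α : D.A →+ E.A)
    (h : ∀ γ : D.Γ, ∃ γ' : E.Γ, (∀ x, t (γ • x) = γ' • t x) ∧
      ∀ a, α (D.ρ γ a) = E.ρ γ' (α a)) :
    D.chainObj m ⟶ E.chainObj k :=
  AddCommGrpCat.ofHom (Chain.map t α h)

lemma chainHom_eq_id {D : BarDatum.{u}} {m : ℕ} (t : (Fin (m + 1) → D.X) → (Fin (m + 1) → D.X))
    (α : D.A →+ D.A) (h) (ht : ∀ x, t x = x) (hα : ∀ a, α a = a) :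
    chainHom t α h = 𝟙 _ := by
  refine AddCommGrpCat.hom_ext (Chain.hom_ext fun x a => ?_)
  change Chain.map t α h (Chain.tmul D x a) = Chain.tmul D x a
  rw [Chain.map_tmul, ht, hα]

lemma chainHom_comp_eq {D E F : BarDatum.{u}} {m k l : ℕ}
    {t : (Fin (m + 1) → D.X) → (Fin (k + 1) → E.X)} {α : D.A →+ E.A} {h}
    {t' : (Fin (k + 1) → E.X) → (Fin (l + 1) → F.X)} {α' : E.A →+ F.A} {h'}
    {t'' : (Fin (m + 1) → D.X) → (Fin (l + 1) → F.X)} {α'' : D.A →+ F.A} {h''}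
    (ht : ∀ x, t' (t x) = t'' x) (hα : ∀ a, α' (α a) = α'' a) :
    chainHom t α h ≫ chainHom t' α' h' = chainHom t'' α'' h'' := by
  refine AddCommGrpCat.hom_ext (Chain.hom_ext fun x a => ?_)
  change Chain.map t' α' h' (Chain.map t α h (Chain.tmul D x a)) =
    Chain.map t'' α'' h'' (Chain.tmul D x a)
  simp only [Chain.map_tmul, ht, hα]

lemma chainHom_comp_eq_comp {D E E' F : BarDatum.{u}} {m k k' l : ℕ}
    {t : (Fin (m + 1) → D.X) → (Fin (k + 1) → E.X)} {α : D.A →+ E.A} {h}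
    {t' : (Fin (k + 1) → E.X) → (Fin (l + 1) → F.X)} {α' : E.A →+ F.A} {h'}
    {s : (Fin (m + 1) → D.X) → (Fin (k' + 1) → E'.X)} {β : D.A →+ E'.A} {g}
    {s' : (Fin (k' + 1) → E'.X) → (Fin (l + 1) → F.X)} {β' : E'.A →+ F.A} {g'}
    (ht : ∀ x, t' (t x) = s' (s x)) (hα : ∀ a, α' (α a) = β' (β a)) :
    chainHom t α h ≫ chainHom t' α' h' = chainHom s β g ≫ chainHom s' β' g' := by
  refine AddCommGrpCat.hom_ext (Chain.hom_ext fun x a => ?_)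
  change Chain.map t' α' h' (Chain.map t α h (Chain.tmul D x a)) =
    Chain.map s' β' g' (Chain.map s β g (Chain.tmul D x a))
  simp only [Chain.map_tmul, ht, hα]

lemma chainHom_eq_of_smul {D E : BarDatum.{u}} {m k : ℕ}
    {t t' : (Fin (m + 1) → D.X) → (Fin (k + 1) → E.X)} {α α' : D.A →+ E.A} {h h'} (γ : E.Γ)
    (ht : ∀ x, t' x = γ • t x) (hα : ∀ a, α' a = E.ρ γ (α a)) :
    chainHom t α h = chainHom t' α' h' := by
  refine AddCommGrpCat.hom_ext (Chain.hom_ext fun x a => ?_)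
  change Chain.map t α h (Chain.tmul D x a) = Chain.map t' α' h' (Chain.tmul D x a)
  rw [Chain.map_tmul, Chain.map_tmul, ht, hα, Chain.tmul_smul]

/-- A pair of maps `X → Y` and `A → B` such that every `γ : Γ` acts compatibly with some `γ'`. -/
@[ext]
structure Hom (D E : BarDatum.{u}) : Type u where
  pts : D.X → E.X
  coeff : D.A →+ E.A
  equivariant : ∀ γ : D.Γ, ∃ γ' : E.Γ, (∀ x, pts (γ • x) = γ' • pts x) ∧
    ∀ a, coeff (D.ρ γ a) = E.ρ γ' (coeff a)

instance : Category BarDatum.{u} where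
  Hom := Hom
  id D := ⟨id, AddMonoidHom.id _, fun γ => ⟨γ, fun _ => rfl, fun _ => rfl⟩⟩
  comp f g := ⟨g.pts ∘ f.pts, g.coeff.comp f.coeff, fun γ => by
    obtain ⟨γ', h₁, h₂⟩ := f.equivariant γ
    obtain ⟨γ'', h₃, h₄⟩ := g.equivariant γ'
    exact ⟨γ'', fun x => by simp [h₁, h₃], fun a => by simp [h₂, h₄]⟩⟩

/-- The simplicial abelian group `m ↦ ℤ[Xᵐ⁺¹] ⊗_Γ A`; the `i`-th face omits the `i`-th entry. -/
def simplicialChains (D : BarDatum.{u}) : SimplicialObject AddCommGrpCat.{u} where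
  obj Δ := D.chainObj Δ.unop.len
  map f := chainHom (fun x => x ∘ f.unop.toOrderHom) (AddMonoidHom.id _)
    fun γ => ⟨γ, fun _ => rfl, fun _ => rfl⟩
  map_id _ := chainHom_eq_id (D := D) (fun x => x ∘ id) (AddMonoidHom.id _) _
    (fun _ => rfl) (fun _ => rfl)
  map_comp f g := (chainHom_comp_eq (D := D) (E := D) (F := D)
    (t := fun x => x ∘ f.unop.toOrderHom) (t' := fun x => x ∘ g.unop.toOrderHom)
    (t'' := fun x => x ∘ (f ≫ g).unop.toOrderHom) (α := AddMonoidHom.id _)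
    (α' := AddMonoidHom.id _) (α'' := AddMonoidHom.id _) (fun _ => rfl) (fun _ => rfl)).symm

/-- The map of simplicial abelian groups induced by a morphism. -/
def simplicialChainsMap {D E : BarDatum.{u}} (F : D ⟶ E) :
    D.simplicialChains ⟶ E.simplicialChains where
  app Δ := chainHom (fun x => F.pts ∘ x) F.coeff fun γ => by
    obtain ⟨γ', h₁, h₂⟩ := F.equivariant γ
    exact ⟨γ', fun x => funext fun i => h₁ (x i), h₂⟩
  naturality Δ Δ' f := chainHom_comp_eq_comp
    (t := fun x => x ∘ f.unop.toOrderHom) (t' := fun x => F.pts ∘ x)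
    (s := fun x => F.pts ∘ x) (s' := fun x => x ∘ f.unop.toOrderHom)
    (α := AddMonoidHom.id _) (α' := F.coeff) (β := F.coeff) (β' := AddMonoidHom.id _)
    (fun _ => rfl) (fun _ => rfl)

/-- Functoriality of `simplicialChains`. -/
def simplicialChainsFunctor : BarDatum.{u} ⥤ SimplicialObject AddCommGrpCat.{u} where
  obj D := D.simplicialChains
  map F := simplicialChainsMap F
  map_id D := by
    refine NatTrans.ext (funext fun Δ => ?_)
    exact chainHom_eq_id (D := D) (fun x => id ∘ x) (AddMonoidHom.id _) _
      (fun _ => rfl) (fun _ => rfl)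
  map_comp F G := by
    refine NatTrans.ext (funext fun Δ => ?_)
    exact (chainHom_comp_eq
      (t := fun x => F.pts ∘ x) (t' := fun x => G.pts ∘ x) (t'' := fun x => (F ≫ G).pts ∘ x)
      (α := F.coeff) (α' := G.coeff) (α'' := (F ≫ G).coeff)
      (fun _ => rfl) (fun _ => rfl)).symm

/-- The chain complex `ℤ[X^{*+1}] ⊗_Γ A` with differential
`(x₀, …, xₘ) ⊗ a ↦ ∑ᵢ (-1)ⁱ (x₀, …, x̂ᵢ, …, xₘ) ⊗ a`. -/
def complex : BarDatum.{u} ⥤ ChainComplex AddCommGrpCat.{u} ℕ :=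
  simplicialChainsFunctor ⋙ alternatingFaceMapComplex AddCommGrpCat.{u}

/-- The homology of `ℤ[X^{*+1}] ⊗_Γ A`. -/
def homology (q : ℕ) : BarDatum.{u} ⥤ AddCommGrpCat.{u} :=
  complex ⋙ HomologicalComplex.homologyFunctor _ _ q

lemma val_succAbove {n : ℕ} (i : Fin (n + 1)) (k : Fin n) :
    (i.succAbove k : ℕ) = if (k : ℕ) < i then (k : ℕ) else k + 1 := by
  simp only [Fin.succAbove, Fin.lt_def, Fin.val_castSucc]
  split_ifs <;> simp

lemma val_predAbove {n : ℕ} (j : Fin n) (k : Fin (n + 1)) :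
    (j.predAbove k : ℕ) = if (j : ℕ) < k then (k : ℕ) - 1 else k := by
  simp only [Fin.predAbove, Fin.lt_def, Fin.val_castSucc]
  split_ifs <;> simp

/-- The `j`-th prism: `(x₀, …, xₙ) ↦ (f x₀, …, f xⱼ, g xⱼ, …, g xₙ)`. -/
def prismFun {X Y : Type u} {n : ℕ} (f g : X → Y) (j : Fin (n + 1)) (x : Fin (n + 1) → X)
    (k : Fin (n + 2)) : Y :=
  if k ≤ j.castSucc then f (x (j.predAbove k)) else g (x (j.predAbove k))

/-- The prism operators between two maps of `Γ`-sets. -/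
def prism {D E : BarDatum.{u}} (F G : D ⟶ E) (hc : F.coeff = G.coeff)
    (h : ∀ γ : D.Γ, ∃ γ' : E.Γ, (∀ x, F.pts (γ • x) = γ' • F.pts x) ∧
      (∀ x, G.pts (γ • x) = γ' • G.pts x) ∧ ∀ a, F.coeff (D.ρ γ a) = E.ρ γ' (F.coeff a)) :
    SimplicialObject.Homotopy (simplicialChainsMap F) (simplicialChainsMap G) where
  h {n} j := chainHom (D := D) (E := E) (m := n) (k := n + 1)
    (prismFun F.pts G.pts j) F.coeff fun γ => by
      obtain ⟨γ', h₁, h₂, h₃⟩ := h γ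
      refine ⟨γ', fun x => funext fun k => ?_, h₃⟩
      dsimp only [Pi.smul_apply, prismFun]
      split_ifs
      · exact h₁ _
      · exact h₂ _
  h_zero_comp_δ_zero n := by
    refine chainHom_comp_eq (t := prismFun F.pts G.pts 0) (t' := fun y => y ∘ Fin.succAbove 0)
      (t'' := fun x => G.pts ∘ x) (α := F.coeff) (α' := AddMonoidHom.id _) (α'' := G.coeff)
      (fun x => funext fun k => ?_) (fun a => by rw [hc]; rfl)
    simp [prismFun]
  h_last_comp_δ_last n := by
    refine chainHom_comp_eq (t := prismFun F.pts G.pts (Fin.last n))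
      (t' := fun y => y ∘ Fin.succAbove (Fin.last _))
      (t'' := fun x => F.pts ∘ x) (α := F.coeff) (α' := AddMonoidHom.id _) (α'' := F.coeff)
      (fun x => funext fun k => ?_) (fun a => rfl)
    simp [prismFun, Fin.le_last]
  h_succ_comp_δ_castSucc_of_lt i j hij := by
    refine chainHom_comp_eq_comp (t := prismFun F.pts G.pts j.succ)
      (t' := fun y => y ∘ Fin.succAbove i.castSucc) (s := fun x => x ∘ Fin.succAbove i)
      (s' := prismFun F.pts G.pts j)
      (α := F.coeff) (α' := AddMonoidHom.id _) (β := AddMonoidHom.id _) (β' := F.coeff)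
      (fun x => funext fun k => ?_) (fun a => rfl)
    have h₁ : Fin.succAbove i.castSucc k ≤ j.succ.castSucc ↔ k ≤ j.castSucc := by
      simp only [Fin.le_def, Fin.val_castSucc, Fin.val_succ, val_succAbove] at *
      split_ifs <;> omega
    have h₂ : Fin.predAbove j.succ (Fin.succAbove i.castSucc k) =
        i.succAbove (j.predAbove k) := by
      simp only [Fin.ext_iff, Fin.le_def, Fin.val_castSucc, Fin.val_succ,
        val_succAbove, val_predAbove] at *
      split_ifs <;> omega
    simp only [Function.comp_apply, prismFun, h₁, h₂]
  h_succ_comp_δ_castSucc_succ j := by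
    refine chainHom_comp_eq_comp (t := prismFun F.pts G.pts j.succ)
      (t' := fun y => y ∘ Fin.succAbove j.castSucc.succ)
      (s := prismFun F.pts G.pts j.castSucc) (s' := fun y => y ∘ Fin.succAbove j.castSucc.succ)
      (α := F.coeff) (α' := AddMonoidHom.id _) (β := F.coeff) (β' := AddMonoidHom.id _)
      (fun x => funext fun k => ?_) (fun a => rfl)
    have h₁ : Fin.succAbove j.castSucc.succ k ≤ j.succ.castSucc ↔
        Fin.succAbove j.castSucc.succ k ≤ j.castSucc.castSucc := by
      simp only [Fin.le_def, Fin.val_castSucc, Fin.val_succ, val_succAbove] at *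
      split_ifs <;> omega
    have h₂ : Fin.predAbove j.succ (Fin.succAbove j.castSucc.succ k) =
        Fin.predAbove j.castSucc (Fin.succAbove j.castSucc.succ k) := by
      simp only [Fin.ext_iff, Fin.le_def, Fin.val_castSucc, Fin.val_succ,
        val_succAbove, val_predAbove] at *
      split_ifs <;> omega
    simp only [Function.comp_apply, prismFun, h₁, h₂]
  h_castSucc_comp_δ_succ_of_lt i j hji := by
    refine chainHom_comp_eq_comp (t := prismFun F.pts G.pts j.castSucc)
      (t' := fun y => y ∘ Fin.succAbove i.succ) (s := fun x => x ∘ Fin.succAbove i)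
      (s' := prismFun F.pts G.pts j)
      (α := F.coeff) (α' := AddMonoidHom.id _) (β := AddMonoidHom.id _) (β' := F.coeff)
      (fun x => funext fun k => ?_) (fun a => rfl)
    have h₁ : Fin.succAbove i.succ k ≤ j.castSucc.castSucc ↔ k ≤ j.castSucc := by
      simp only [Fin.le_def, Fin.lt_def, Fin.val_castSucc, Fin.val_succ, val_succAbove] at *
      split_ifs <;> omega
    have h₂ : Fin.predAbove j.castSucc (Fin.succAbove i.succ k) =
        i.succAbove (j.predAbove k) := by
      simp only [Fin.ext_iff, Fin.le_def, Fin.lt_def, Fin.val_castSucc, Fin.val_succ,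
        val_succAbove, val_predAbove] at *
      split_ifs <;> omega
    simp only [Function.comp_apply, prismFun, h₁, h₂]
  h_comp_σ_castSucc_of_le i j hij := by
    refine chainHom_comp_eq_comp (t := prismFun F.pts G.pts j)
      (t' := fun y => y ∘ Fin.predAbove i.castSucc) (s := fun x => x ∘ Fin.predAbove i)
      (s' := prismFun F.pts G.pts j.succ)
      (α := F.coeff) (α' := AddMonoidHom.id _) (β := AddMonoidHom.id _) (β' := F.coeff)
      (fun x => funext fun k => ?_) (fun a => rfl)
    have h₁ : Fin.predAbove i.castSucc k ≤ j.castSucc ↔ k ≤ j.succ.castSucc := by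
      simp only [Fin.le_def, Fin.val_castSucc, Fin.val_succ, val_predAbove] at *
      split_ifs <;> omega
    have h₂ : Fin.predAbove j (Fin.predAbove i.castSucc k) =
        i.predAbove (j.succ.predAbove k) := by
      simp only [Fin.ext_iff, Fin.le_def, Fin.val_castSucc, Fin.val_succ, val_predAbove] at *
      split_ifs <;> omega
    simp only [Function.comp_apply, prismFun, h₁, h₂]
  h_comp_σ_succ_of_lt i j hji := by
    refine chainHom_comp_eq_comp (t := prismFun F.pts G.pts j)
      (t' := fun y => y ∘ Fin.predAbove i.succ) (s := fun x => x ∘ Fin.predAbove i)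
      (s' := prismFun F.pts G.pts j.castSucc)
      (α := F.coeff) (α' := AddMonoidHom.id _) (β := AddMonoidHom.id _) (β' := F.coeff)
      (fun x => funext fun k => ?_) (fun a => rfl)
    have h₁ : Fin.predAbove i.succ k ≤ j.castSucc ↔ k ≤ j.castSucc.castSucc := by
      simp only [Fin.le_def, Fin.val_castSucc, Fin.val_succ, val_predAbove] at *
      split_ifs <;> omega
    have h₂ : Fin.predAbove j (Fin.predAbove i.succ k) =
        i.predAbove (j.castSucc.predAbove k) := by
      simp only [Fin.ext_iff, Fin.le_def, Fin.val_castSucc, Fin.val_succ, val_predAbove] at *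
      split_ifs <;> omega
    simp only [Function.comp_apply, prismFun, h₁, h₂]

lemma homology_map_eq_of_prism {D E : BarDatum.{u}} (F G : D ⟶ E) (hc : F.coeff = G.coeff)
    (h : ∀ γ : D.Γ, ∃ γ' : E.Γ, (∀ x, F.pts (γ • x) = γ' • F.pts x) ∧
      (∀ x, G.pts (γ • x) = γ' • G.pts x) ∧ ∀ a, F.coeff (D.ρ γ a) = E.ρ γ' (F.coeff a)) (q : ℕ) :
    (homology q).map F = (homology q).map G :=
  (prism F G hc h).map_homology_eq q

lemma homology_map_eq_of_smul {D E : BarDatum.{u}} (F G : D ⟶ E) (γ : E.Γ)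
    (h₁ : ∀ x, G.pts x = γ • F.pts x) (h₂ : ∀ a, G.coeff a = E.ρ γ (F.coeff a)) (q : ℕ) :
    (homology q).map F = (homology q).map G := by
  have h : simplicialChainsMap F = simplicialChainsMap G := by
    exact NatTrans.ext (funext fun Δ => chainHom_eq_of_smul (t := fun x => F.pts ∘ x)
      (t' := fun x => G.pts ∘ x) γ (fun x => funext fun k => h₁ (x k)) h₂)
  exact congrArg (fun t => (HomologicalComplex.homologyFunctor _ _ q).map
    ((alternatingFaceMapComplex AddCommGrpCat.{u}).map t)) h

end BarDatum

/-! ## Groups with a module, and group extensions with a module -/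

/-- A group `G` together with a `G`-module `A`. -/
structure GrpMod : Type (u + 1) where
  G : Type u
  A : Type u
  [grp : Group G]
  [ab : AddCommGroup A]
  ρ : G →* AddMonoid.End A

namespace GrpMod

attribute [instance] grp ab

/-- A group homomorphism together with an equivariant homomorphism of modules. -/
@[ext]
structure Hom (M M' : GrpMod.{u}) : Type u where
  hom : M.G →* M'.G
  coeff : M.A →+ M'.A
  equivariant : ∀ g a, coeff (M.ρ g a) = M'.ρ (hom g) (coeff a)

instance : Category GrpMod.{u} where
  Hom := Hom
  id M := ⟨MonoidHom.id _, AddMonoidHom.id _, fun _ _ => rfl⟩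
  comp f f' := ⟨f'.hom.comp f.hom, f'.coeff.comp f.coeff, fun g a => by
    simp [f.equivariant, f'.equivariant]⟩

/-- `G` acting on itself by left translations, and on `A`. -/
def toBarDatum : GrpMod.{u} ⥤ BarDatum.{u} where
  obj M := { Γ := M.G, X := M.G, A := M.A, ρ := M.ρ }
  map f := ⟨f.hom, f.coeff, fun g => ⟨f.hom g, fun x => map_mul f.hom g x, f.equivariant g⟩⟩

/-- The complex `B_*(G) ⊗_G A`, where `B_*(G)` is the standard resolution. It is written in the
coordinates in which the usual generator `g₀ ⊗ g₁ ⊗ ⋯ ⊗ gₘ` of `B_m(G)` becomes the tuple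
`(g₀, g₀g₁, …, g₀g₁⋯gₘ)`: replacing `gᵢ ⊗ gᵢ₊₁` by `gᵢgᵢ₊₁`, or dropping `gₘ`, becomes the
omission of the entry of index `i`, respectively `m`. -/
def bar : GrpMod.{u} ⥤ ChainComplex AddCommGrpCat.{u} ℕ :=
  toBarDatum ⋙ BarDatum.complex

/-- The homology groups `H_q(G, A)`. -/
def homology (q : ℕ) : GrpMod.{u} ⥤ AddCommGrpCat.{u} :=
  bar ⋙ HomologicalComplex.homologyFunctor _ _ q

end GrpMod

/-- A short exact sequence of groups `1 → N → P → Q → 1` together with a `P`-module `A`. -/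
structure GrpExtMod : Type (u + 1) where
  N : Type u
  P : Type u
  Q : Type u
  A : Type u
  [grpN : Group N]
  [grpP : Group P]
  [grpQ : Group Q]
  [ab : AddCommGroup A]
  i : N →* P
  p : P →* Q
  inj : Function.Injective i
  surj : Function.Surjective p
  exact : i.range = p.ker
  ρ : P →* AddMonoid.End A

namespace GrpExtMod

attribute [instance] grpN grpP grpQ ab

/-- A morphism of short exact sequences together with an equivariant homomorphism of modules. -/
@[ext]
structure Hom (X Y : GrpExtMod.{u}) : Type u where
  homN : X.N →* Y.N
  homP : X.P →* Y.P
  homQ : X.Q →* Y.Q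
  coeff : X.A →+ Y.A
  comm_i : ∀ n, homP (X.i n) = Y.i (homN n)
  comm_p : ∀ x, homQ (X.p x) = Y.p (homP x)
  equivariant : ∀ x a, coeff (X.ρ x a) = Y.ρ (homP x) (coeff a)

instance : Category GrpExtMod.{u} where
  Hom := Hom
  id X := ⟨MonoidHom.id _, MonoidHom.id _, MonoidHom.id _, AddMonoidHom.id _,
    fun _ => rfl, fun _ => rfl, fun _ _ => rfl⟩
  comp f g := ⟨g.homN.comp f.homN, g.homP.comp f.homP, g.homQ.comp f.homQ, g.coeff.comp f.coeff,
    fun n => by simp [f.comm_i, g.comm_i], fun x => by simp [f.comm_p, g.comm_p],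
    fun x a => by simp [f.equivariant, g.equivariant]⟩

/-- The group `P` acting on `A`. -/
def mid : GrpExtMod.{u} ⥤ GrpMod.{u} where
  obj X := { G := X.P, A := X.A, ρ := X.ρ }
  map f := ⟨f.homP, f.coeff, f.equivariant⟩

/-- The group `N` acting on `A` through `N → P`. -/
def sub : GrpExtMod.{u} ⥤ GrpMod.{u} where
  obj X := { G := X.N, A := X.A, ρ := X.ρ.comp X.i }
  map {X Y} f := ⟨f.homN, f.coeff, fun n a => by
    change f.coeff (X.ρ (X.i n) a) = Y.ρ (Y.i (f.homN n)) (f.coeff a)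
    rw [f.equivariant, f.comm_i]⟩

/-- The group `N` acting on `P` by left translations and on `A`; the associated complex is
`B_*(P) ⊗_N A`. -/
def relBar : GrpExtMod.{u} ⥤ BarDatum.{u} where
  obj X := { Γ := X.N, X := X.P, A := X.A, act := MulAction.compHom X.P X.i, ρ := X.ρ.comp X.i }
  map {X Y} f := ⟨f.homP, f.coeff, fun n => ⟨f.homN n, fun x => by
    change f.homP (X.i n * x) = Y.i (f.homN n) * f.homP x
    rw [map_mul, f.comm_i], fun a => by
    change f.coeff (X.ρ (X.i n) a) = Y.ρ (Y.i (f.homN n)) (f.coeff a)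
    rw [f.equivariant, f.comm_i]⟩⟩

/-- The inclusion `B_*(N) ⊗_N A → B_*(P) ⊗_N A`. -/
def compare (X : GrpExtMod.{u}) : GrpMod.toBarDatum.obj (sub.obj X) ⟶ relBar.obj X :=
  ⟨X.i, AddMonoidHom.id _, fun n => ⟨n, fun x => map_mul X.i n x, fun _ => rfl⟩⟩

lemma compare_naturality {X Y : GrpExtMod.{u}} (f : X ⟶ Y) :
    GrpMod.toBarDatum.map (sub.map f) ≫ compare Y = compare X ≫ relBar.map f :=
  BarDatum.Hom.ext (funext fun n => (f.comm_i n).symm) rfl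

lemma p_i (X : GrpExtMod.{u}) (n : X.N) : X.p (X.i n) = 1 := by
  rw [← MonoidHom.mem_ker, ← X.exact]
  exact ⟨n, rfl⟩

lemma exists_retraction (X : GrpExtMod.{u}) :
    ∃ r : X.P → X.N, ∀ n x, r (X.i n * x) = n * r x := by
  have h (x : X.P) : ∃ n, X.i n = x * (Function.surjInv X.surj (X.p x))⁻¹ := by
    rw [← MonoidHom.mem_range, X.exact, MonoidHom.mem_ker, map_mul, map_inv,
      Function.surjInv_eq X.surj, mul_inv_cancel]
  choose r hr using h
  refine ⟨r, fun n x => X.inj ?_⟩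
  rw [map_mul, hr, hr, map_mul, p_i, one_mul, mul_assoc]

/-- The complex `B_*(P) ⊗_N A` computes the homology of `N` with coefficients in `A`. -/
instance isIso_compare (X : GrpExtMod.{u}) (q : ℕ) :
    IsIso ((BarDatum.homology q).map (compare X)) := by
  obtain ⟨r, hr⟩ := X.exists_retraction
  let R : relBar.obj X ⟶ GrpMod.toBarDatum.obj (sub.obj X) :=
    ⟨r, AddMonoidHom.id _, fun n => ⟨n, hr n, fun _ => rfl⟩⟩
  have h₁ : ∀ n m : X.N, r (X.i (n * m)) = n * r (X.i m) := fun n m => by rw [map_mul, hr]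
  have h₂ : ∀ (n : X.N) (x : X.P), X.i (r (X.i n * x)) = X.i n * X.i (r x) := fun n x => by
    rw [hr, map_mul]
  refine ⟨(BarDatum.homology q).map R, ?_, ?_⟩
  · rw [← CategoryTheory.Functor.map_comp, ← CategoryTheory.Functor.map_id]
    exact BarDatum.homology_map_eq_of_prism (compare X ≫ R) (𝟙 _) rfl
      (fun n => ⟨n, h₁ n, fun _ => rfl, fun _ => rfl⟩) q
  · rw [← CategoryTheory.Functor.map_comp, ← CategoryTheory.Functor.map_id]
    exact BarDatum.homology_map_eq_of_prism (R ≫ compare X) (𝟙 _) rfl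
      (fun n => ⟨n, h₂ n, fun _ => rfl, fun _ => rfl⟩) q

/-- The isomorphism from `H_q(N, A)` to the homology of `B_*(P) ⊗_N A`. -/
def compareIso (X : GrpExtMod.{u}) (q : ℕ) :
    (GrpMod.homology q).obj (sub.obj X) ≅ (BarDatum.homology q).obj (relBar.obj X) :=
  @asIso _ _ _ _ ((BarDatum.homology q).map (compare X)) (isIso_compare X q)

lemma ρ_mul (X : GrpExtMod.{u}) (x y : X.P) (a : X.A) : X.ρ (x * y) a = X.ρ x (X.ρ y a) := by
  rw [map_mul]
  rfl

lemma act_equivariant (X : GrpExtMod.{u}) (x : X.P) (n : X.N) :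
    ∃ n' : X.N, (∀ y : X.P, x * (X.i n * y) = X.i n' * (x * y)) ∧
      ∀ a : X.A, X.ρ x (X.ρ (X.i n) a) = X.ρ (X.i n') (X.ρ x a) := by
  obtain ⟨n', hn'⟩ : x * X.i n * x⁻¹ ∈ X.i.range := by
    rw [X.exact, MonoidHom.mem_ker, map_mul, map_mul, map_inv, p_i, mul_one, mul_inv_cancel]
  refine ⟨n', fun y => ?_, fun a => ?_⟩
  · rw [hn']
    group
  · rw [hn', ← ρ_mul, ← ρ_mul, inv_mul_cancel_right]

/-- The action `x (b ⊗ a) = xb ⊗ xa` of `x : P` on `B_*(P) ⊗_N A`. -/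
def act (X : GrpExtMod.{u}) (x : X.P) : relBar.obj X ⟶ relBar.obj X :=
  ⟨fun (y : X.P) => x * y, X.ρ x, act_equivariant X x⟩

lemma exists_mul_of_p_eq (X : GrpExtMod.{u}) {x y : X.P} (h : X.p x = X.p y) :
    ∃ n : X.N, (∀ z : X.P, y * z = X.i n * (x * z)) ∧
      ∀ a : X.A, X.ρ y a = X.ρ (X.i n) (X.ρ x a) := by
  obtain ⟨n, hn⟩ : y * x⁻¹ ∈ X.i.range := by
    rw [X.exact, MonoidHom.mem_ker, map_mul, map_inv, h, mul_inv_cancel]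
  refine ⟨n, fun z => ?_, fun a => ?_⟩
  · rw [hn, mul_assoc, inv_mul_cancel_left]
  · rw [hn, ← ρ_mul, inv_mul_cancel_right]

/-- The induced map on the homology of `B_*(P) ⊗_N A` depends only on the class of `x` in `Q`. -/
lemma homology_act_eq (X : GrpExtMod.{u}) (q : ℕ) {x y : X.P} (h : X.p x = X.p y) :
    (BarDatum.homology q).map (act X x) = (BarDatum.homology q).map (act X y) := by
  obtain ⟨n, h₁, h₂⟩ := exists_mul_of_p_eq X h
  exact BarDatum.homology_map_eq_of_smul (act X x) (act X y) n h₁ h₂ q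

/-- The endomorphism of `H_q(N, A)` given by the action of `x : P` on `B_*(P) ⊗_N A`. -/
def homologyAct (X : GrpExtMod.{u}) (q : ℕ) (x : X.P) :
    (GrpMod.homology q).obj (sub.obj X) ⟶ (GrpMod.homology q).obj (sub.obj X) :=
  (compareIso X q).hom ≫ (BarDatum.homology q).map (act X x) ≫ (compareIso X q).inv

lemma homologyAct_eq (X : GrpExtMod.{u}) (q : ℕ) {x y : X.P} (h : X.p x = X.p y) :
    homologyAct X q x = homologyAct X q y := by
  rw [homologyAct, homologyAct, homology_act_eq X q h]

lemma homologyAct_one (X : GrpExtMod.{u}) (q : ℕ) : homologyAct X q 1 = 𝟙 _ := by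
  have h : act X 1 = 𝟙 _ := by
    refine BarDatum.Hom.ext (funext fun (y : X.P) => one_mul y) ?_
    change X.ρ 1 = _
    rw [map_one]
    rfl
  rw [homologyAct, h, CategoryTheory.Functor.map_id, Category.id_comp, Iso.hom_inv_id]

lemma homologyAct_mul (X : GrpExtMod.{u}) (q : ℕ) (x y : X.P) :
    homologyAct X q (x * y) = homologyAct X q y ≫ homologyAct X q x := by
  have h : act X (x * y) = act X y ≫ act X x := by
    refine BarDatum.Hom.ext (funext fun (z : X.P) => mul_assoc x y z) ?_
    change X.ρ (x * y) = _
    rw [map_mul]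
    rfl
  simp [homologyAct, h]

lemma homologyAct_naturality {X Y : GrpExtMod.{u}} (f : X ⟶ Y) (q : ℕ) (x : X.P) :
    homologyAct X q x ≫ (GrpMod.homology q).map (sub.map f) =
      (GrpMod.homology q).map (sub.map f) ≫ homologyAct Y q (f.homP x) := by
  have h₁ : (GrpMod.homology q).map (sub.map f) ≫ (compareIso Y q).hom =
      (compareIso X q).hom ≫ (BarDatum.homology q).map (relBar.map f) := by
    change (BarDatum.homology q).map (GrpMod.toBarDatum.map (sub.map f)) ≫
      (BarDatum.homology q).map (compare Y) = (BarDatum.homology q).map (compare X) ≫ _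
    rw [← CategoryTheory.Functor.map_comp, compare_naturality, CategoryTheory.Functor.map_comp]
  have h₂ : act X x ≫ relBar.map f = relBar.map f ≫ act Y (f.homP x) :=
    BarDatum.Hom.ext (funext fun (y : X.P) => map_mul f.homP x y)
      (AddMonoidHom.ext fun a => f.equivariant x a)
  have h₃ : (compareIso X q).inv ≫ (GrpMod.homology q).map (sub.map f) =
      (BarDatum.homology q).map (relBar.map f) ≫ (compareIso Y q).inv := by
    rw [Iso.inv_comp_eq, ← Category.assoc, ← h₁, Category.assoc, Iso.hom_inv_id, Category.comp_id]
  have h₄ : (BarDatum.homology q).map (act X x) ≫ (BarDatum.homology q).map (relBar.map f) =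
      (BarDatum.homology q).map (relBar.map f) ≫
        (BarDatum.homology q).map (act Y (f.homP x)) := by
    rw [← CategoryTheory.Functor.map_comp, h₂, CategoryTheory.Functor.map_comp]
  simp only [homologyAct, Category.assoc]
  rw [h₃, reassoc_of% h₄, reassoc_of% h₁]

lemma p_surjInv (X : GrpExtMod.{u}) (y : X.Q) : X.p (Function.surjInv X.surj y) = y :=
  Function.surjInv_eq X.surj y

/-- The action of `Q` on `H_q(N, A)`. -/
def homologyρ (X : GrpExtMod.{u}) (q : ℕ) :
    X.Q →* AddMonoid.End ((GrpMod.homology q).obj (sub.obj X)) where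
  toFun y := (homologyAct X q (Function.surjInv X.surj y)).hom
  map_one' := by
    rw [homologyAct_eq X q (y := 1) (by rw [p_surjInv, map_one]), homologyAct_one]
    rfl
  map_mul' y z := by
    rw [homologyAct_eq X q (y := Function.surjInv X.surj y * Function.surjInv X.surj z)
      (by simp only [map_mul, p_surjInv]), homologyAct_mul]
    rfl

/-- The group `Q` together with the `Q`-module `H_q(N, A)`. -/
def quotHomology (q : ℕ) : GrpExtMod.{u} ⥤ GrpMod.{u} where
  obj X := { G := X.Q, A := (GrpMod.homology q).obj (sub.obj X), ρ := homologyρ X q }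
  map {X Y} f := ⟨f.homQ, ((GrpMod.homology q).map (sub.map f)).hom, fun y a => by
    have h := homologyAct_naturality f q (Function.surjInv X.surj y)
    rw [homologyAct_eq Y q (y := Function.surjInv Y.surj (f.homQ y))
      (by rw [← f.comm_p, p_surjInv, p_surjInv])] at h
    exact congrArg (fun t => t.hom a) h⟩
  map_id X := GrpMod.Hom.ext rfl (by
    change ((GrpMod.homology q).map (sub.map (𝟙 X))).hom = _
    rw [CategoryTheory.Functor.map_id, CategoryTheory.Functor.map_id]
    rfl)
  map_comp f g := GrpMod.Hom.ext rfl (by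
    change ((GrpMod.homology q).map (sub.map (f ≫ g))).hom = _
    rw [CategoryTheory.Functor.map_comp, CategoryTheory.Functor.map_comp]
    rfl)

end GrpExtMod

/-! ## Homology of simplicial groups with coefficients

A simplicial group `G_*` acting on an abelian simplicial group `A_*` is a simplicial object
of `GrpMod`. -/

/-- The bicomplex `B_q(G_p) ⊗_{G_p} A_p`. -/
def barBicomplex (M : SimplicialObject GrpMod.{u}) :
    HomologicalComplex₂ AddCommGrpCat.{u} (ComplexShape.down ℕ) (ComplexShape.down ℕ) :=
  (alternatingFaceMapComplex (ChainComplex AddCommGrpCat.{u} ℕ)).obj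
    (((SimplicialObject.whiskering _ _).obj GrpMod.bar).obj M)

/-- The homology `H_n(G_*, A_*)` of the total complex of `B(G_*, A_*)`. -/
def simplicialHomology (M : SimplicialObject GrpMod.{u}) (n : ℕ) : AddCommGrpCat.{u} :=
  ((barBicomplex M).total (ComplexShape.down ℕ)).homology n

/-! ## Crossed modules -/

/-- A crossed module `μ : H → G`, the action of `G` on the group `H` being given by the
instance. -/
structure CrossedModule (H G : Type u) [Group H] [Group G] [MulDistribMulAction G H] where
  μ : H →* G
  μ_smul : ∀ (g : G) (h : H), μ (g • h) = g * μ h * g⁻¹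
  peiffer : ∀ h h' : H, μ h • h' = h * h' * h⁻¹

/-- The action of a crossed module `(H, G, μ)` on an abelian crossed module `(C, A, ν)`, i.e. on
a homomorphism `ν : C → A` of abelian groups (`A` acting trivially on `C`): actions of the group
`G` on `C` and `A` (given by the instances), together with a map `ξ : H × A → C`. -/
structure CrossedModule.Action {H G : Type u} [Group H] [Group G] [MulDistribMulAction G H]
    (X : CrossedModule H G) (C A : Type u) [AddCommGroup C] [AddCommGroup A]
    [DistribMulAction G C] [DistribMulAction G A] where
  ν : C →+ A
  ξ : H → A → C
  ν_smul : ∀ (g : G) (c : C), ν (g • c) = g • ν c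
  ν_ξ : ∀ (h : H) (a : A), ν (ξ h a) = X.μ h • a - a
  ξ_ν : ∀ (h : H) (c : C), ξ h (ν c) = X.μ h • c - c
  smul_ξ : ∀ (g : G) (h : H) (a : A), g • ξ h a = ξ (g • h) (g • a)
  ξ_mul : ∀ (h h' : H) (a : A), ξ (h * h') a = X.μ h • ξ h' a + ξ h a
  ξ_add : ∀ (h : H) (a a' : A), ξ h (a + a') = ξ h a + ξ h a'

/-- A morphism of crossed modules. -/
structure CrossedModule.Hom {H G H' G' : Type u} [Group H] [Group G] [MulDistribMulAction G H]
    [Group H'] [Group G'] [MulDistribMulAction G' H']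
    (X : CrossedModule H G) (X' : CrossedModule H' G') where
  top : H →* H'
  base : G →* G'
  comm : ∀ h, base (X.μ h) = X'.μ (top h)
  top_smul : ∀ (g : G) (h : H), top (g • h) = base g • top h

/-- Short exact sequences of crossed modules `0 → (H', G', μ') → (H, G, μ) → (H'', G'', μ'') → 0`:
both underlying sequences of groups are short exact. -/
structure CrossedModule.IsShortExact {H' G' H G H'' G'' : Type u}
    [Group H'] [Group G'] [MulDistribMulAction G' H'] [Group H] [Group G] [MulDistribMulAction G H]
    [Group H''] [Group G''] [MulDistribMulAction G'' H'']
    {X' : CrossedModule H' G'} {X : CrossedModule H G} {X'' : CrossedModule H'' G''}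
    (i : X'.Hom X) (p : X.Hom X'') : Prop where
  top_injective : Function.Injective i.top
  base_injective : Function.Injective i.base
  top_surjective : Function.Surjective p.top
  base_surjective : Function.Surjective p.base
  top_exact : i.top.range = p.top.ker
  base_exact : i.base.range = p.base.ker

/-! ## Nerves -/

/-- The `n`-simplices of the nerve of the internal category of a crossed module: objects
`x₀, …, xₙ` of `G` and arrows `(hᵢⱼ, xⱼ) : xⱼ → μ(hᵢⱼ) xⱼ = xᵢ` of `H ⋊ G`, for `i ≤ j`, compatible
with the composition. Such a simplex is determined by `(h₀₁, h₁₂, …, hₙ₋₁ₙ, xₙ)`, which can be any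
element of `Hⁿ × G`. -/
@[ext]
structure NerveSimplex {H G : Type u} [Group H] [Group G] [MulDistribMulAction G H]
    (X : CrossedModule H G) (n : ℕ) : Type u where
  pt : Fin (n + 1) → G
  arr : ∀ i j : Fin (n + 1), i ≤ j → H
  target : ∀ i j (h : i ≤ j), pt i = X.μ (arr i j h) * pt j
  comp : ∀ i j k (h : i ≤ j) (h' : j ≤ k), arr i j h * arr j k h' = arr i k (h.trans h')

namespace NerveSimplex

section

variable {H G : Type u} [Group H] [Group G] [MulDistribMulAction G H] {X : CrossedModule H G}
  {n m : ℕ}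

lemma arr_self (x : NerveSimplex X n) (i : Fin (n + 1)) : x.arr i i le_rfl = 1 :=
  mul_eq_left.1 (x.comp i i i le_rfl le_rfl)

lemma smul_smul_arr (x : NerveSimplex X n) {j k : Fin (n + 1)} (h : j ≤ k) (a : H) :
    x.pt j • a = x.arr j k h * (x.pt k • a) * (x.arr j k h)⁻¹ := by
  rw [x.target j k h, mul_smul, X.peiffer]

/-- The product is that of `G` on objects and that of `H ⋊ G` on arrows:
`(h, x) (k, y) = (h · ˣk, xy)`. -/
instance : Mul (NerveSimplex X n) where
  mul x y :=
    { pt i := x.pt i * y.pt i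
      arr i j h := x.arr i j h * x.pt j • y.arr i j h
      target i j h := by
        rw [x.target i j h, y.target i j h, map_mul, X.μ_smul]
        group
      comp i j k h h' := by
        rw [← x.comp i j k h h', ← y.comp i j k h h', smul_smul_arr x h', smul_mul']
        group }

instance : One (NerveSimplex X n) where
  one :=
    { pt _ := 1
      arr _ _ _ := 1
      target _ _ _ := by simp
      comp _ _ _ _ _ := by simp }

instance : Inv (NerveSimplex X n) where
  inv x :=
    { pt i := (x.pt i)⁻¹
      arr i j h := (x.pt j)⁻¹ • (x.arr i j h)⁻¹
      target i j h := by
        rw [x.target i j h, X.μ_smul, map_inv]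
        group
      comp i j k h h' := by
        have key := smul_smul_arr x h' ((x.pt j)⁻¹ • (x.arr i j h)⁻¹)
        rw [smul_inv_smul] at key
        rw [eq_inv_smul_iff, smul_mul', smul_inv_smul, ← x.comp i j k h h', mul_inv_rev]
        generalize x.pt k • (x.pt j)⁻¹ • (x.arr i j h)⁻¹ = s at key ⊢
        rw [key]
        group }

@[simp] lemma mul_pt (x y : NerveSimplex X n) (i) : (x * y).pt i = x.pt i * y.pt i := rfl
@[simp] lemma mul_arr (x y : NerveSimplex X n) (i j h) :
    (x * y).arr i j h = x.arr i j h * x.pt j • y.arr i j h := rfl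
@[simp] lemma one_pt (i) : (1 : NerveSimplex X n).pt i = 1 := rfl
@[simp] lemma one_arr (i j h) : (1 : NerveSimplex X n).arr i j h = 1 := rfl
@[simp] lemma inv_pt (x : NerveSimplex X n) (i) : (x⁻¹).pt i = (x.pt i)⁻¹ := rfl
@[simp] lemma inv_arr (x : NerveSimplex X n) (i j h) :
    (x⁻¹).arr i j h = (x.pt j)⁻¹ • (x.arr i j h)⁻¹ := rfl

instance : Group (NerveSimplex X n) :=
  Group.ofLeftAxioms
    (fun x y z => by ext <;> simp [mul_assoc, mul_smul])
    (fun x => by ext <;> simp)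
    (fun x => by ext <;> simp)

/-- The simplicial operators of the nerve. -/
def restrict (f : Fin (m + 1) →o Fin (n + 1)) : NerveSimplex X n →* NerveSimplex X m where
  toFun x :=
    { pt i := x.pt (f i)
      arr i j h := x.arr (f i) (f j) (f.monotone h)
      target _ _ _ := x.target _ _ _
      comp _ _ _ _ _ := x.comp _ _ _ _ _ }
  map_one' := rfl
  map_mul' _ _ := rfl

/-- Functoriality of the nerve. -/
def mapHom {H' G' : Type u} [Group H'] [Group G'] [MulDistribMulAction G' H']
    {X' : CrossedModule H' G'} (f : X.Hom X') : NerveSimplex X n →* NerveSimplex X' n where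
  toFun x :=
    { pt i := f.base (x.pt i)
      arr i j h := f.top (x.arr i j h)
      target i j h := by rw [x.target i j h, map_mul, f.comm]
      comp i j k h h' := by rw [← map_mul, x.comp] }
  map_one' := by ext <;> simp
  map_mul' x y := by ext <;> simp [f.top_smul]

end

section

variable {H' G' H G H'' G'' : Type u}
  [Group H'] [Group G'] [MulDistribMulAction G' H'] [Group H] [Group G] [MulDistribMulAction G H]
  [Group H''] [Group G''] [MulDistribMulAction G'' H'']
  {X' : CrossedModule H' G'} {X : CrossedModule H G} {X'' : CrossedModule H'' G''}
  {i : X'.Hom X} {p : X.Hom X''} (n : ℕ)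

lemma mapHom_injective (hip : CrossedModule.IsShortExact i p) :
    Function.Injective (mapHom (n := n) i) := by
  intro x y hxy
  ext a b h
  · exact hip.base_injective (congrFun (congrArg pt hxy) a)
  · exact hip.top_injective (congrFun (congrFun (congrFun (congrArg arr hxy) a) b) h)

lemma mapHom_surjective (hip : CrossedModule.IsShortExact i p) :
    Function.Surjective (mapHom (n := n) p) := by
  intro z
  choose l hl using fun a => hip.top_surjective (z.arr a (Fin.last n) (Fin.le_last a))
  obtain ⟨g, hg⟩ := hip.base_surjective (z.pt (Fin.last n))
  refine ⟨⟨fun a => X.μ (l a) * g, fun a b _ => l a * (l b)⁻¹, fun a b _ => ?_,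
    fun a b c _ _ => ?_⟩, ?_⟩
  · rw [← mul_assoc, ← map_mul, inv_mul_cancel_right]
  · group
  · ext a b h
    · change p.base (X.μ (l a) * g) = z.pt a
      rw [map_mul, p.comm, hl, hg, ← z.target]
    · change p.top (l a * (l b)⁻¹) = z.arr a b h
      rw [map_mul, map_inv, hl, hl, mul_inv_eq_iff_eq_mul, z.comp]

lemma mapHom_exact (hip : CrossedModule.IsShortExact i p) :
    (mapHom (n := n) i).range = (mapHom (n := n) p).ker := by
  ext x
  constructor
  · rintro ⟨y, rfl⟩
    refine NerveSimplex.ext (funext fun a => ?_) (funext fun a => funext fun b => funext fun h => ?_)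
    · exact MonoidHom.mem_ker.1 (hip.base_exact ▸ ⟨y.pt a, rfl⟩)
    · exact MonoidHom.mem_ker.1 (hip.top_exact ▸ ⟨y.arr a b h, rfl⟩)
  · intro hx
    have h₁ (a) : ∃ g, i.base g = x.pt a := by
      rw [← MonoidHom.mem_range, hip.base_exact]
      exact congrFun (congrArg pt (MonoidHom.mem_ker.1 hx)) a
    have h₂ (a b h) : ∃ k, i.top k = x.arr a b h := by
      rw [← MonoidHom.mem_range, hip.top_exact]
      exact congrFun (congrFun (congrFun (congrArg arr (MonoidHom.mem_ker.1 hx)) a) b) h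
    choose g hg using h₁
    choose k hk using h₂
    refine ⟨⟨g, k, fun a b h => hip.base_injective ?_, fun a b c h h' => hip.top_injective ?_⟩, ?_⟩
    · rw [map_mul, i.comm, hg, hg, hk, x.target a b h]
    · rw [map_mul, hk, hk, hk, x.comp]
    · ext a b h
      · exact hg a
      · exact hk a b h

end

end NerveSimplex

/-- The nerve of a crossed module, a simplicial group. -/
def CrossedModule.nerve {H G : Type u} [Group H] [Group G] [MulDistribMulAction G H]
    (X : CrossedModule H G) : SimplicialObject GrpCat.{u} where
  obj Δ := GrpCat.of (NerveSimplex X Δ.unop.len)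
  map f := GrpCat.ofHom (NerveSimplex.restrict f.unop.toOrderHom)

namespace CrossedModule.Action

variable {H G : Type u} [Group H] [Group G] [MulDistribMulAction G H] {X : CrossedModule H G}
  {C A : Type u} [AddCommGroup C] [AddCommGroup A] [DistribMulAction G C] [DistribMulAction G A]
  (M : X.Action C A)

/-- The `n`-simplices of the nerve of the abelian crossed module `ν : C → A`: objects
`a₀, …, aₙ` of `A` and arrows `(cᵢⱼ, aⱼ) : aⱼ → ν(cᵢⱼ) + aⱼ = aᵢ` of `C × A`, for `i ≤ j`, compatible
with the composition. -/
def coeffNerve (n : ℕ) : AddSubgroup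
    ((Fin (n + 1) → A) × ({ij : Fin (n + 1) × Fin (n + 1) // ij.1 ≤ ij.2} → C)) where
  carrier := {z | (∀ i j (h : i ≤ j), z.1 i = M.ν (z.2 ⟨(i, j), h⟩) + z.1 j) ∧
    ∀ i j k (h : i ≤ j) (h' : j ≤ k),
      z.2 ⟨(i, j), h⟩ + z.2 ⟨(j, k), h'⟩ = z.2 ⟨(i, k), h.trans h'⟩}
  zero_mem' := by simp
  add_mem' {z w} hz hw := by
    refine ⟨fun i j h => ?_, fun i j k h h' => ?_⟩
    · simp only [Prod.fst_add, Prod.snd_add, Pi.add_apply, map_add, hz.1 i j h, hw.1 i j h]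
      abel
    · simp only [Prod.snd_add, Pi.add_apply, ← hz.2 i j k h h', ← hw.2 i j k h h']
      abel
  neg_mem' {z} hz := by
    refine ⟨fun i j h => ?_, fun i j k h h' => ?_⟩
    · simp only [Prod.fst_neg, Prod.snd_neg, Pi.neg_apply, map_neg, hz.1 i j h]
      abel
    · simp only [Prod.snd_neg, Pi.neg_apply, ← hz.2 i j k h h']
      abel

/-- The simplicial operators of the nerve of `ν : C → A`. -/
def coeffRestrict {m n : ℕ} (f : Fin (m + 1) →o Fin (n + 1)) :
    M.coeffNerve n →+ M.coeffNerve m where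
  toFun z := ⟨(fun i => z.1.1 (f i), fun ij => z.1.2 ⟨(f ij.1.1, f ij.1.2), f.monotone ij.2⟩),
    fun _ _ _ => z.2.1 _ _ _, fun _ _ _ _ _ => z.2.2 _ _ _ _ _⟩
  map_zero' := rfl
  map_add' _ _ := rfl

lemma ξ_zero (h : H) : M.ξ h 0 = 0 := by
  simpa using M.ξ_add h 0 0

lemma ξ_one (a : A) : M.ξ 1 a = 0 := by
  simpa using M.ξ_mul 1 1 a

/-- The action of the nerve of `(H, G, μ)` on the nerve of `(C, A, ν)`. In the semidirect product
`(C ⋊ H) ⋊ (A ⋊ G)` the conjugation action of the arrow `(h, x)` on the arrow `(c, a)` is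
`(h, x) · (c, a) = (μ(h)x · c + ξ(h, x · a), x · a)`. -/
def nerveSMul {n : ℕ} (x : NerveSimplex X n) : AddMonoid.End (M.coeffNerve n) :=
    { toFun z := ⟨(fun i => x.pt i • z.1.1 i,
          fun ij => (X.μ (x.arr ij.1.1 ij.1.2 ij.2) * x.pt ij.1.2) • z.1.2 ij +
            M.ξ (x.arr ij.1.1 ij.1.2 ij.2) (x.pt ij.1.2 • z.1.1 ij.1.2)), by
        refine ⟨fun i j h => ?_, fun i j k h h' => ?_⟩
        · simp only [map_add, M.ν_smul, M.ν_ξ, ← x.target, z.2.1 i j h, smul_add]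
          rw [x.target i j h]
          simp only [mul_smul]
          abel
        · have e := z.2.1 j k h'
          simp only [← x.target]
          rw [← z.2.2 i j k h h', ← x.comp i j k h h', M.ξ_mul, e, smul_add, smul_add, M.ξ_add,
            ← M.ν_smul, M.ξ_ν, smul_smul, ← x.target i j h, x.target j k h']
          have e' : (X.μ (x.arr j k h') * x.pt k) • z.1.1 k =
              M.ν (M.ξ (x.arr j k h') (x.pt k • z.1.1 k)) + x.pt k • z.1.1 k := by
            rw [M.ν_ξ, mul_smul]
            abel
          rw [e', M.ξ_add, M.ξ_ν]
          abel⟩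
      map_zero' := by
        ext <;> simp [M.ξ_zero]
      map_add' z w := by
        ext i
        · simp
        · simp only [AddSubgroup.coe_add, Prod.fst_add, Prod.snd_add, Pi.add_apply, smul_add,
            M.ξ_add]
          abel }

/-- The action of the group of `n`-simplices of the nerve of `(H, G, μ)` on that of
`(C, A, ν)`. -/
def nerveρ (n : ℕ) : NerveSimplex X n →* AddMonoid.End (M.coeffNerve n) where
  toFun x := M.nerveSMul x
  map_one' := by
    ext z i
    · exact one_smul _ _
    · change (X.μ 1 * 1) • z.1.2 i + M.ξ 1 ((1 : G) • z.1.1 i.1.2) = z.1.2 i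
      simp [M.ξ_one]
  map_mul' x y := by
    ext z i
    · exact mul_smul _ _ _
    · obtain ⟨⟨i, j⟩, h⟩ := i
      change (X.μ (x.arr i j h * x.pt j • y.arr i j h) * (x.pt j * y.pt j)) • z.1.2 ⟨(i, j), h⟩ +
          M.ξ (x.arr i j h * x.pt j • y.arr i j h) ((x.pt j * y.pt j) • z.1.1 j) =
        (X.μ (x.arr i j h) * x.pt j) • ((X.μ (y.arr i j h) * y.pt j) • z.1.2 ⟨(i, j), h⟩ +
          M.ξ (y.arr i j h) (y.pt j • z.1.1 j)) + M.ξ (x.arr i j h) (x.pt j • y.pt j • z.1.1 j)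
      rw [M.ξ_mul, map_mul, X.μ_smul, smul_add, mul_smul (x.pt j) (y.pt j) (z.1.1 j), ← M.smul_ξ,
        ← add_assoc]
      simp only [smul_smul]
      congr 3
      group

/-- The nerve of `(H, G, μ)` acting on the nerve of `(C, A, ν)`. -/
def nerve : SimplicialObject GrpMod.{u} where
  obj Δ := { G := X.nerve.obj Δ, A := M.coeffNerve Δ.unop.len, ρ := M.nerveρ Δ.unop.len }
  map f := ⟨(X.nerve.map f).hom, M.coeffRestrict f.unop.toOrderHom, fun _ _ => rfl⟩

/-- The homology groups `H_n((H, G, μ), (C, A, ν))`. -/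
def homology (n : ℕ) : AddCommGrpCat.{u} :=
  simplicialHomology M.nerve n

end CrossedModule.Action

namespace CrossedModule.IsShortExact

variable {H' G' H G H'' G'' : Type u}
  [Group H'] [Group G'] [MulDistribMulAction G' H'] [Group H] [Group G] [MulDistribMulAction G H]
  [Group H''] [Group G''] [MulDistribMulAction G'' H'']
  {X' : CrossedModule H' G'} {X : CrossedModule H G} {X'' : CrossedModule H'' G''}
  {i : X'.Hom X} {p : X.Hom X''}
  {C A : Type u} [AddCommGroup C] [AddCommGroup A] [DistribMulAction G C] [DistribMulAction G A]

/-- The short exact sequence of simplicial groups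
`1 → Nerve_*(H', G', μ') → Nerve_*(H, G, μ) → Nerve_*(H'', G'', μ'') → 1`, together with the
action of `Nerve_*(H, G, μ)` on `Nerve_*(C, A, ν)`. -/
def nerve (hip : CrossedModule.IsShortExact i p) (M : X.Action C A) :
    SimplicialObject GrpExtMod.{u} where
  obj Δ :=
    { N := X'.nerve.obj Δ
      P := X.nerve.obj Δ
      Q := X''.nerve.obj Δ
      A := M.coeffNerve Δ.unop.len
      i := NerveSimplex.mapHom i
      p := NerveSimplex.mapHom p
      inj := NerveSimplex.mapHom_injective _ hip
      surj := NerveSimplex.mapHom_surjective _ hip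
      exact := NerveSimplex.mapHom_exact _ hip
      ρ := M.nerveρ Δ.unop.len }
  map f := ⟨(X'.nerve.map f).hom, (X.nerve.map f).hom, (X''.nerve.map f).hom,
    M.coeffRestrict f.unop.toOrderHom, fun _ => rfl, fun _ => rfl, fun _ _ => rfl⟩

/-- The simplicial group `Nerve_*(H'', G'', μ'')` acting on the abelian simplicial group
`ℋ_q(Nerve_*(H', G', μ'), Nerve_*(C, A, ν))`, which is
`H_q(Nerve_n(H', G', μ'), Nerve_n(C, A, ν))` in degree `n`. -/
def coefficients (hip : CrossedModule.IsShortExact i p) (M : X.Action C A) (q : ℕ) :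
    SimplicialObject GrpMod.{u} :=
  ((SimplicialObject.whiskering _ _).obj (GrpExtMod.quotHomology q)).obj (hip.nerve M)

end CrossedModule.IsShortExact

/-! ## First quadrant spectral sequences -/

/-- First quadrant homological spectral sequences of abelian groups starting with the page `E²`;
the differential of the page `Eʳ` goes from `Eʳ_{p,q}` to `Eʳ_{p-r,q+r-1}`. -/
abbrev FirstQuadrantSpectralSequence : Type (u + 1) :=
  SpectralSequence AddCommGrpCat.{u} (fun r => ComplexShape.spectralSequenceNat (-r, r - 1)) 2

/-- Convergence `E²_{pq} ⇒ H_{p+q}`: each `H_n` has an increasing filtration `F`, with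
`F_p = 0` for `p < 0` and `F_p = H_n` for `p ≥ n`, such that `F_p / F_{p-1} ≅ E^∞_{p,n-p}` for
`0 ≤ p ≤ n`. Here `E^∞_{pq} = Eʳ_{pq}` for all `r > max p (q + 1)`, since the differentials of these
pages from and to the position `(p, q)` vanish. -/
def FirstQuadrantSpectralSequence.ConvergesTo (E : FirstQuadrantSpectralSequence.{u})
    (H : ℕ → AddCommGrpCat.{u}) : Prop :=
  ∃ F : ∀ n : ℕ, ℤ → AddSubgroup (H n),
    (∀ n, Monotone (F n)) ∧
    (∀ n, ∀ p < 0, F n p = ⊥) ∧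
    (∀ n : ℕ, ∀ p : ℤ, n ≤ p → F n p = ⊤) ∧
    ∀ (p q : ℕ) (r : ℤ) (_ : (p : ℤ) < r) (hq : (q : ℤ) + 1 < r),
      Nonempty ((F (p + q) p ⧸ (F (p + q) (p - 1)).addSubgroupOf (F (p + q) p)) ≃+
        (E.page r (by lia)).X (p, q))

end

noncomputable section

/-! Write `1 → N_* → P_* → Q_* → 1` for the short exact sequence of nerves and `A_*` for the
coefficients; the argument works for every simplicial object of `GrpExtMod`. It is the
Hochschild–Serre argument in each simplicial degree, carried out on the triple complex `B_s(Q_p)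
⊗_{Q_p} (B_t(P_p) ⊗_{N_p} A_p)`. The action of `P_p` on `B_*(P_p) ⊗_{N_p} A_p` factors through `Q_p`
already on chains, so this makes sense. Totalizing over `p` and `s` gives the bicomplex
`quotBicomplex`, with indices `t` and `n = p + s`.

Filter by `n` and take homology in the direction of `t` first. Since `B_s(Q)` is a free `Q`-module,
tensoring with it is exact (`bar_map_injective`, `bar_map_surjective`, `bar_map_exact`), so it
commutes with cycles and homology. What remains is the total complex for `Q_*` acting on the
homology of `B_*(P_*) ⊗_{N_*} A_*`, which is `ℋ_t(N_*, A_*)` by `quotHomologyIso`. Its homology is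
the second page, by the general computation `nonempty_page_two_iso`.

For the abutment, fix `p` and `t`. The complex `B_*(Q) ⊗_Q (B_t(P) ⊗_N A)` is a resolution of
`B_t(P) ⊗_P A`, because `y ⊗ (x ⊗ a) ↦ (p(x₀), y) ⊗ (x ⊗ a)` contracts it. Hence the augmentation
has an exact cone for each `t` (`coneExact_totalAugmentation`), and therefore also on total
complexes (`coneExact_total_map`). The target is the total complex of `B_t(P_p) ⊗_{P_p} A_p`, which
computes the homology of `P_*`.

The general input is the spectral sequence of a bounded filtration, built from the subgroups `Z^r_p`
and `B^r_p` and compared with homology through groups of representatives. -/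

/-! ### Homology of abelian groups in terms of elements -/

lemma AddMonoidHom.nonempty_addEquiv_of_ker_eq {Z A B : Type*} [AddCommGroup Z] [AddCommGroup A]
    [AddCommGroup B] (f : Z →+ A) (g : Z →+ B) (hf : Function.Surjective f)
    (hg : Function.Surjective g) (h : ∀ z, f z = 0 ↔ g z = 0) : Nonempty (A ≃+ B) :=
  ⟨((QuotientAddGroup.quotientKerEquivOfSurjective f hf).symm.trans
    (QuotientAddGroup.quotientAddEquivOfEq (show f.ker = g.ker from AddSubgroup.ext h))).trans
      (QuotientAddGroup.quotientKerEquivOfSurjective g hg)⟩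

/-- The homology of a short complex of abelian groups, computed from a group of representatives. -/
theorem AddCommGrpCat.nonempty_homology_iso_of_representatives (S : ShortComplex AddCommGrpCat.{u})
    {Z : Type u} {E : AddCommGrpCat.{u}} [AddCommGroup Z] (a : Z →+ S.X₂) (b : Z →+ E)
    (hb : Function.Surjective b) (ha : ∀ z, S.g (a z) = 0)
    (hs : ∀ x, S.g x = 0 → ∃ z y, x = a z + S.f y)
    (hk : ∀ z, b z = 0 ↔ ∃ y, S.f y = a z) :
    Nonempty (S.homology ≅ E) := by
  let a' : Z →+ (AddMonoidHom.ker S.g.hom) ⧸ AddMonoidHom.range S.abToCycles :=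
    (QuotientAddGroup.mk' _).comp (a.codRestrict _ fun z => ha z)
  have ha' : Function.Surjective a' := by
    intro x
    obtain ⟨⟨x, hx⟩, rfl⟩ := QuotientAddGroup.mk_surjective x
    obtain ⟨z, y, h⟩ := hs x hx
    refine ⟨z, (QuotientAddGroup.eq).2 ⟨y, Subtype.ext ?_⟩⟩
    change S.f y = -a z + x
    rw [h]
    abel
  obtain ⟨e⟩ := AddMonoidHom.nonempty_addEquiv_of_ker_eq a' b ha' hb fun z => by
    rw [hk]
    refine (QuotientAddGroup.eq_zero_iff _).trans ⟨?_, ?_⟩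
    · rintro ⟨y, hy⟩
      exact ⟨y, congrArg Subtype.val hy⟩
    · rintro ⟨y, hy⟩
      exact ⟨y, Subtype.ext hy⟩
  exact ⟨S.abHomologyIso ≪≫ AddEquiv.toAddCommGrpIso (Y := E) e⟩

/-- The group `Z` need not be the group of cycles: it only has to meet every homology class through
`a` and surject onto `E` through `b`, with the same kernel. This one criterion yields the passage
from a page to the next, the second page of a bicomplex, and the homology isomorphism given by an
exact cone. -/
theorem HomologicalComplex.nonempty_homology_iso_of_representatives {ι : Type*}
    {c : ComplexShape ι} (T : HomologicalComplex AddCommGrpCat.{u} c) (i : ι)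
    {Z : Type u} {E : AddCommGrpCat.{u}} [AddCommGroup Z] (a : Z →+ T.X i) (b : Z →+ E)
    (hb : Function.Surjective b) (ha : ∀ z, T.d i (c.next i) (a z) = 0)
    (hs : ∀ x, T.d i (c.next i) x = 0 → ∃ z y, x = a z + T.d (c.prev i) i y)
    (hk : ∀ z, b z = 0 ↔ ∃ y, T.d (c.prev i) i y = a z) :
    Nonempty (T.homology i ≅ E) :=
  AddCommGrpCat.nonempty_homology_iso_of_representatives (T.sc i) a b hb ha hs hk

@[simp]
lemma HomologicalComplex.d_d_apply {ι : Type*} {c : ComplexShape ι}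
    (T : HomologicalComplex AddCommGrpCat.{u} c) (i j k : ι) (x : T.X i) :
    T.d j k (T.d i j x) = 0 := by
  rw [← ConcreteCategory.comp_apply, T.d_comp_d]
  rfl

namespace HomologicalComplex

variable {ι : Type*} {c : ComplexShape ι} (T : HomologicalComplex AddCommGrpCat.{u} c) (i : ι)

lemma iCycles_injective : Function.Injective (T.iCycles i) :=
  (AddCommGrpCat.mono_iff_injective _).1 inferInstance

lemma homologyπ_surjective : Function.Surjective (T.homologyπ i) :=
  (AddCommGrpCat.epi_iff_surjective _).1 inferInstance

@[simp]
lemma d_iCycles_apply (j : ι) (z : T.cycles i) : T.d i j (T.iCycles i z) = 0 := by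
  rw [← ConcreteCategory.comp_apply, T.iCycles_d]
  rfl

lemma exists_iCycles_eq {j : ι} (hj : c.next i = j) {x : T.X i} (hx : T.d i j x = 0) :
    ∃ z, T.iCycles i z = x := by
  subst hj
  exact (ShortComplex.ab_exact_iff _).1
    (ShortComplex.exact_of_f_is_kernel (ShortComplex.mk _ _ (T.iCycles_d i (c.next i)))
      (T.cyclesIsKernel i _ rfl)) x hx

lemma homologyπ_eq_zero_iff {j : ι} (hj : c.prev i = j) (z : T.cycles i) :
    T.homologyπ i z = 0 ↔ ∃ y, T.d j i y = T.iCycles i z := by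
  subst hj
  constructor
  · intro h
    obtain ⟨y, hy⟩ := (ShortComplex.ab_exact_iff _).1
      (ShortComplex.exact_of_g_is_cokernel (ShortComplex.mk _ _ (T.toCycles_comp_homologyπ _ i))
        (T.homologyIsCokernel _ i rfl)) z h
    refine ⟨y, ?_⟩
    change T.toCycles _ i y = z at hy
    rw [← hy, ← ConcreteCategory.comp_apply, T.toCycles_i]
  · rintro ⟨y, hy⟩
    have : z = T.toCycles _ i y := by
      apply T.iCycles_injective i
      rw [← hy, ← ConcreteCategory.comp_apply, T.toCycles_i]
    rw [this, ← ConcreteCategory.comp_apply, T.toCycles_comp_homologyπ]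
    rfl

end HomologicalComplex

/-! ### The spectral sequence of a filtered complex -/

/-- A bounded increasing filtration of a chain complex of abelian groups: zero for negative
indices, everything from the index equal to the degree on. -/
structure ChainFiltration (T : ChainComplex AddCommGrpCat.{u} ℕ) where
  F : ℤ → ∀ n, AddSubgroup (T.X n)
  mono : ∀ {p p' : ℤ} {n : ℕ}, p ≤ p' → F p n ≤ F p' n
  d_mem : ∀ {p : ℤ} {n : ℕ} (m : ℕ) {x : T.X n}, x ∈ F p n → T.d n m x ∈ F p m
  bot : ∀ {p : ℤ} (n : ℕ), p < 0 → F p n = ⊥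
  top : ∀ {p : ℤ} {n : ℕ}, (n : ℤ) ≤ p → F p n = ⊤

namespace ChainFiltration

variable {T : ChainComplex AddCommGrpCat.{u} ℕ} (𝓕 : ChainFiltration T)

lemma d_apply_eq_zero {n m : ℕ} (h : m + 1 ≠ n) (x : T.X n) : T.d n m x = 0 := by
  rw [T.shape _ _ h]
  rfl

/-- The elements of `F_p` whose boundary is in `F_{p-r}`. -/
def Z (r p : ℤ) (n : ℕ) : AddSubgroup (T.X n) :=
  𝓕.F p n ⊓ ⨅ m, (𝓕.F (p - r) m).comap (T.d n m).hom

lemma mem_Z {r p : ℤ} {n : ℕ} {x : T.X n} :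
    x ∈ 𝓕.Z r p n ↔ x ∈ 𝓕.F p n ∧ ∀ m, T.d n m x ∈ 𝓕.F (p - r) m := by
  simp only [Z, AddSubgroup.mem_inf, AddSubgroup.mem_iInf]
  rfl

lemma d_mem_Z {r p : ℤ} {n : ℕ} {x : T.X n} (hx : x ∈ 𝓕.Z r p n) (m : ℕ) (r' : ℤ) :
    T.d n m x ∈ 𝓕.Z r' (p - r) m := by
  rw [mem_Z] at hx ⊢
  refine ⟨hx.2 m, fun k => ?_⟩
  rw [HomologicalComplex.d_d_apply]
  exact zero_mem _

lemma Z_le {r r' p p' : ℤ} (n : ℕ) (hp : p' ≤ p) (hr : p' - r' ≤ p - r) :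
    𝓕.Z r' p' n ≤ 𝓕.Z r p n := by
  intro x hx
  rw [mem_Z] at hx ⊢
  exact ⟨𝓕.mono hp hx.1, fun m => 𝓕.mono hr (hx.2 m)⟩

/-- The denominator of the `r`-th page: `Z^{r-1}_{p-1} + d Z^{r-1}_{p+r-1}`. -/
def B (r p : ℤ) (n : ℕ) : AddSubgroup (T.X n) :=
  𝓕.Z (r - 1) (p - 1) n ⊔ (𝓕.Z (r - 1) (p + r - 1) (n + 1)).map (T.d (n + 1) n).hom

lemma mem_B {r p : ℤ} {n : ℕ} {x : T.X n} :
    x ∈ 𝓕.B r p n ↔ ∃ w ∈ 𝓕.Z (r - 1) (p - 1) n, ∃ y ∈ 𝓕.Z (r - 1) (p + r - 1) (n + 1),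
      w + T.d (n + 1) n y = x := by
  simp only [B, AddSubgroup.mem_sup, AddSubgroup.mem_map]
  constructor
  · rintro ⟨w, hw, _, ⟨y, hy, rfl⟩, rfl⟩
    exact ⟨w, hw, y, hy, rfl⟩
  · rintro ⟨w, hw, y, hy, rfl⟩
    exact ⟨w, hw, _, ⟨y, hy, rfl⟩, rfl⟩

/-- The group `E^r_p = Z^r_p / (Z^{r-1}_{p-1} + d Z^{r-1}_{p+r-1})`. -/
abbrev E (r p : ℤ) (n : ℕ) : Type u := 𝓕.Z r p n ⧸ (𝓕.B r p n).addSubgroupOf (𝓕.Z r p n)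

/-- The class in `E^r_p` of an element of `Z^r_p`. -/
def E.mk (r p : ℤ) (n : ℕ) : 𝓕.Z r p n →+ 𝓕.E r p n := QuotientAddGroup.mk' _

lemma E.mk_surjective (r p : ℤ) (n : ℕ) : Function.Surjective (E.mk 𝓕 r p n) :=
  QuotientAddGroup.mk_surjective

lemma E.mk_eq_zero {r p : ℤ} {n : ℕ} (x : 𝓕.Z r p n) :
    E.mk 𝓕 r p n x = 0 ↔ (x : T.X n) ∈ 𝓕.B r p n :=
  QuotientAddGroup.eq_zero_iff _

/-- The target index is kept as a separate variable because on a page it is the cast of a natural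
number, equal to `p - r` only propositionally. -/
lemma d_mem_Z' {r p p' : ℤ} (hp : p' = p - r) {n : ℕ} {x : T.X n} (hx : x ∈ 𝓕.Z r p n) (m : ℕ) :
    T.d n m x ∈ 𝓕.Z r p' m := by
  subst hp
  exact 𝓕.d_mem_Z hx m r

/-- The boundary, as a homomorphism `Z^r_p → Z^r_{p-r}`. -/
def dZ (r p p' : ℤ) (n m : ℕ) (hp : p' = p - r) : 𝓕.Z r p n →+ 𝓕.Z r p' m :=
  ((T.d n m).hom.comp (𝓕.Z r p n).subtype).codRestrict (𝓕.Z r p' m) fun x => 𝓕.d_mem_Z' hp x.2 m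

/-- The differential `E^r_p → E^r_{p-r}`. -/
def dE (r p p' : ℤ) (n m : ℕ) (hp : p' = p - r) : 𝓕.E r p n →+ 𝓕.E r p' m :=
  QuotientAddGroup.map _ _ (𝓕.dZ r p p' n m hp) (by
    intro x hx
    obtain ⟨w, hw, y, -, h⟩ := 𝓕.mem_B.1 hx
    refine 𝓕.mem_B.2 ?_
    change ∃ w' ∈ _, ∃ y' ∈ _, _ = T.d n m x
    -- If `x = w + dy` then `dx = dw`, and `w ∈ Z^{r-1}_{p-1}` is exactly a source allowed in the
    -- denominator at `p' = p - r`, since `p' + r - 1 = p - 1`.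
    have h' : T.d n m x = T.d n m w := by
      change _ = (x : T.X n) at h
      rw [← h, map_add, HomologicalComplex.d_d_apply, add_zero]
    by_cases hm : m + 1 = n
    · subst hm
      refine ⟨0, zero_mem _, w, 𝓕.Z_le _ (by lia) (by lia) hw, by rw [h', zero_add]⟩
    · exact ⟨0, zero_mem _, 0, zero_mem _, by simp [d_apply_eq_zero hm]⟩)

lemma dE_mk (r p p' : ℤ) (n m : ℕ) (hp : p' = p - r) (x : 𝓕.Z r p n) :
    𝓕.dE r p p' n m hp (E.mk 𝓕 r p n x) = E.mk 𝓕 r p' m (𝓕.dZ r p p' n m hp x) := rfl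

lemma dE_dE (r p p' p'' : ℤ) (n m k : ℕ) (hp : p' = p - r) (hp' : p'' = p' - r) (x : 𝓕.E r p n) :
    𝓕.dE r p' p'' m k hp' (𝓕.dE r p p' n m hp x) = 0 := by
  obtain ⟨x, rfl⟩ := E.mk_surjective 𝓕 _ _ _ x
  rw [dE_mk, dE_mk, E.mk_eq_zero]
  change T.d m k (T.d n m x) ∈ _
  rw [HomologicalComplex.d_d_apply]
  exact zero_mem _

lemma target_eq {r : ℤ} {pq pq' : ℕ × ℕ}
    (h : (ComplexShape.spectralSequenceNat (-r, r - 1)).Rel pq pq') : (pq'.1 : ℤ) = pq.1 - r := by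
  have := h.1
  simp only at this
  lia

open Classical in
/-- The `r`-th page of the spectral sequence of a filtered complex. -/
def page (r : ℤ) :
    HomologicalComplex AddCommGrpCat.{u} (ComplexShape.spectralSequenceNat (-r, r - 1)) where
  X pq := AddCommGrpCat.of (𝓕.E r pq.1 (pq.1 + pq.2))
  d pq pq' := if h : (ComplexShape.spectralSequenceNat (-r, r - 1)).Rel pq pq' then
    AddCommGrpCat.ofHom (𝓕.dE r pq.1 pq'.1 _ _ (target_eq h)) else 0
  shape pq pq' h := dif_neg h
  d_comp_d' pq pq' pq'' h h' := by
    rw [dif_pos h, dif_pos h']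
    exact AddCommGrpCat.hom_ext (AddMonoidHom.ext fun x => 𝓕.dE_dE ..)

/-- The class in the `r`-th page of an element of `Z^r_p`. -/
def pageMk (r : ℤ) (pq : ℕ × ℕ) : 𝓕.Z r pq.1 (pq.1 + pq.2) →+ (𝓕.page r).X pq :=
  E.mk 𝓕 r pq.1 (pq.1 + pq.2)

lemma pageMk_surjective (r : ℤ) (pq : ℕ × ℕ) : Function.Surjective (𝓕.pageMk r pq) :=
  E.mk_surjective 𝓕 _ _ _

lemma pageMk_eq_zero {r : ℤ} {pq : ℕ × ℕ} (x : 𝓕.Z r pq.1 (pq.1 + pq.2)) :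
    𝓕.pageMk r pq x = 0 ↔ (x : T.X (pq.1 + pq.2)) ∈ 𝓕.B r pq.1 (pq.1 + pq.2) :=
  E.mk_eq_zero ..

lemma page_d_pageMk {r : ℤ} {pq pq' : ℕ × ℕ}
    (h : (ComplexShape.spectralSequenceNat (-r, r - 1)).Rel pq pq')
    (x : 𝓕.Z r pq.1 (pq.1 + pq.2)) :
    (𝓕.page r).d pq pq' (𝓕.pageMk r pq x) =
      𝓕.pageMk r pq' (𝓕.dZ r _ _ _ _ (target_eq h) x) := by
  have : (𝓕.page r).d pq pq' = AddCommGrpCat.ofHom (𝓕.dE r pq.1 pq'.1 _ _ (target_eq h)) :=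
    dif_pos h
  rw [this]
  rfl

/-- As `q + r - 1 ≥ 0`, an outgoing arrow can leave the first quadrant only through its first index.
-/
lemma lt_of_not_rel_next {r : ℤ} {pq : ℕ × ℕ} (hr : 1 ≤ r)
    (h : ¬ (ComplexShape.spectralSequenceNat (-r, r - 1)).Rel pq
      ((ComplexShape.spectralSequenceNat (-r, r - 1)).next pq)) : (pq.1 : ℤ) < r := by
  by_contra! hp
  refine h ?_
  have h' : (ComplexShape.spectralSequenceNat (-r, r - 1)).Rel pq
      ((pq.1 - r).toNat, (pq.2 + r - 1).toNat) := by
    simp only [ComplexShape.spectralSequenceNat_rel_iff]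
    lia
  rwa [ComplexShape.next_eq' _ h']

/-- The source of an incoming arrow would be `(p + r, q - r + 1)`, so only the second index can be
negative. -/
lemma lt_of_not_rel_prev {r : ℤ} {pq : ℕ × ℕ} (hr : 1 ≤ r)
    (h : ¬ (ComplexShape.spectralSequenceNat (-r, r - 1)).Rel
      ((ComplexShape.spectralSequenceNat (-r, r - 1)).prev pq) pq) : (pq.2 : ℤ) + 1 < r := by
  by_contra! hp
  refine h ?_
  have h' : (ComplexShape.spectralSequenceNat (-r, r - 1)).Rel
      ((pq.1 + r).toNat, (pq.2 - r + 1).toNat) pq := by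
    simp only [ComplexShape.spectralSequenceNat_rel_iff]
    lia
  rwa [ComplexShape.prev_eq' _ h']

/-- The boundary of an element of `Z^{r+1}_p` lies in `Z^{r-1}_{p-r-1}`, the first summand of the
denominator at `p - r`. -/
lemma page_d_next_eq_zero {r : ℤ} {pq : ℕ × ℕ} (z : 𝓕.Z r pq.1 (pq.1 + pq.2))
    (hz : z.1 ∈ 𝓕.Z (r + 1) pq.1 (pq.1 + pq.2)) :
    (𝓕.page r).d pq ((ComplexShape.spectralSequenceNat (-r, r - 1)).next pq)
      (𝓕.pageMk r pq z) = 0 := by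
  by_cases h : (ComplexShape.spectralSequenceNat (-r, r - 1)).Rel pq
    ((ComplexShape.spectralSequenceNat (-r, r - 1)).next pq)
  · rw [𝓕.page_d_pageMk h, 𝓕.pageMk_eq_zero]
    refine AddSubgroup.mem_sup_left ?_
    refine 𝓕.Z_le _ ?_ ?_ (𝓕.d_mem_Z hz _ (r - 1))
    · rw [target_eq h]
      lia
    · rw [target_eq h]
      lia
  · rw [(𝓕.page r).shape _ _ h]
    rfl

/-- A vanishing differential means `dz = w + dy` with `w` in filtration `p - r - 1` and `y ∈
Z^{r-1}_{p-1}`. Then `z - y` has the same class as `z` and boundary `w`, so it survives to the next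
page. -/
lemma exists_of_page_d_next_eq_zero {r : ℤ} (hr : 1 ≤ r) {pq : ℕ × ℕ}
    (z : 𝓕.Z r pq.1 (pq.1 + pq.2))
    (hz : (𝓕.page r).d pq ((ComplexShape.spectralSequenceNat (-r, r - 1)).next pq)
      (𝓕.pageMk r pq z) = 0) :
    ∃ z' : 𝓕.Z r pq.1 (pq.1 + pq.2), z'.1 ∈ 𝓕.Z (r + 1) pq.1 (pq.1 + pq.2) ∧
      𝓕.pageMk r pq z = 𝓕.pageMk r pq z' := by
  by_cases h : (ComplexShape.spectralSequenceNat (-r, r - 1)).Rel pq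
    ((ComplexShape.spectralSequenceNat (-r, r - 1)).next pq)
  · rw [𝓕.page_d_pageMk h, 𝓕.pageMk_eq_zero] at hz
    obtain ⟨w, hw, y, hy, e⟩ := 𝓕.mem_B.1 hz
    have h₁ := target_eq h
    have h₂ := h.2
    generalize (ComplexShape.spectralSequenceNat (-r, r - 1)).next pq = pq' at *
    have hn : pq'.1 + pq'.2 + 1 = pq.1 + pq.2 := by
      simp only at h₂
      lia
    -- The degree is generalized to `n` so that the propositional equality of degrees can be
    -- substituted.
    have key : ∀ n (hn : pq'.1 + pq'.2 + 1 = n) (z : 𝓕.Z r pq.1 n),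
        w + T.d _ _ y = T.d n (pq'.1 + pq'.2) z.1 →
        ∃ z' : 𝓕.Z r pq.1 n, z'.1 ∈ 𝓕.Z (r + 1) pq.1 n ∧ (z - z').1 ∈ 𝓕.B r pq.1 n := by
      rintro _ rfl z e
      have hy' : y ∈ 𝓕.Z (r - 1) (pq.1 - 1) (pq'.1 + pq'.2 + 1) :=
        𝓕.Z_le _ (by lia) (by lia) hy
      refine ⟨z - ⟨y, 𝓕.Z_le _ (by lia) (by lia) hy'⟩, ?_, ?_⟩
      · refine 𝓕.mem_Z.2 ⟨sub_mem (𝓕.mem_Z.1 z.2).1 (𝓕.mono (by lia) (𝓕.mem_Z.1 hy).1), ?_⟩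
        intro m
        by_cases hm : m = pq'.1 + pq'.2
        · subst hm
          change T.d _ _ (z.1 - y) ∈ _
          rw [map_sub, ← e, add_sub_cancel_right]
          exact 𝓕.mono (by lia) (𝓕.mem_Z.1 hw).1
        · rw [d_apply_eq_zero (by lia)]
          exact zero_mem _
      · rw [sub_sub_cancel]
        exact AddSubgroup.mem_sup_left hy'
    obtain ⟨z', h₁, h₂⟩ := key _ hn z e
    refine ⟨z', h₁, sub_eq_zero.1 ?_⟩
    rwa [← map_sub, 𝓕.pageMk_eq_zero]
  · refine ⟨z, ?_, rfl⟩
    -- Without an outgoing arrow `p < r`, so both `F_{p-r}` and `F_{p-r-1}` vanish and `z` is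
    -- already a cycle.
    have hp := lt_of_not_rel_next hr h
    have := 𝓕.mem_Z.1 z.2
    refine 𝓕.mem_Z.2 ⟨this.1, fun m => ?_⟩
    have := this.2 m
    rw [𝓕.bot _ (by lia)] at this ⊢
    exact this

/-- The boundaries in `B^{r+1}_p` come from `Z^r_{p+r}`, the source of the incoming differential of
the `r`-th page. The other summands of `B^r_p` and `B^{r+1}_p` match because the boundary of `z`
lies one step deeper than that of a general element of `Z^r_p`. -/
lemma pageMk_succ_eq_zero_iff {r : ℤ} (hr : 1 ≤ r) {pq : ℕ × ℕ}
    (z : 𝓕.Z (r + 1) pq.1 (pq.1 + pq.2)) (z' : 𝓕.Z r pq.1 (pq.1 + pq.2)) (hz : z.1 = z'.1) :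
    𝓕.pageMk (r + 1) pq z = 0 ↔
      ∃ y, (𝓕.page r).d ((ComplexShape.spectralSequenceNat (-r, r - 1)).prev pq) pq y =
        𝓕.pageMk r pq z' := by
  rw [pageMk_eq_zero, mem_B]
  by_cases h : (ComplexShape.spectralSequenceNat (-r, r - 1)).Rel
    ((ComplexShape.spectralSequenceNat (-r, r - 1)).prev pq) pq
  · have h₁ := target_eq h
    have h₂ := h.2
    generalize (ComplexShape.spectralSequenceNat (-r, r - 1)).prev pq = pq' at *
    have hn : pq.1 + pq.2 + 1 = pq'.1 + pq'.2 := by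
      simp only at h₂
      lia
    constructor
    · rintro ⟨w, hw, y, hy, e⟩
      have hy' : ∃ y' : 𝓕.Z r pq'.1 (pq'.1 + pq'.2), T.d _ _ y'.1 = T.d _ (pq.1 + pq.2) y := by
        rw [← hn]
        exact ⟨⟨y, 𝓕.Z_le _ (by lia) (by lia) hy⟩, rfl⟩
      obtain ⟨y', hy'⟩ := hy'
      refine ⟨𝓕.pageMk r pq' y', ?_⟩
      rw [𝓕.page_d_pageMk h, ← sub_eq_zero, ← map_sub, pageMk_eq_zero]
      have : (𝓕.dZ r _ _ _ _ (target_eq h) y' - z').1 = - w := by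
        change T.d _ _ y'.1 - z'.1 = - w
        rw [hy', ← hz, ← e]
        abel
      rw [this]
      exact AddSubgroup.mem_sup_left (neg_mem (𝓕.Z_le _ (by lia) (by lia) hw))
    · rintro ⟨y, hy⟩
      obtain ⟨y, rfl⟩ := 𝓕.pageMk_surjective _ _ y
      rw [𝓕.page_d_pageMk h, ← sub_eq_zero, ← map_sub, pageMk_eq_zero, mem_B] at hy
      obtain ⟨w, hw, y', hy', e⟩ := hy
      change _ = T.d _ _ y.1 - z'.1 at e
      have hy₂ : ∃ y₂ ∈ 𝓕.Z r pq'.1 (pq.1 + pq.2 + 1),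
          T.d _ (pq.1 + pq.2) y₂ = T.d _ (pq.1 + pq.2) y.1 := by
        rw [hn]
        exact ⟨y, y.2, rfl⟩
      obtain ⟨y₂, hy₂, e'⟩ := hy₂
      have e'' : -w + T.d _ _ (y₂ - y') = z.1 := by
        rw [map_sub, e', eq_sub_of_add_eq e, hz]
        abel
      -- Here `w` is only known to be in `Z^{r-1}_{p-1}`; it is in `Z^r_{p-1}` because `d(-w) = dz`
      -- lies in `F_{p-r-1}`.
      refine ⟨-w, neg_mem (𝓕.mem_Z.2 ⟨(𝓕.mem_Z.1 hw).1, fun m => ?_⟩), y₂ - y', ?_, e''⟩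
      · have := (𝓕.mem_Z.1 z.2).2 m
        rw [← e'', map_add, HomologicalComplex.d_d_apply, add_zero, map_neg, neg_mem_iff] at this
        exact 𝓕.mono (by lia) this
      · exact sub_mem (𝓕.Z_le _ (by lia) (by lia) hy₂) (𝓕.Z_le _ (by lia) (by lia) hy')
  · have hq := lt_of_not_rel_prev hr h
    -- Without an incoming arrow `q + 1 < r`, so the filtration in degree `p + q + 1` is exhausted
    -- at `p + r - 1`, and both denominators allow the same boundaries.
    have htop (k : ℤ) (hk : pq.1 + r - 1 ≤ k) : 𝓕.F k (pq.1 + pq.2 + 1) = ⊤ :=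
      𝓕.top (by push_cast; lia)
    rw [(𝓕.page r).shape _ _ h]
    trans 𝓕.pageMk r pq z' = 0
    · rw [pageMk_eq_zero, mem_B]
      constructor
      · rintro ⟨w, hw, y, hy, e⟩
        refine ⟨w, 𝓕.Z_le _ (by lia) (by lia) hw, y, 𝓕.mem_Z.2 ⟨?_, fun m => ?_⟩, e.trans hz⟩
        · rw [htop _ (by lia)]
          trivial
        · exact 𝓕.mono (by lia) ((𝓕.mem_Z.1 hy).2 m)
      · rintro ⟨w, hw, y, hy, e⟩
        refine ⟨w, 𝓕.mem_Z.2 ⟨(𝓕.mem_Z.1 hw).1, fun m => ?_⟩, y, 𝓕.Z_le _ (by lia) (by lia) hy,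
          e.trans hz.symm⟩
        have := (𝓕.mem_Z.1 z.2).2 m
        rw [hz, ← e, map_add, HomologicalComplex.d_d_apply, add_zero] at this
        exact 𝓕.mono (by lia) this
    · exact ⟨fun h => ⟨0, h.symm⟩, fun ⟨_, h⟩ => h.symm⟩

/-- The homology of a page at `(p, q)` is the object of the next page. -/
theorem nonempty_page_iso {r : ℤ} (hr : 1 ≤ r) (pq : ℕ × ℕ) :
    Nonempty ((𝓕.page r).homology pq ≅ (𝓕.page (r + 1)).X pq) := by
  have hle : 𝓕.Z (r + 1) pq.1 (pq.1 + pq.2) ≤ 𝓕.Z r pq.1 (pq.1 + pq.2) :=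
    𝓕.Z_le _ le_rfl (by lia)
  obtain ⟨a, ha⟩ : ∃ a : 𝓕.Z (r + 1) pq.1 (pq.1 + pq.2) →+ (𝓕.page r).X pq,
      ∀ z, a z = 𝓕.pageMk r pq ⟨z.1, hle z.2⟩ :=
    ⟨(𝓕.pageMk r pq).comp (AddSubgroup.inclusion hle), fun _ => rfl⟩
  refine (𝓕.page r).nonempty_homology_iso_of_representatives pq a
    (𝓕.pageMk (r + 1) pq) (𝓕.pageMk_surjective _ _) (fun z => ?_) (fun x hx => ?_) (fun z => ?_)
  · rw [ha]
    exact 𝓕.page_d_next_eq_zero _ z.2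
  · obtain ⟨z, rfl⟩ := 𝓕.pageMk_surjective _ _ x
    obtain ⟨z', h, h'⟩ := 𝓕.exists_of_page_d_next_eq_zero hr z hx
    refine ⟨⟨z', h⟩, 0, ?_⟩
    rw [map_zero, add_zero, ha]
    exact h'
  · rw [ha]
    exact 𝓕.pageMk_succ_eq_zero_iff hr z _ rfl

/-- The spectral sequence of a filtered complex. -/
def spectralSequence : FirstQuadrantSpectralSequence.{u} where
  page r _ := 𝓕.page r
  iso r r' pq hr _ := hr ▸ (𝓕.nonempty_page_iso (by lia) pq).some

/-! ### Convergence -/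

/-- The filtration of the homology. -/
def homologyFiltration (n : ℕ) (p : ℤ) : AddSubgroup (T.homology n) :=
  ((𝓕.F p n).comap (T.iCycles n).hom).map (T.homologyπ n).hom

lemma mem_homologyFiltration {n : ℕ} {p : ℤ} {x : T.homology n} :
    x ∈ 𝓕.homologyFiltration n p ↔ ∃ z, T.iCycles n z ∈ 𝓕.F p n ∧ T.homologyπ n z = x := Iff.rfl

lemma homologyFiltration_mono (n : ℕ) : Monotone (𝓕.homologyFiltration n) := fun _ _ h =>
  AddSubgroup.map_mono (AddSubgroup.comap_mono (𝓕.mono h))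

/-- For `p < r` the boundary is required to lie in `F_{p-r} = 0`, so `Z^r_p` has stabilized to the
cycles in `F_p`. -/
lemma mem_Z_of_lt {p q : ℕ} {r : ℤ} (hp : (p : ℤ) < r) {x : T.X (p + q)} :
    x ∈ 𝓕.Z r p (p + q) ↔ x ∈ 𝓕.F p (p + q) ∧ ∃ z, T.iCycles (p + q) z = x := by
  rw [mem_Z]
  refine and_congr_right fun _ => ⟨fun h => ?_, ?_⟩
  · refine T.exists_iCycles_eq _ rfl ?_
    have := h ((ComplexShape.down ℕ).next (p + q))
    rwa [𝓕.bot _ (by lia), AddSubgroup.mem_bot] at this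
  · rintro ⟨z, rfl⟩ m
    rw [HomologicalComplex.d_iCycles_apply]
    exact zero_mem _

/-- For `q + 1 < r` the group `F_{p+r-1}` is everything in degree `p + q + 1`. So `B^r_p` allows
every boundary lying in `F_p`, and membership means being homologous to a cycle of `F_{p-1}`. -/
lemma mem_B_of_lt {p q : ℕ} {r : ℤ} (hq : (q : ℤ) + 1 < r) (z : T.cycles (p + q))
    (hz : T.iCycles (p + q) z ∈ 𝓕.F p (p + q)) :
    T.iCycles (p + q) z ∈ 𝓕.B r p (p + q) ↔
      T.homologyπ (p + q) z ∈ 𝓕.homologyFiltration (p + q) (p - 1) := by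
  rw [mem_B, mem_homologyFiltration]
  constructor
  · rintro ⟨w, hw, y, hy, e⟩
    have hw' : T.d (p + q) ((ComplexShape.down ℕ).next (p + q)) w = 0 := by
      rw [eq_sub_of_add_eq e, map_sub, T.d_iCycles_apply, T.d_d_apply, sub_zero]
    obtain ⟨z', rfl⟩ := T.exists_iCycles_eq _ rfl hw'
    refine ⟨z', (𝓕.mem_Z.1 hw).1, ?_⟩
    rw [eq_comm, ← sub_eq_zero, ← map_sub, T.homologyπ_eq_zero_iff (j := p + q + 1) _ (by simp)]
    exact ⟨y, by rw [map_sub, ← e]; abel⟩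
  · rintro ⟨z', hz', e⟩
    rw [eq_comm, ← sub_eq_zero, ← map_sub,
      T.homologyπ_eq_zero_iff (j := p + q + 1) _ (by simp)] at e
    obtain ⟨y, hy⟩ := e
    rw [map_sub] at hy
    refine ⟨_, 𝓕.mem_Z.2 ⟨hz', fun m => ?_⟩, y, 𝓕.mem_Z.2 ⟨?_, fun m => ?_⟩, by rw [hy]; abel⟩
    · rw [T.d_iCycles_apply]
      exact zero_mem _
    · rw [𝓕.top (by push_cast; lia)]
      trivial
    · by_cases hm : m = p + q
      · subst hm
        rw [hy]
        exact 𝓕.mono (by lia) (sub_mem hz (𝓕.mono (by lia) hz'))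
      · rw [d_apply_eq_zero (by lia)]
        exact zero_mem _

theorem nonempty_graded_addEquiv_page {p q : ℕ} {r : ℤ} (hp : (p : ℤ) < r) (hq : (q : ℤ) + 1 < r) :
    Nonempty ((𝓕.homologyFiltration (p + q) p ⧸
      (𝓕.homologyFiltration (p + q) (p - 1)).addSubgroupOf (𝓕.homologyFiltration (p + q) p)) ≃+
        (𝓕.page r).X (p, q)) := by
  -- The cycles in `F_p` surject onto both sides, and the two kernels agree by `mem_B_of_lt`.
  let Z₁ := (𝓕.F p (p + q)).comap (T.iCycles (p + q)).hom
  have hZ (z : Z₁) : T.iCycles (p + q) z.1 ∈ 𝓕.Z r p (p + q) :=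
    (𝓕.mem_Z_of_lt hp).2 ⟨z.2, _, rfl⟩
  obtain ⟨a, ha⟩ : ∃ a : Z₁ →+ 𝓕.homologyFiltration (p + q) p,
      ∀ z, (a z).1 = T.homologyπ (p + q) z.1 :=
    ⟨((T.homologyπ (p + q)).hom.comp Z₁.subtype).codRestrict _ fun z => ⟨z.1, z.2, rfl⟩,
      fun _ => rfl⟩
  obtain ⟨b, hb⟩ : ∃ b : Z₁ →+ 𝓕.Z r p (p + q), ∀ z, (b z).1 = T.iCycles (p + q) z.1 :=
    ⟨((T.iCycles (p + q)).hom.comp Z₁.subtype).codRestrict _ hZ, fun _ => rfl⟩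
  refine AddMonoidHom.nonempty_addEquiv_of_ker_eq ((QuotientAddGroup.mk' _).comp a)
    ((𝓕.pageMk r (p, q)).comp b) ?_ ?_ fun z => ?_
  · refine (QuotientAddGroup.mk'_surjective _).comp ?_
    rintro ⟨_, z, hz, rfl⟩
    exact ⟨⟨z, hz⟩, Subtype.ext (ha _)⟩
  · refine (𝓕.pageMk_surjective r (p, q)).comp ?_
    rintro ⟨x, hx⟩
    obtain ⟨hx, z, rfl⟩ := (𝓕.mem_Z_of_lt hp).1 hx
    exact ⟨⟨z, hx⟩, Subtype.ext (hb _)⟩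
  · rw [AddMonoidHom.comp_apply, AddMonoidHom.comp_apply, pageMk_eq_zero, hb]
    refine (QuotientAddGroup.eq_zero_iff _).trans ?_
    rw [AddSubgroup.mem_addSubgroupOf, ha]
    exact (𝓕.mem_B_of_lt hq z.1 z.2).symm

theorem convergesTo : 𝓕.spectralSequence.ConvergesTo fun n => T.homology n := by
  refine ⟨𝓕.homologyFiltration, 𝓕.homologyFiltration_mono, fun n p hp => ?_, fun n p hp => ?_,
    fun p q r hp hq => 𝓕.nonempty_graded_addEquiv_page hp hq⟩
  · rw [eq_bot_iff]
    rintro _ ⟨z, hz, rfl⟩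
    change T.iCycles n z ∈ 𝓕.F p n at hz
    rw [𝓕.bot n hp, AddSubgroup.mem_bot] at hz
    have : z = 0 := T.iCycles_injective n (by rw [hz, map_zero])
    rw [this, map_zero]
    exact zero_mem _
  · rw [eq_top_iff]
    rintro x -
    obtain ⟨z, rfl⟩ := T.homologyπ_surjective n x
    exact ⟨z, by rw [𝓕.top hp]; trivial, rfl⟩

end ChainFiltration

/-! ### Components and filtrations of the total complex -/

namespace HomologicalComplex₂

variable (K : HomologicalComplex₂ AddCommGrpCat.{u} (ComplexShape.down ℕ) (ComplexShape.down ℕ))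

/-- The inclusion of the summand `K_{p,q}` in the total complex. -/
def totalIn (p q n : ℕ) (h : p + q = n) : (K.X p).X q →+ (K.total (ComplexShape.down ℕ)).X n :=
  (K.ιTotal (ComplexShape.down ℕ) p q n h).hom

open Classical in
/-- The projection of the total complex onto the summand `K_{p,q}`. -/
def totalPr (p q n : ℕ) : (K.total (ComplexShape.down ℕ)).X n →+ (K.X p).X q :=
  AddCommGrpCat.Hom.hom <| K.totalDesc fun p' q' _ =>
    if h : p' = p ∧ q' = q then (K.XXIsoOfEq _ _ _ h.1 h.2).hom else 0

@[simp]
lemma totalPr_totalIn (p q n : ℕ) (h : p + q = n) (x : (K.X p).X q) :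
    K.totalPr p q n (K.totalIn p q n h x) = x := by
  change (K.ιTotal (ComplexShape.down ℕ) p q n h ≫ K.totalDesc _) x = x
  rw [ι_totalDesc, dif_pos ⟨rfl, rfl⟩]
  simp

lemma totalPr_totalIn_of_ne {p q p' q' : ℕ} (n : ℕ) (h : p + q = n) (hp : ¬ (p = p' ∧ q = q'))
    (x : (K.X p).X q) :
    K.totalPr p' q' n (K.totalIn p q n h x) = 0 := by
  change (K.ιTotal (ComplexShape.down ℕ) p q n h ≫ K.totalDesc _) x = 0
  rw [ι_totalDesc, dif_neg hp]
  rfl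

lemma total_addHom_ext {n : ℕ} {A : Type u} [AddCommGroup A]
    {f g : (K.total (ComplexShape.down ℕ)).X n →+ A}
    (h : ∀ p q h x, f (K.totalIn p q n h x) = g (K.totalIn p q n h x)) : f = g := by
  have : AddCommGrpCat.ofHom f = AddCommGrpCat.ofHom g :=
    total.hom_ext (K := K) _ fun p q hpq => AddCommGrpCat.hom_ext (AddMonoidHom.ext (h p q hpq))
  exact congrArg AddCommGrpCat.Hom.hom this

lemma sum_totalIn_totalPr {n : ℕ} (x : (K.total (ComplexShape.down ℕ)).X n) :
    ∑ i : Finset.HasAntidiagonal.antidiagonal n,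
      K.totalIn i.1.1 i.1.2 n (Finset.HasAntidiagonal.mem_antidiagonal.1 i.2)
        (K.totalPr i.1.1 i.1.2 n x) = x := by
  have : ∑ i : Finset.HasAntidiagonal.antidiagonal n,
      (K.totalIn i.1.1 i.1.2 n (Finset.HasAntidiagonal.mem_antidiagonal.1 i.2)).comp
        (K.totalPr i.1.1 i.1.2 n) =
      AddMonoidHom.id _ := by
    refine K.total_addHom_ext fun p q h x => ?_
    rw [AddMonoidHom.finsetSum_apply, Finset.sum_eq_single
      ⟨(p, q), Finset.HasAntidiagonal.mem_antidiagonal.2 h⟩]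
    · simp
    · rintro ⟨⟨p', q'⟩, hpq⟩ - hne
      simp only [AddMonoidHom.comp_apply]
      rw [K.totalPr_totalIn_of_ne, map_zero]
      rintro ⟨rfl, rfl⟩
      exact hne rfl
    · simp
  simpa using DFunLike.congr_fun this x

lemma total_ext {n : ℕ} {x y : (K.total (ComplexShape.down ℕ)).X n}
    (h : ∀ p q, p + q = n → K.totalPr p q n x = K.totalPr p q n y) : x = y := by
  rw [← K.sum_totalIn_totalPr x, ← K.sum_totalIn_totalPr y]
  exact Finset.sum_congr rfl fun i _ => by
    rw [h _ _ (Finset.HasAntidiagonal.mem_antidiagonal.1 i.2)]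

lemma exists_totalPr_eq (n : ℕ) (y : ∀ p q, (K.X p).X q) :
    ∃ x, ∀ p q, p + q = n → K.totalPr p q n x = y p q := by
  refine ⟨∑ i : Finset.HasAntidiagonal.antidiagonal n,
    K.totalIn i.1.1 i.1.2 n (Finset.HasAntidiagonal.mem_antidiagonal.1 i.2) (y i.1.1 i.1.2),
    fun p q h => ?_⟩
  rw [map_sum, Finset.sum_eq_single
      ⟨(p, q), Finset.HasAntidiagonal.mem_antidiagonal.2 h⟩]
  · simp
  · rintro ⟨⟨p', q'⟩, hpq⟩ - hne
    rw [K.totalPr_totalIn_of_ne]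
    rintro ⟨rfl, rfl⟩
    exact hne rfl
  · simp

lemma total_d_totalIn (p q n m : ℕ) (h : p + q = n) (x : (K.X p).X q) :
    (K.total (ComplexShape.down ℕ)).d n m (K.totalIn p q n h x) =
      (K.d₁ (ComplexShape.down ℕ) p q m) x + (K.d₂ (ComplexShape.down ℕ) p q m) x := by
  change (K.ιTotal (ComplexShape.down ℕ) p q n h ≫
    (K.D₁ (ComplexShape.down ℕ) n m + K.D₂ (ComplexShape.down ℕ) n m)) x = _
  rw [Preadditive.comp_add, ι_D₁, ι_D₂]
  rfl

lemma d₁_succ_apply (p q n : ℕ) (h : p + q = n) (x : (K.X (p + 1)).X q) :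
    (K.d₁ (ComplexShape.down ℕ) (p + 1) q n) x = K.totalIn p q n h ((K.d (p + 1) p).f q x) := by
  rw [K.d₁_eq (ComplexShape.down ℕ) (i₁' := p) (by simp) q n h]
  have : ComplexShape.ε₁ (ComplexShape.down ℕ) (ComplexShape.down ℕ) (ComplexShape.down ℕ)
    (p + 1, q) = 1 := rfl
  rw [this, one_smul]
  rfl

lemma d₂_succ_apply (p q n : ℕ) (h : p + q = n) (x : (K.X p).X (q + 1)) :
    (K.d₂ (ComplexShape.down ℕ) p (q + 1) n) x =
      (-1 : ℤ) ^ p • K.totalIn p q n h ((K.X p).d (q + 1) q x) := by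
  rw [K.d₂_eq (ComplexShape.down ℕ) p (i₂' := q) (by simp) n h]
  have : ComplexShape.ε₂ (ComplexShape.down ℕ) (ComplexShape.down ℕ) (ComplexShape.down ℕ)
    (p, q + 1) = (-1) ^ p := rfl
  rw [this, Units.smul_def]
  simp only [Units.val_pow_eq_pow_val, Units.val_neg, Units.val_one]
  rfl

lemma d₁_zero_apply (q n : ℕ) (x : (K.X 0).X q) : (K.d₁ (ComplexShape.down ℕ) 0 q n) x = 0 := by
  rw [K.d₁_eq_zero (ComplexShape.down ℕ) _ _ _ (by simp)]
  rfl

lemma d₂_zero_apply (p n : ℕ) (x : (K.X p).X 0) : (K.d₂ (ComplexShape.down ℕ) p 0 n) x = 0 := by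
  rw [K.d₂_eq_zero (ComplexShape.down ℕ) _ _ _ (by simp)]
  rfl

/-- Only two components of `x` reach position `(p, q)`: one horizontally, without sign, and one
vertically, with sign `(-1)^p`. All later work on total complexes is done by components through this
formula. -/
lemma totalPr_d {p q m n : ℕ} (h : p + q = m) (hm : m + 1 = n)
    (x : (K.total (ComplexShape.down ℕ)).X n) :
    K.totalPr p q m ((K.total (ComplexShape.down ℕ)).d n m x) =
      (K.d (p + 1) p).f q (K.totalPr (p + 1) q n x) +
        (-1 : ℤ) ^ p • (K.X p).d (q + 1) q (K.totalPr p (q + 1) n x) := by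
  subst hm
  suffices (K.totalPr p q m).comp ((K.total (ComplexShape.down ℕ)).d (m + 1) m).hom =
      ((K.d (p + 1) p).f q).hom.comp (K.totalPr (p + 1) q (m + 1)) +
        (-1 : ℤ) ^ p • ((K.X p).d (q + 1) q).hom.comp (K.totalPr p (q + 1) (m + 1)) from
    DFunLike.congr_fun this x
  refine K.total_addHom_ext fun a b hab x => ?_
  change K.totalPr p q m ((K.total (ComplexShape.down ℕ)).d (m + 1) m _) =
    (K.d (p + 1) p).f q (K.totalPr (p + 1) q (m + 1) _) +
      (-1 : ℤ) ^ p • (K.X p).d (q + 1) q (K.totalPr p (q + 1) (m + 1) _)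
  rw [total_d_totalIn, map_add]
  congr 1
  · obtain _ | a := a
    · rw [d₁_zero_apply, totalPr_totalIn_of_ne _ _ _ (by simp), map_zero, map_zero]
    · rw [d₁_succ_apply K a b m (by lia)]
      by_cases ha : a = p
      · obtain rfl := ha
        obtain rfl : b = q := by lia
        simp
      · rw [totalPr_totalIn_of_ne _ _ _ (by lia), totalPr_totalIn_of_ne _ _ _ (by lia), map_zero]
  · obtain _ | b := b
    · rw [d₂_zero_apply, totalPr_totalIn_of_ne _ _ _ (by simp), map_zero, map_zero, smul_zero]
    · rw [d₂_succ_apply K a b m (by lia), map_zsmul]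
      by_cases ha : a = p
      · obtain rfl := ha
        obtain rfl : b = q := by lia
        simp
      · rw [totalPr_totalIn_of_ne _ _ _ (by lia), totalPr_totalIn_of_ne _ _ _ (by lia), map_zero,
          smul_zero, smul_zero]

variable {K} in
lemma totalPr_map {L : HomologicalComplex₂ AddCommGrpCat.{u} (ComplexShape.down ℕ)
    (ComplexShape.down ℕ)} (φ : K ⟶ L) (p q n : ℕ) (x : (K.total (ComplexShape.down ℕ)).X n) :
    L.totalPr p q n ((total.map φ (ComplexShape.down ℕ)).f n x) =
      (φ.f p).f q (K.totalPr p q n x) := by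
  suffices (L.totalPr p q n).comp ((total.map φ (ComplexShape.down ℕ)).f n).hom =
      ((φ.f p).f q).hom.comp (K.totalPr p q n) from DFunLike.congr_fun this x
  refine K.total_addHom_ext fun a b hab x => ?_
  change L.totalPr p q n ((K.ιTotal (ComplexShape.down ℕ) a b n hab ≫
    (total.map φ (ComplexShape.down ℕ)).f n) x) = (φ.f p).f q (K.totalPr p q n _)
  rw [ιTotal_map]
  change L.totalPr p q n (L.totalIn a b n hab ((φ.f a).f b x)) = _
  by_cases h : a = p ∧ b = q
  · obtain ⟨rfl, rfl⟩ := h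
    simp
  · rw [totalPr_totalIn_of_ne _ _ _ h, totalPr_totalIn_of_ne _ _ _ h, map_zero]

/-- The filtration of the total complex by the first index. -/
def totalFiltration : ChainFiltration (K.total (ComplexShape.down ℕ)) where
  F p n := ⨅ (a : ℕ) (b : ℕ) (_ : a + b = n) (_ : p < a), (K.totalPr a b n).ker
  mono hp := by
    refine iInf_mono fun a => iInf_mono fun b => iInf_mono fun h => ?_
    exact le_iInf fun h' => iInf_le _ (by lia)
  d_mem {p n} m x hx := by
    simp only [AddSubgroup.mem_iInf, AddMonoidHom.mem_ker] at hx ⊢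
    intro a b h hp
    by_cases hm : m + 1 = n
    · rw [K.totalPr_d h hm, hx _ _ (by lia) (by lia), hx _ _ (by lia) (by lia)]
      simp
    · rw [ChainFiltration.d_apply_eq_zero hm, map_zero]
  bot {p} n hp := by
    refine eq_bot_iff.2 fun x hx => ?_
    simp only [AddSubgroup.mem_iInf, AddMonoidHom.mem_ker] at hx
    exact K.total_ext fun a b h => by rw [hx a b h (by lia), map_zero]
  top {p n} hp := by
    refine eq_top_iff.2 fun x _ => ?_
    simp only [AddSubgroup.mem_iInf]
    intro a b h h'
    lia

lemma mem_totalFiltration {p : ℤ} {n : ℕ} {x : (K.total (ComplexShape.down ℕ)).X n} :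
    x ∈ K.totalFiltration.F p n ↔ ∀ a b : ℕ, a + b = n → p < a → K.totalPr a b n x = 0 := by
  change x ∈ ⨅ (a : ℕ) (b : ℕ) (_ : a + b = n) (_ : p < a), (K.totalPr a b n).ker ↔ _
  simp only [AddSubgroup.mem_iInf, AddMonoidHom.mem_ker]

/-- The filtration of the total complex by the second index. -/
def totalFiltration₂ : ChainFiltration (K.total (ComplexShape.down ℕ)) where
  F p n := ⨅ (a : ℕ) (b : ℕ) (_ : a + b = n) (_ : p < b), (K.totalPr a b n).ker
  mono hp := by
    refine iInf_mono fun a => iInf_mono fun b => iInf_mono fun h => ?_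
    exact le_iInf fun h' => iInf_le _ (by lia)
  d_mem {p n} m x hx := by
    simp only [AddSubgroup.mem_iInf, AddMonoidHom.mem_ker] at hx ⊢
    intro a b h hp
    by_cases hm : m + 1 = n
    · rw [K.totalPr_d h hm, hx _ _ (by lia) (by lia), hx _ _ (by lia) (by lia)]
      simp
    · rw [ChainFiltration.d_apply_eq_zero hm, map_zero]
  bot {p} n hp := by
    refine eq_bot_iff.2 fun x hx => ?_
    simp only [AddSubgroup.mem_iInf, AddMonoidHom.mem_ker] at hx
    exact K.total_ext fun a b h => by rw [hx a b h (by lia), map_zero]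
  top {p n} hp := by
    refine eq_top_iff.2 fun x _ => ?_
    simp only [AddSubgroup.mem_iInf]
    intro a b h h'
    lia

lemma mem_totalFiltration₂ {p : ℤ} {n : ℕ} {x : (K.total (ComplexShape.down ℕ)).X n} :
    x ∈ K.totalFiltration₂.F p n ↔ ∀ a b : ℕ, a + b = n → p < b → K.totalPr a b n x = 0 := by
  change x ∈ ⨅ (a : ℕ) (b : ℕ) (_ : a + b = n) (_ : p < b), (K.totalPr a b n).ker ↔ _
  simp only [AddSubgroup.mem_iInf, AddMonoidHom.mem_ker]

end HomologicalComplex₂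

/-! ### Chain maps with exact cone -/

/-- The cone of a chain map is exact, in terms of elements: every cycle `(x, y)` of the cone is a
boundary. -/
def ConeExact {S T : ChainComplex AddCommGrpCat.{u} ℕ} (g : S ⟶ T) : Prop :=
  -- In degree `0` the cone has no component in `S`, whereas `i - 1` truncates to `0`; the clause `i
  -- = 0 → x = 0` repairs this.
  ∀ (i : ℕ) (x : S.X (i - 1)) (y : T.X i), (i = 0 → x = 0) → (∀ j, S.d (i - 1) j x = 0) →
    g.f (i - 1) x = T.d i (i - 1) y →
    ∃ (x' : S.X i) (y' : T.X (i + 1)), S.d i (i - 1) x' = x ∧ y = g.f i x' - T.d (i + 1) i y'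

namespace ConeExact

variable {S T : ChainComplex AddCommGrpCat.{u} ℕ} {g : S ⟶ T}

lemma hom_d_apply (g : S ⟶ T) (i j : ℕ) (x : S.X i) : g.f j (S.d i j x) = T.d i j (g.f i x) := by
  rw [← ConcreteCategory.comp_apply, ← g.comm, ConcreteCategory.comp_apply]

/-- Cone cycles `(0, y)` in degree `n` give surjectivity on homology; cone cycles `(x, y)` in degree
`n + 1`, which say that `g x` is a boundary, give injectivity. -/
theorem nonempty_homology_iso (hg : ConeExact g) (n : ℕ) :
    Nonempty (T.homology n ≅ S.homology n) := by
  refine T.nonempty_homology_iso_of_representatives n (Z := S.cycles n)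
    ((g.f n).hom.comp (S.iCycles n).hom) (S.homologyπ n).hom (S.homologyπ_surjective n)
    (fun z => ?_) (fun y hy => ?_) (fun z => ?_)
  · change T.d _ _ (g.f n (S.iCycles n z)) = 0
    rw [← hom_d_apply, S.d_iCycles_apply, map_zero]
  · have hy' : T.d n (n - 1) y = 0 := by
      obtain _ | n := n
      · exact ChainFiltration.d_apply_eq_zero (by simp) _
      · rwa [ChainComplex.next_nat_succ] at hy
    obtain ⟨x', y', h₁, rfl⟩ := hg n 0 y (fun _ => rfl) (fun _ => map_zero _)
      (by rw [map_zero, hy'])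
    obtain ⟨z, rfl⟩ : ∃ z, S.iCycles n z = x' := by
      refine S.exists_iCycles_eq n rfl ?_
      obtain _ | n := n
      · exact ChainFiltration.d_apply_eq_zero (by simp) _
      · rwa [ChainComplex.next_nat_succ]
    rw [ChainComplex.prev]
    exact ⟨z, -y', by rw [map_neg, ← sub_eq_add_neg]; rfl⟩
  · refine (S.homologyπ_eq_zero_iff n (j := n + 1) (by simp) z).trans ?_
    rw [ChainComplex.prev]
    change _ ↔ ∃ y, T.d (n + 1) n y = g.f n (S.iCycles n z)
    constructor
    · rintro ⟨y, hy⟩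
      exact ⟨g.f _ y, by rw [← hy, hom_d_apply]⟩
    · rintro ⟨y, hy⟩
      obtain ⟨x', -, h, -⟩ := hg (n + 1) (S.iCycles n z) y (by simp)
        (fun j => S.d_iCycles_apply n j z) hy.symm
      exact ⟨x', h⟩

/-- The hypothesis is exactness of the cone on graded pieces: a cone cycle modulo `F_{p-1}` is a
boundary modulo `F_{p-1}`. Subtracting that boundary lowers the filtration, and the process stops
because the filtrations vanish in negative indices. -/
theorem of_filtration (F : ChainFiltration S) (F' : ChainFiltration T)
    (h : ∀ (p i : ℕ) (x : S.X (i - 1)) (y : T.X i), x ∈ F.F p (i - 1) → y ∈ F'.F p i →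
      (i = 0 → x = 0) → (∀ j, S.d (i - 1) j x ∈ F.F (p - 1) j) →
      g.f (i - 1) x - T.d i (i - 1) y ∈ F'.F (p - 1) (i - 1) →
      ∃ x' ∈ F.F p i, ∃ y' ∈ F'.F p (i + 1), x - S.d i (i - 1) x' ∈ F.F (p - 1) (i - 1) ∧
        y - g.f i x' + T.d (i + 1) i y' ∈ F'.F (p - 1) i) : ConeExact g := by
  intro i
  -- The index is shifted by one so that the induction starts at `F_{-1} = 0`.
  have key (k : ℕ) : ∀ (x : S.X (i - 1)) (y : T.X i), x ∈ F.F ((k : ℤ) - 1) (i - 1) →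
      y ∈ F'.F ((k : ℤ) - 1) i → (i = 0 → x = 0) → (∀ j, S.d (i - 1) j x = 0) →
      g.f (i - 1) x = T.d i (i - 1) y →
      ∃ (x' : S.X i) (y' : T.X (i + 1)), S.d i (i - 1) x' = x ∧
        y = g.f i x' - T.d (i + 1) i y' := by
    induction k with
    | zero =>
      intro x y hx hy _ _ _
      rw [F.bot _ (by simp), AddSubgroup.mem_bot] at hx
      rw [F'.bot _ (by simp), AddSubgroup.mem_bot] at hy
      exact ⟨0, 0, by simp [hx], by simp [hy]⟩
    | succ k ih =>
      intro x y hx hy h₀ h₁ h₂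
      rw [Nat.cast_succ, add_sub_cancel_right] at hx hy
      obtain ⟨x', hx', y', hy', h₃, h₄⟩ := h k i x y hx hy h₀
        (fun j => by rw [h₁]; exact zero_mem _) (by rw [h₂, sub_self]; exact zero_mem _)
      obtain ⟨x'', y'', h₅, h₆⟩ := ih _ _ h₃ h₄ (fun hi => by
          rw [h₀ hi, ChainFiltration.d_apply_eq_zero (by lia), sub_zero])
        (fun j => by rw [map_sub, h₁, S.d_d_apply, sub_zero])
        (by rw [map_sub, map_add, map_sub, T.d_d_apply, h₂, hom_d_apply, add_zero])
      refine ⟨x' + x'', y' + y'', by rw [map_add, h₅]; abel, ?_⟩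
      rw [map_add, map_add, add_sub_add_comm, ← h₆]
      abel
  intro x y h₀ h₁ h₂
  exact key (i + 1) x y (by rw [F.top (by lia)]; trivial) (by rw [F'.top (by lia)]; trivial)
    h₀ h₁ h₂

end ConeExact

/-- The filtration of a complex by degree. -/
def ChainFiltration.degree (T : ChainComplex AddCommGrpCat.{u} ℕ) : ChainFiltration T where
  F p n := ⨆ _ : (n : ℤ) ≤ p, ⊤
  mono h := iSup_mono' fun h' => ⟨h'.trans h, le_rfl⟩
  d_mem {p n} m x hx := by
    by_cases hm : m + 1 = n
    · by_cases h : (m : ℤ) ≤ p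
      · rw [iSup_pos h]
        trivial
      · rw [iSup_neg (by lia), AddSubgroup.mem_bot] at hx
        rw [hx, map_zero]
        exact zero_mem _
    · rw [ChainFiltration.d_apply_eq_zero hm]
      exact zero_mem _
  bot n hp := iSup_neg (by lia)
  top hp := iSup_pos hp

/-! ### Exact cones from rows and from augmented columns -/

namespace HomologicalComplex₂

variable {K L : HomologicalComplex₂ AddCommGrpCat.{u} (ComplexShape.down ℕ) (ComplexShape.down ℕ)}

/-- A map of first quadrant bicomplexes all of whose rows have exact cones induces a map of total
complexes whose cone is exact. -/
theorem coneExact_total_map (f : K ⟶ L)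
    (h : ∀ q, ConeExact ((HomologicalComplex₂.flipFunctor _ _ _).map f |>.f q)) :
    ConeExact (total.map f (ComplexShape.down ℕ)) := by
  -- Filtering by the second index makes the `q`-th graded piece the map of `q`-th rows.
  refine ConeExact.of_filtration K.totalFiltration₂ L.totalFiltration₂ ?_
  intro q i x y hx hy h₀ h₁ h₂
  rw [mem_totalFiltration₂] at hx hy h₂
  have h₁ := fun j => K.mem_totalFiltration₂.1 (h₁ j)
  -- Below degree `q` everything already lies in filtration `q - 1`.
  by_cases hi : i < q
  · refine ⟨0, zero_mem _, 0, zero_mem _, ?_⟩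
    rw [K.totalFiltration₂.top (by lia), L.totalFiltration₂.top (by lia)]
    exact ⟨trivial, trivial⟩
  obtain ⟨p, rfl⟩ : ∃ p, p + q = i := ⟨i - q, by lia⟩
  obtain ⟨x', y', h₃, h₄⟩ : ∃ (x' : (K.X p).X q) (y' : (L.X (p + 1)).X q),
      (∀ a, a + 1 = p → (K.d p a).f q x' = K.totalPr a q (p + q - 1) x) ∧
      L.totalPr p q (p + q) y = (f.f p).f q x' - (L.d (p + 1) p).f q y' := by
    -- For `p = 0` there is no component of `x` in row `q`, and the exactness of the row is applied
    -- with first entry `0`.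
    obtain _ | p := p
    · obtain ⟨x', y', -, e⟩ := h q 0 0 (L.totalPr 0 q (0 + q) y) (fun _ => rfl)
        (fun _ => map_zero _)
        ((map_zero _).trans (ChainFiltration.d_apply_eq_zero (by simp) _).symm)
      exact ⟨x', y', by simp, e⟩
    · have hd (j : ℕ) : (K.d p j).f q (K.totalPr p q (p + 1 + q - 1) x) = 0 := by
        by_cases hj : j + 1 = p
        · subst hj
          have := h₁ (j + q) j q rfl (by lia)
          rw [K.totalPr_d rfl (by lia), hx j (q + 1) (by lia) (by lia), map_zero, smul_zero,
            add_zero] at this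
          exact this
        · exact ChainFiltration.d_apply_eq_zero (T := K.flip.X q) hj _
      have hxy := h₂ p q (by lia) (by lia)
      rw [map_sub, totalPr_map, totalPr_d _ (by lia) (by lia), hy p (q + 1) (by lia) (by lia),
        map_zero, smul_zero, add_zero, sub_eq_zero] at hxy
      obtain ⟨x', y', e, e'⟩ := h q (p + 1) (K.totalPr p q (p + 1 + q - 1) x)
        (L.totalPr (p + 1) q (p + 1 + q) y) (by simp) hd hxy
      refine ⟨x', y', fun a ha => ?_, e'⟩
      obtain rfl : a = p := by lia
      exact e
  refine ⟨K.totalIn p q _ rfl x', ?_, L.totalIn (p + 1) q (p + q + 1) (by lia) y', ?_, ?_, ?_⟩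
  · refine K.mem_totalFiltration₂.2 fun a b _ hb => ?_
    rw [totalPr_totalIn_of_ne _ _ _ (by lia)]
  · refine L.mem_totalFiltration₂.2 fun a b _ hb => ?_
    rw [totalPr_totalIn_of_ne _ _ _ (by lia)]
  · refine K.mem_totalFiltration₂.2 fun a b hab hb => ?_
    by_cases hp : p + q = 0
    · rw [ChainFiltration.d_apply_eq_zero (by lia), sub_zero, h₀ hp, map_zero]
    · rw [map_sub, totalPr_d _ hab (by lia),
        totalPr_totalIn_of_ne (p' := a) (q' := b + 1) _ _ _ (by lia), map_zero, smul_zero, add_zero]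
      by_cases hbq : b = q
      · subst hbq
        obtain rfl : p = a + 1 := by lia
        rw [totalPr_totalIn, h₃ a rfl, sub_self]
      · rw [totalPr_totalIn_of_ne _ _ _ (by lia), map_zero, sub_zero, hx a b hab (by lia)]
  · refine L.mem_totalFiltration₂.2 fun a b hab hb => ?_
    rw [map_add, map_sub, totalPr_map, totalPr_d _ hab rfl,
      totalPr_totalIn_of_ne (p' := a) (q' := b + 1) _ _ _ (by lia), map_zero, smul_zero, add_zero]
    by_cases hbq : b = q
    · subst hbq
      obtain rfl : a = p := by lia
      rw [totalPr_totalIn, totalPr_totalIn, h₄]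
      abel
    · rw [totalPr_totalIn_of_ne _ _ _ (by lia), totalPr_totalIn_of_ne _ _ _ (by lia), map_zero,
        map_zero, hy a b hab (by lia)]
      simp

/-- The map to a complex `C` from the total complex of a bicomplex augmented to `C`. -/
def totalAugmentation (K : HomologicalComplex₂ AddCommGrpCat.{u} (ComplexShape.down ℕ)
    (ComplexShape.down ℕ)) (C : ChainComplex AddCommGrpCat.{u} ℕ) (ε : ∀ p, (K.X p).X 0 ⟶ C.X p)
    (h : ∀ p x, ε p ((K.X p).d 1 0 x) = 0)
    (h' : ∀ p x, ε p ((K.d (p + 1) p).f 0 x) = C.d (p + 1) p (ε (p + 1) x)) :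
    K.total (ComplexShape.down ℕ) ⟶ C where
  f n := AddCommGrpCat.ofHom ((ε n).hom.comp (K.totalPr n 0 n))
  comm' n m hm := by
    obtain rfl : m + 1 = n := hm
    refine AddCommGrpCat.hom_ext (AddMonoidHom.ext fun x => ?_)
    change C.d (m + 1) m (ε (m + 1) (K.totalPr (m + 1) 0 (m + 1) x)) =
      ε m (K.totalPr m 0 m ((K.total (ComplexShape.down ℕ)).d (m + 1) m x))
    rw [K.totalPr_d (by lia) rfl, map_add, map_zsmul, h, smul_zero, add_zero, h']

/-- The hypotheses say that each column is a resolution of `C_p`. With the total complex filtered by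
columns and `C` by degree, the graded pieces of the cone are these augmented columns up to signs and
shift. -/
theorem coneExact_totalAugmentation {C : ChainComplex AddCommGrpCat.{u} ℕ}
    {ε : ∀ p, (K.X p).X 0 ⟶ C.X p} (h h')
    (h₀ : ∀ p, Function.Surjective (ε p))
    (h₁ : ∀ p x, ε p x = 0 → ∃ y, (K.X p).d 1 0 y = x)
    (h₂ : ∀ p q x, (K.X p).d (q + 1) q x = 0 → ∃ y, (K.X p).d (q + 2) (q + 1) y = x) :
    ConeExact (K.totalAugmentation C ε h h') := by
  have hbot {p : ℤ} {n : ℕ} (h : p < n) : (ChainFiltration.degree C).F p n = ⊥ :=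
    iSup_neg (by lia)
  refine ConeExact.of_filtration K.totalFiltration (ChainFiltration.degree C) ?_
  intro p i x y hx hy hi hdx hxy
  rw [mem_totalFiltration] at hx
  have hdx := fun j => K.mem_totalFiltration.1 (hdx j)
  -- For `i < p` there is nothing to correct; at `i = p` the element `y` is lifted along `ε`; for `i
  -- > p` one has `y = 0`, and exactness of the column at position `i - 1 - p` is used.
  obtain h | rfl | h := lt_trichotomy i p
  · refine ⟨0, zero_mem _, 0, zero_mem _, ?_⟩
    rw [K.totalFiltration.top (by lia), (ChainFiltration.degree C).top (by lia)]
    exact ⟨trivial, trivial⟩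
  · obtain ⟨x', hx'⟩ := h₀ i y
    refine ⟨K.totalIn i 0 i rfl x', by rw [K.totalFiltration.top le_rfl]; trivial, 0, zero_mem _,
      ?_, ?_⟩
    · obtain _ | i := i
      · rw [hi rfl, ChainFiltration.d_apply_eq_zero (by simp), sub_zero]
        exact zero_mem _
      · rw [K.totalFiltration.top (by simp)]
        trivial
    · change y - ε i (K.totalPr i 0 i (K.totalIn i 0 i rfl x')) + _ ∈ _
      rw [totalPr_totalIn, hx', map_zero, sub_self, add_zero]
      exact zero_mem _
  · obtain ⟨q, rfl⟩ : ∃ q, i = p + q + 1 := ⟨i - p - 1, by lia⟩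
    rw [hbot (by lia), AddSubgroup.mem_bot] at hy
    subst hy
    obtain ⟨x', hx'⟩ : ∃ x', (K.X p).d (q + 1) q x' = K.totalPr p q (p + q) x := by
      obtain _ | q := q
      · refine h₁ p _ ?_
        rw [hbot (by simp), AddSubgroup.mem_bot, map_zero, sub_zero] at hxy
        exact hxy
      · refine h₂ p q _ ?_
        have := hdx (p + q) p q rfl (by lia)
        rw [K.totalPr_d rfl (by lia), hx (p + 1) q (by lia) (by lia), map_zero, zero_add] at this
        have e := congrArg ((-1 : ℤ) ^ p • ·) this
        simpa [smul_smul, ← mul_pow] using e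
    -- The factor `(-1)^p` cancels the sign of the vertical differential in the total complex.
    refine ⟨(-1 : ℤ) ^ p • K.totalIn p (q + 1) (p + q + 1) (by lia) x', ?_, 0, zero_mem _, ?_, ?_⟩
    · refine K.mem_totalFiltration.2 fun a b hab hb => ?_
      rw [map_zsmul, totalPr_totalIn_of_ne _ _ _ (by lia), smul_zero]
    · refine K.mem_totalFiltration.2 fun a b hab hb => ?_
      change a + b = p + q at hab
      rw [map_sub]
      change K.totalPr a b (p + q) x -
        K.totalPr a b (p + q) ((K.total (ComplexShape.down ℕ)).d (p + q + 1) (p + q) _) = 0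
      rw [totalPr_d _ hab rfl]
      by_cases ha : a = p
      · subst ha
        obtain rfl : b = q := by lia
        simp only [map_zsmul]
        rw [totalPr_totalIn_of_ne (p' := a + 1) _ _ _ (by lia), totalPr_totalIn, hx', smul_smul,
          ← mul_pow]
        simp
      · have hx₀ : K.totalPr a b (p + q) x = 0 := hx a b hab (by lia)
        simp only [map_zsmul]
        rw [totalPr_totalIn_of_ne (p' := a + 1) _ _ _ (by lia),
          totalPr_totalIn_of_ne (p' := a) _ _ _ (by lia), hx₀]
        simp
    · change 0 - ε _ (K.totalPr (p + q + 1) 0 (p + q + 1) _) + _ ∈ _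
      rw [map_zsmul, totalPr_totalIn_of_ne _ _ _ (by lia)]
      simp only [smul_zero, map_zero, sub_zero, add_zero]
      exact zero_mem _

end HomologicalComplex₂

/-! ### The second page for a bicomplex -/

namespace HomologicalComplex₂

variable (K : HomologicalComplex₂ AddCommGrpCat.{u} (ComplexShape.down ℕ) (ComplexShape.down ℕ))

lemma mem_totalFiltration_Z {r p : ℤ} {n : ℕ} {x : (K.total (ComplexShape.down ℕ)).X n} :
    x ∈ K.totalFiltration.Z r p n ↔ (∀ a b : ℕ, a + b = n → p < a → K.totalPr a b n x = 0) ∧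
      ∀ a b : ℕ, a + b + 1 = n → p - r < a → (K.d (a + 1) a).f b (K.totalPr (a + 1) b n x) +
        (-1 : ℤ) ^ a • (K.X a).d (b + 1) b (K.totalPr a (b + 1) n x) = 0 := by
  rw [ChainFiltration.mem_Z, mem_totalFiltration]
  refine and_congr_right fun _ => ⟨fun h a b hab ha => ?_, fun h m => ?_⟩
  · rw [← K.totalPr_d rfl hab]
    exact K.mem_totalFiltration.1 (h _) a b rfl ha
  · rw [mem_totalFiltration]
    intro a b hab ha
    by_cases hm : m + 1 = n
    · rw [K.totalPr_d hab hm]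
      exact h a b (by lia) ha
    · rw [ChainFiltration.d_apply_eq_zero hm, map_zero]

/-- The components of `z` beyond column `p` vanish, so in column `p` the boundary of `z` is, up to
sign, the vertical boundary of the leading component. It vanishes because the total boundary lies in
`F_{p-1}`. -/
lemma d_totalPr_eq_zero_of_mem_Z {r : ℤ} (hr : 1 ≤ r) {p q : ℕ} {n : ℕ} (hn : p + q = n)
    {z : (K.total (ComplexShape.down ℕ)).X n} (hz : z ∈ K.totalFiltration.Z r p n) (j : ℕ) :
    (K.X p).d q j (K.totalPr p q n z) = 0 := by
  by_cases hj : j + 1 = q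
  · subst hj
    obtain ⟨h₁, h₂⟩ := K.mem_totalFiltration_Z.1 hz
    have e := h₂ p j hn (by lia)
    rw [h₁ (p + 1) j (by lia) (by lia), map_zero, zero_add] at e
    have e := congrArg ((-1 : ℤ) ^ p • ·) e
    simpa [smul_smul, ← mul_pow] using e
  · exact ChainFiltration.d_apply_eq_zero hj _

/-- If the horizontal boundary of `x` equals the vertical boundary of `y` in column `p - 1`, then
adding `y` with the opposite of the sign of the vertical differential there pushes the total
boundary down to `F_{p-2}`. For `p = 0` no correction is needed. -/
lemma exists_mem_Z_two {p q : ℕ} (x : (K.X p).X q) (hx : ∀ j : ℕ, (K.X p).d q j x = 0)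
    (hx' : ∀ p', p' + 1 = p → ∃ y, (K.X p').d (q + 1) q y = (K.d p p').f q x) :
    ∃ z ∈ K.totalFiltration.Z 2 p (p + q), K.totalPr p q (p + q) z = x := by
  obtain _ | p := p
  · refine ⟨K.totalIn 0 q (0 + q) rfl x, K.mem_totalFiltration_Z.2 ⟨?_, ?_⟩,
      K.totalPr_totalIn ..⟩
    · intro a b _ ha
      rw [totalPr_totalIn_of_ne _ _ _ (by simp at ha; lia)]
    · intro a b hab _
      rw [totalPr_totalIn_of_ne _ _ _ (by lia), map_zero, zero_add]
      by_cases ha : a = 0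
      · subst ha
        obtain rfl : q = b + 1 := by lia
        rw [totalPr_totalIn, hx, smul_zero]
      · rw [totalPr_totalIn_of_ne _ _ _ (by lia), map_zero, smul_zero]
  · obtain ⟨y, hy⟩ := hx' p rfl
    refine ⟨K.totalIn (p + 1) q (p + 1 + q) rfl x -
      (-1 : ℤ) ^ p • K.totalIn p (q + 1) (p + 1 + q) (by lia) y,
      K.mem_totalFiltration_Z.2 ⟨?_, ?_⟩, ?_⟩
    · intro a b _ ha
      rw [map_sub, map_zsmul, totalPr_totalIn_of_ne _ _ _ (by lia),
        totalPr_totalIn_of_ne _ _ _ (by lia), smul_zero, sub_zero]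
    · intro a b hab ha
      simp only [map_sub, map_zsmul]
      rw [totalPr_totalIn_of_ne (p := p) (p' := a + 1) _ _ _ (by lia)]
      by_cases hap : a = p
      · subst hap
        obtain rfl : b = q := by lia
        rw [totalPr_totalIn, totalPr_totalIn, hy,
          totalPr_totalIn_of_ne (p := a + 1) _ _ _ (by lia)]
        simp [smul_smul, ← mul_pow]
      · rw [totalPr_totalIn_of_ne (p := p) _ _ _ (by lia),
          totalPr_totalIn_of_ne (p := p + 1) (p' := a + 1) _ _ _ (by lia)]
        by_cases hap' : a = p + 1
        · subst hap'
          obtain rfl : q = b + 1 := by lia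
          rw [totalPr_totalIn, hx]
          simp
        · rw [totalPr_totalIn_of_ne _ _ _ (by lia)]
          simp
    · rw [map_sub, map_zsmul, totalPr_totalIn, totalPr_totalIn_of_ne _ _ _ (by lia), smul_zero,
        sub_zero]

/-- The element `x + (-1)^p y` has these properties; its boundary has component `d₁x + d₂y` at `(p,
q)`. The indices `2 - 1` and `p + 2 - 1` are those of the denominator of the second page. -/
lemma exists_mem_Z_one {p q : ℕ} (x : (K.X (p + 1)).X q) (hx : ∀ j : ℕ, (K.X (p + 1)).d q j x = 0)
    (y : (K.X p).X (q + 1)) :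
    ∃ Y ∈ K.totalFiltration.Z (2 - 1) (p + 2 - 1) (p + q + 1),
      K.totalPr (p + 1) q (p + q + 1) Y = x ∧
      K.totalPr p (q + 1) (p + q + 1) Y = (-1 : ℤ) ^ p • y ∧
      ∀ a b, a + b = p + q + 1 → p + 1 < a → K.totalPr a b (p + q + 1) Y = 0 := by
  refine ⟨K.totalIn (p + 1) q (p + q + 1) (by lia) x +
    (-1 : ℤ) ^ p • K.totalIn p (q + 1) (p + q + 1) (by lia) y,
    K.mem_totalFiltration_Z.2 ⟨?_, ?_⟩, ?_, ?_, ?_⟩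
  · intro a b _ ha
    rw [map_add, map_zsmul, totalPr_totalIn_of_ne _ _ _ (by lia),
      totalPr_totalIn_of_ne _ _ _ (by lia), smul_zero, add_zero]
  · intro a b hab ha
    simp only [map_add, map_zsmul]
    rw [totalPr_totalIn_of_ne (p := p) (p' := a + 1) _ _ _ (by lia),
      totalPr_totalIn_of_ne (p := p) (p' := a) _ _ _ (by lia),
      totalPr_totalIn_of_ne (p := p + 1) (p' := a + 1) _ _ _ (by lia)]
    by_cases hap : a = p + 1
    · subst hap
      obtain rfl : q = b + 1 := by lia
      rw [totalPr_totalIn, hx]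
      simp
    · rw [totalPr_totalIn_of_ne _ _ _ (by lia)]
      simp
  · rw [map_add, map_zsmul, totalPr_totalIn, totalPr_totalIn_of_ne _ _ _ (by lia),
      smul_zero, add_zero]
  · rw [map_add, map_zsmul, totalPr_totalIn, totalPr_totalIn_of_ne _ _ _ (by lia),
      zero_add]
  · intro a b _ ha
    rw [map_add, map_zsmul, totalPr_totalIn_of_ne _ _ _ (by lia),
      totalPr_totalIn_of_ne _ _ _ (by lia), smul_zero, add_zero]

/-- Membership depends on the leading component alone: an element of `Z²_p` whose leading component
vanishes lies in `Z¹_{p-1}`. On leading components the denominator is the vertical boundaries plus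
the horizontal boundaries of vertical cycles. -/
lemma mem_B_two_iff {p q : ℕ} {z : (K.total (ComplexShape.down ℕ)).X (p + q)}
    (hz : z ∈ K.totalFiltration.Z 2 p (p + q)) :
    z ∈ K.totalFiltration.B 2 p (p + q) ↔ ∃ (x : (K.X (p + 1)).X q) (y : (K.X p).X (q + 1)),
      (∀ j : ℕ, (K.X (p + 1)).d q j x = 0) ∧
        K.totalPr p q (p + q) z = (K.d (p + 1) p).f q x + (K.X p).d (q + 1) q y := by
  rw [ChainFiltration.mem_B]
  constructor
  · rintro ⟨w, hw, y, hy, e⟩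
    refine ⟨K.totalPr (p + 1) q (p + q + 1) y, (-1 : ℤ) ^ p • K.totalPr p (q + 1) (p + q + 1) y,
      fun j => ?_, ?_⟩
    · exact K.d_totalPr_eq_zero_of_mem_Z (r := 1) le_rfl (by lia)
        (K.totalFiltration.Z_le _ (by push_cast; lia) (by push_cast; lia) hy) j
    · rw [← e, map_add, (K.mem_totalFiltration_Z.1 hw).1 p q rfl (by lia), zero_add,
        K.totalPr_d rfl rfl, map_zsmul]
  · rintro ⟨x, y, hx, e⟩
    obtain ⟨Y, hY, h₁, h₂, h₃⟩ := K.exists_mem_Z_one x hx y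
    refine ⟨z - (K.total (ComplexShape.down ℕ)).d (p + q + 1) (p + q) Y, ?_, Y, hY,
      sub_add_cancel _ _⟩
    rw [ChainFiltration.mem_Z] at hz
    refine (ChainFiltration.mem_Z _).2 ⟨K.mem_totalFiltration.2 fun a b hab ha => ?_,
      fun m => ?_⟩
    · rw [map_sub, K.totalPr_d hab rfl]
      by_cases hap : a = p
      · subst hap
        obtain rfl : b = q := by lia
        rw [h₁, h₂, e, map_zsmul, smul_smul, ← mul_pow]
        simp
      · rw [K.mem_totalFiltration.1 hz.1 a b hab (by lia), h₃ (a + 1) b (by lia) (by lia)]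
        by_cases hap' : a = p + 1
        · subst hap'
          obtain rfl : q = b + 1 := by lia
          rw [h₁, hx]
          simp
        · rw [h₃ a (b + 1) (by lia) (by lia)]
          simp
    · rw [map_sub, HomologicalComplex.d_d_apply, sub_zero]
      exact K.totalFiltration.mono (by lia) (hz.2 m)

set_option maxHeartbeats 400000 in
/-- The second page of the spectral sequence of a bicomplex is the horizontal homology of its
vertical homology. The latter is given as a quotient `π : Zc ⟶ Hc` of the complex `Zc` of vertical
cycles. -/
theorem nonempty_page_two_iso {q : ℕ} {Zc Hc : ChainComplex AddCommGrpCat.{u} ℕ}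
    (i : Zc ⟶ K.flip.X q) (π : Zc ⟶ Hc)
    (hi : ∀ p c (j : ℕ), (K.X p).d q j (i.f p c) = 0)
    (hi' : ∀ p (x : (K.X p).X q), (∀ j : ℕ, (K.X p).d q j x = 0) → ∃ c, i.f p c = x)
    (hπ : ∀ p, Function.Surjective (π.f p))
    (hπ' : ∀ p c, π.f p c = 0 ↔ ∃ y, (K.X p).d (q + 1) q y = i.f p c) (p : ℕ) :
    Nonempty ((K.totalFiltration.page 2).X (p, q) ≅ Hc.homology p) := by
  have hd (p p' : ℕ) (c) : (K.d p p').f q (i.f p c) = i.f p' (Zc.d p p' c) :=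
    (ConeExact.hom_d_apply i p p' c).symm
  let f : K.totalFiltration.Z 2 p (p + q) →+ (K.X p).X q :=
    (K.totalPr p q (p + q)).comp (K.totalFiltration.Z 2 p (p + q)).subtype
  -- Representatives are pairs formed by an element of `Z²_p` and a vertical cycle with the same
  -- leading component; they map both to the second page and to `Hc`.
  let S : AddSubgroup (K.totalFiltration.Z 2 p (p + q) × Zc.X p) :=
    (f.comp (AddMonoidHom.fst _ _)).eqLocus ((i.f p).hom.comp (AddMonoidHom.snd _ _))
  have hS (z : S) : K.totalPr p q (p + q) z.1.1.1 = i.f p z.1.2 := z.2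
  obtain ⟨a, ha⟩ : ∃ a : S →+ Hc.X p, ∀ z, a z = π.f p z.1.2 :=
    ⟨(π.f p).hom.comp ((AddMonoidHom.snd _ _).comp S.subtype), fun _ => rfl⟩
  obtain ⟨b, hb⟩ : ∃ b : S →+ (K.totalFiltration.page 2).X (p, q),
      ∀ z, b z = K.totalFiltration.pageMk 2 (p, q) z.1.1 :=
    ⟨(K.totalFiltration.pageMk 2 (p, q)).comp ((AddMonoidHom.fst _ _).comp S.subtype),
      fun _ => rfl⟩
  suffices Nonempty (Hc.homology p ≅ (K.totalFiltration.page 2).X (p, q)) from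
    this.map Iso.symm
  refine Hc.nonempty_homology_iso_of_representatives p a b ?_ ?_ ?_ ?_
  · intro x
    obtain ⟨z, rfl⟩ := K.totalFiltration.pageMk_surjective 2 (p, q) x
    obtain ⟨c, hc⟩ := hi' p (K.totalPr p q (p + q) z.1)
      (K.d_totalPr_eq_zero_of_mem_Z (by lia) rfl z.2)
    exact ⟨⟨(z, c), hc.symm⟩, hb _⟩
  · intro z
    rw [ha]
    obtain _ | p := p
    · exact ChainFiltration.d_apply_eq_zero (by simp) _
    · rw [ChainComplex.next_nat_succ, ← ConeExact.hom_d_apply, hπ', ← hd, ← hS]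
      generalize z.1.1 = z
      obtain ⟨z, hz⟩ := z
      have e := (K.mem_totalFiltration_Z.1 hz).2 p q (by lia) (by lia)
      refine ⟨-((-1 : ℤ) ^ p • K.totalPr p (q + 1) (p + 1 + q) z), ?_⟩
      rw [map_neg, map_zsmul]
      exact (eq_neg_of_add_eq_zero_left e).symm
  · intro x hx
    obtain ⟨c, rfl⟩ := hπ p x
    obtain ⟨z, hz, h⟩ := K.exists_mem_Z_two (i.f p c) (hi p c) (by
      rintro p' rfl
      rwa [ChainComplex.next_nat_succ, ← ConeExact.hom_d_apply, hπ', ← hd] at hx)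
    exact ⟨⟨(⟨z, hz⟩, c), h⟩, 0, by rw [map_zero, add_zero, ha]⟩
  · intro z
    have hz : b z = 0 ↔ z.1.1.1 ∈ K.totalFiltration.B 2 p (p + q) := by
      rw [hb]
      exact K.totalFiltration.pageMk_eq_zero (pq := (p, q)) z.1.1
    refine hz.trans ((K.mem_B_two_iff z.1.1.2).trans ?_)
    rw [ChainComplex.prev, ha, hS]
    constructor
    · rintro ⟨x, y, hx, e⟩
      obtain ⟨c', rfl⟩ := hi' _ x hx
      refine ⟨π.f (p + 1) c', ?_⟩
      rw [← ConeExact.hom_d_apply, eq_comm, ← sub_eq_zero, ← map_sub, hπ', map_sub, e, hd]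
      exact ⟨y, (add_sub_cancel_left _ _).symm⟩
    · rintro ⟨y, hy⟩
      obtain ⟨c', rfl⟩ := hπ (p + 1) y
      rw [← ConeExact.hom_d_apply] at hy
      obtain ⟨y, hy⟩ := (hπ' p (z.1.2 - Zc.d (p + 1) p c')).1 (by rw [map_sub, hy, sub_self])
      refine ⟨i.f _ c', y, hi _ _, ?_⟩
      rw [hd, hy, map_sub]
      exact (add_sub_cancel _ _).symm

end HomologicalComplex₂

/-! ### The action of `Q` on `B_*(P) ⊗_N A` -/

namespace GrpExtMod

/-- The complex `B_*(P) ⊗_N A`. -/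
def relComplex : GrpExtMod.{u} ⥤ ChainComplex AddCommGrpCat.{u} ℕ := relBar ⋙ BarDatum.complex

/-- The action of `x : P` on `B_*(P) ⊗_N A`. -/
def relComplexAct (X : GrpExtMod.{u}) (x : X.P) : relComplex.obj X ⟶ relComplex.obj X :=
  BarDatum.complex.map (act X x)

/-- Elements with the same image in `Q` differ by an element of `N`, which is absorbed by the tensor
product over `N`. So `Q` acts on the chains themselves, which is what allows the triple complex to
be formed. -/
lemma relComplexAct_eq (X : GrpExtMod.{u}) {x y : X.P} (h : X.p x = X.p y) :
    relComplexAct X x = relComplexAct X y := by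
  obtain ⟨n, h₁, h₂⟩ := exists_mul_of_p_eq X h
  have h : BarDatum.simplicialChainsMap (act X x) = BarDatum.simplicialChainsMap (act X y) :=
    NatTrans.ext (funext fun Δ => BarDatum.chainHom_eq_of_smul (t := fun z => (act X x).pts ∘ z)
      (t' := fun z => (act X y).pts ∘ z) n (fun z => funext fun k => h₁ (z k)) h₂)
  exact congrArg (alternatingFaceMapComplex AddCommGrpCat.{u}).map h

lemma relComplexAct_one (X : GrpExtMod.{u}) : relComplexAct X 1 = 𝟙 _ := by
  have h : act X 1 = 𝟙 _ := by
    refine BarDatum.Hom.ext (funext fun (y : X.P) => one_mul y) ?_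
    change X.ρ 1 = _
    rw [map_one]
    rfl
  rw [relComplexAct, h, CategoryTheory.Functor.map_id]
  rfl

lemma relComplexAct_mul (X : GrpExtMod.{u}) (x y : X.P) :
    relComplexAct X (x * y) = relComplexAct X y ≫ relComplexAct X x := by
  have h : act X (x * y) = act X y ≫ act X x := by
    refine BarDatum.Hom.ext (funext fun (z : X.P) => mul_assoc x y z) ?_
    change X.ρ (x * y) = _
    rw [map_mul]
    rfl
  rw [relComplexAct, h, CategoryTheory.Functor.map_comp]
  rfl

lemma relComplexAct_naturality {X Y : GrpExtMod.{u}} (f : X ⟶ Y) (x : X.P) :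
    relComplexAct X x ≫ relComplex.map f = relComplex.map f ≫ relComplexAct Y (f.homP x) := by
  have h : act X x ≫ relBar.map f = relBar.map f ≫ act Y (f.homP x) :=
    BarDatum.Hom.ext (funext fun (y : X.P) => map_mul f.homP x y)
      (AddMonoidHom.ext fun a => f.equivariant x a)
  change BarDatum.complex.map _ ≫ BarDatum.complex.map _ =
    BarDatum.complex.map _ ≫ BarDatum.complex.map _
  rw [← CategoryTheory.Functor.map_comp, h, CategoryTheory.Functor.map_comp]

variable (Φ Ψ : ChainComplex AddCommGrpCat.{u} ℕ ⥤ AddCommGrpCat.{u})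

/-- The action of `Q` on the value of a functor on `B_*(P) ⊗_N A`. -/
def quotρ (X : GrpExtMod.{u}) : X.Q →* AddMonoid.End (Φ.obj (relComplex.obj X)) where
  toFun y := (Φ.map (relComplexAct X (Function.surjInv X.surj y))).hom
  map_one' := by
    rw [relComplexAct_eq X (y := 1) (by rw [p_surjInv, map_one]), relComplexAct_one,
      CategoryTheory.Functor.map_id]
    rfl
  map_mul' y z := by
    rw [relComplexAct_eq X (y := Function.surjInv X.surj y * Function.surjInv X.surj z)
      (by simp only [map_mul, p_surjInv]), relComplexAct_mul, CategoryTheory.Functor.map_comp]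
    rfl

/-- This removes the chosen preimages: equivariance is checked on images of elements of `P`. -/
lemma quotρ_p (X : GrpExtMod.{u}) (x : X.P) :
    quotρ Φ X (X.p x) = (Φ.map (relComplexAct X x)).hom := by
  change (Φ.map (relComplexAct X (Function.surjInv X.surj (X.p x)))).hom = _
  rw [relComplexAct_eq X (p_surjInv X (X.p x))]

/-- The group `Q` acting on the value of a functor on `B_*(P) ⊗_N A`. -/
def quot : GrpExtMod.{u} ⥤ GrpMod.{u} where
  obj X := { G := X.Q, A := Φ.obj (relComplex.obj X), ρ := quotρ Φ X }
  map {X Y} f := ⟨f.homQ, (Φ.map (relComplex.map f)).hom, fun y a => by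
    obtain ⟨x, rfl⟩ := X.surj y
    rw [f.comm_p, quotρ_p, quotρ_p]
    have h := congrArg Φ.map (relComplexAct_naturality f x)
    rw [CategoryTheory.Functor.map_comp, CategoryTheory.Functor.map_comp] at h
    exact congrArg (fun t => t.hom a) h⟩
  map_id X := GrpMod.Hom.ext rfl (by
    change (Φ.map (relComplex.map (𝟙 X))).hom = _
    rw [CategoryTheory.Functor.map_id, CategoryTheory.Functor.map_id]
    rfl)
  map_comp f g := GrpMod.Hom.ext rfl (by
    change (Φ.map (relComplex.map (f ≫ g))).hom = _
    rw [CategoryTheory.Functor.map_comp, CategoryTheory.Functor.map_comp]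
    rfl)

variable {Φ Ψ}

/-- Functoriality of `quot` in the functor. -/
def quotMap (α : Φ ⟶ Ψ) : quot Φ ⟶ quot Ψ where
  app X := ⟨MonoidHom.id _, (α.app _).hom, fun y a => by
    obtain ⟨x, rfl⟩ := X.surj y
    change (α.app _).hom (quotρ Φ X (X.p x) a) = quotρ Ψ X (X.p x) ((α.app _).hom a)
    rw [quotρ_p, quotρ_p]
    exact congrArg (fun t => t.hom a) (α.naturality (relComplexAct X x))⟩
  naturality X Y f := GrpMod.Hom.ext rfl
    (congrArg AddCommGrpCat.Hom.hom (α.naturality (relComplex.map f)))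

lemma homologyρ_p (X : GrpExtMod.{u}) (q : ℕ) (x : X.P) :
    homologyρ X q (X.p x) = (homologyAct X q x).hom := by
  change (homologyAct X q (Function.surjInv X.surj (X.p x))).hom = _
  rw [homologyAct_eq X q (p_surjInv X (X.p x))]

/-- The `Q`-module `H_q(N, A)` is the homology of `B_*(P) ⊗_N A`. -/
def quotHomologyIso (q : ℕ) :
    quotHomology.{u} q ≅ quot (HomologicalComplex.homologyFunctor _ _ q) :=
  NatIso.ofComponents (fun X =>
    { hom := ⟨MonoidHom.id _, (compareIso X q).hom.hom, fun y a => by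
        obtain ⟨x, rfl⟩ := X.surj y
        change (compareIso X q).hom.hom (homologyρ X q (X.p x) a) =
          quotρ (HomologicalComplex.homologyFunctor _ _ q) X (X.p x) ((compareIso X q).hom.hom a)
        rw [quotρ_p, homologyρ_p]
        have h : homologyAct X q x ≫ (compareIso X q).hom =
          (compareIso X q).hom ≫ (BarDatum.homology q).map (act X x) := by simp [homologyAct]
        exact congrArg (fun t => t.hom a) h⟩
      inv := ⟨MonoidHom.id _, (compareIso X q).inv.hom, fun y a => by
        obtain ⟨x, rfl⟩ := X.surj y
        change (compareIso X q).inv.hom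
          (quotρ (HomologicalComplex.homologyFunctor _ _ q) X (X.p x) a) =
          homologyρ X q (X.p x) ((compareIso X q).inv.hom a)
        rw [quotρ_p, homologyρ_p]
        have h : (BarDatum.homology q).map (act X x) ≫ (compareIso X q).inv =
          (compareIso X q).inv ≫ homologyAct X q x := by simp [homologyAct]
        exact congrArg (fun t => t.hom a) h⟩
      hom_inv_id := GrpMod.Hom.ext rfl
        (congrArg AddCommGrpCat.Hom.hom (compareIso X q).hom_inv_id)
      inv_hom_id := GrpMod.Hom.ext rfl
        (congrArg AddCommGrpCat.Hom.hom (compareIso X q).inv_hom_id) })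
    fun {X Y} f => GrpMod.Hom.ext rfl <| congrArg AddCommGrpCat.Hom.hom <| by
      change (BarDatum.homology q).map (GrpMod.toBarDatum.map (sub.map f)) ≫
        (BarDatum.homology q).map (compare Y) = (BarDatum.homology q).map (compare X) ≫
          (BarDatum.homology q).map (relBar.map f)
      rw [← CategoryTheory.Functor.map_comp, compare_naturality, CategoryTheory.Functor.map_comp]

end GrpExtMod

lemma AddCommGrpCat.sum_apply {ι : Type*} {A B : AddCommGrpCat.{u}} (s : Finset ι)
    (f : ι → (A ⟶ B)) (x : A) : (∑ i ∈ s, f i) x = ∑ i ∈ s, f i x := by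
  change AddCommGrpCat.homAddEquiv (∑ i ∈ s, f i) x = _
  rw [map_sum, AddMonoidHom.finsetSum_apply]
  rfl

/-! ### Homomorphisms out of `ℤ[Xᵐ⁺¹] ⊗_Γ A` -/

namespace BarDatum

lemma Chain.induction {D : BarDatum.{u}} {m : ℕ} {P : D.Chain m → Prop} (z : D.Chain m)
    (h₀ : P 0) (ht : ∀ x a, P (Chain.tmul D x a)) (ha : ∀ z w, P z → P w → P (z + w)) : P z := by
  obtain ⟨v, rfl⟩ := QuotientAddGroup.mk_surjective z
  induction v using Finsupp.induction_linear with
  | zero => exact h₀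
  | add v w hv hw => exact ha _ _ hv hw
  | single x a => exact ht x a

/-- A homomorphism defined on `ℤ[Xᵐ⁺¹] ⊗_Γ A`. -/
def Chain.lift {D : BarDatum.{u}} {m : ℕ} {B : Type*} [AddCommGroup B]
    (f : (Fin (m + 1) → D.X) → D.A →+ B) (h : ∀ (γ : D.Γ) x a, f (γ • x) (D.ρ γ a) = f x a) :
    D.Chain m →+ B :=
  QuotientAddGroup.lift _ (Finsupp.liftAddHom f) (by
    rw [rel, AddSubgroup.closure_le]
    rintro _ ⟨γ, x, a, rfl⟩
    change Finsupp.liftAddHom f (Finsupp.single (γ • x) (D.ρ γ a) - Finsupp.single x a) = 0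
    rw [map_sub, Finsupp.liftAddHom_apply_single, Finsupp.liftAddHom_apply_single, h, sub_self])

@[simp]
lemma Chain.lift_tmul {D : BarDatum.{u}} {m : ℕ} {B : Type*} [AddCommGroup B]
    (f : (Fin (m + 1) → D.X) → D.A →+ B) (h) (x : Fin (m + 1) → D.X) (a : D.A) :
    Chain.lift f h (Chain.tmul D x a) = f x a := by
  change Finsupp.liftAddHom f (Finsupp.single x a) = _
  simp

lemma Chain.tmul_add {D : BarDatum.{u}} {m : ℕ} (x : Fin (m + 1) → D.X) (a b : D.A) :
    Chain.tmul D x (a + b) = Chain.tmul D x a + Chain.tmul D x b := by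
  simp only [Chain.tmul, Finsupp.single_add]
  rfl

lemma Chain.tmul_zero {D : BarDatum.{u}} {m : ℕ} (x : Fin (m + 1) → D.X) :
    Chain.tmul D x 0 = 0 := by
  simp only [Chain.tmul, Finsupp.single_zero]
  rfl

lemma complex_d_apply (D : BarDatum.{u}) (m : ℕ) (x : (complex.obj D).X (m + 1)) :
    (complex.obj D).d (m + 1) m x = ∑ i : Fin (m + 2), (-1 : ℤ) ^ (i : ℕ) •
      Chain.map (D := D) (E := D) (fun x => x ∘ i.succAbove) (AddMonoidHom.id _)
        (fun γ => ⟨γ, fun _ => rfl, fun _ => rfl⟩) x := by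
  change ((alternatingFaceMapComplex _).obj D.simplicialChains).d (m + 1) m x = _
  rw [alternatingFaceMapComplex_obj_d]
  exact AddCommGrpCat.sum_apply Finset.univ
    (fun i : Fin (m + 2) => (-1 : ℤ) ^ (i : ℕ) • D.simplicialChains.δ i) x

lemma complex_map_f_tmul {D E : BarDatum.{u}} (F : D ⟶ E) {m : ℕ} (x : Fin (m + 1) → D.X)
    (a : D.A) : (complex.map F).f m (Chain.tmul D x a) =
      Chain.tmul E (fun j => F.pts (x j)) (F.coeff a) :=
  Chain.map_tmul (fun x => F.pts ∘ x) F.coeff (fun γ => by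
    obtain ⟨γ', h₁, h₂⟩ := F.equivariant γ
    exact ⟨γ', fun x => funext fun i => h₁ (x i), h₂⟩) x a

end BarDatum

/-! ### Exactness of `B_m(G) ⊗_G A` in `A` -/

namespace GrpMod

open BarDatum

/-- The section `x ⊗ a ↦ x₀⁻¹x ⊗ x₀⁻¹a` of the projection from `ℤ[Gᵐ⁺¹] ⊗ A` to
`ℤ[Gᵐ⁺¹] ⊗_G A`. -/
def chainSection (M : GrpMod.{u}) (m : ℕ) :
    (toBarDatum.obj M).Chain m →+ ((Fin (m + 1) → M.G) →₀ M.A) :=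
  Chain.lift (D := toBarDatum.obj M)
    (fun (x : Fin (m + 1) → M.G) => (Finsupp.singleAddHom fun j => (x 0)⁻¹ * x j).comp
      (M.ρ (x 0)⁻¹)) (fun (γ : M.G) (x : Fin (m + 1) → M.G) (a : M.A) => by
    change Finsupp.single (fun j => (γ * x 0)⁻¹ * (γ * x j)) (M.ρ (γ * x 0)⁻¹ (M.ρ γ a)) =
      Finsupp.single (fun j => (x 0)⁻¹ * x j) (M.ρ (x 0)⁻¹ a)
    have e : M.ρ (γ * x 0)⁻¹ (M.ρ γ a) = M.ρ (x 0)⁻¹ a := by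
      change (M.ρ (γ * x 0)⁻¹ * M.ρ γ) a = _
      rw [← map_mul, mul_inv_rev, inv_mul_cancel_right]
    rw [e]
    simp [mul_assoc])

lemma bar_map_f_mk {M N : GrpMod.{u}} (f : M ⟶ N) (m : ℕ) (v : (Fin (m + 1) → M.G) →₀ M.A) :
    (bar.map f).f m (QuotientAddGroup.mk v : (toBarDatum.obj M).Chain m) =
      (QuotientAddGroup.mk ((v.mapDomain (f.hom ∘ ·)).mapRange f.coeff (map_zero _)) :
        (toBarDatum.obj N).Chain m) := rfl

lemma chainSection_tmul (M : GrpMod.{u}) {m : ℕ} (x : Fin (m + 1) → M.G) (a : M.A) :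
    M.chainSection m (Chain.tmul (toBarDatum.obj M) x a) =
      Finsupp.single (fun j => (x 0)⁻¹ * x j) (M.ρ (x 0)⁻¹ a) := by
  exact Chain.lift_tmul (D := toBarDatum.obj M) _ _ x a

lemma mk_chainSection (M : GrpMod.{u}) (m : ℕ) (z : (bar.obj M).X m) :
    (QuotientAddGroup.mk (M.chainSection m z) : (toBarDatum.obj M).Chain m) = z := by
  have : (QuotientAddGroup.mk' ((toBarDatum.obj M).rel m)).comp (M.chainSection m) =
      AddMonoidHom.id _ := Chain.hom_ext fun (x : Fin (m + 1) → M.G) a =>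
    (congrArg QuotientAddGroup.mk (M.chainSection_tmul x a)).trans
      (Chain.tmul_smul (toBarDatum.obj M) (x 0)⁻¹ x a)
  exact DFunLike.congr_fun this z

lemma bar_map_f_tmul {M N : GrpMod.{u}} (f : M ⟶ N) {m : ℕ} (x : Fin (m + 1) → M.G) (a : M.A) :
    (bar.map f).f m (Chain.tmul (toBarDatum.obj M) x a) =
      Chain.tmul (toBarDatum.obj N) (fun j => f.hom (x j)) (f.coeff a) :=
  complex_map_f_tmul (toBarDatum.map f) x a

/-- Normalizing the first entry to `1` is compatible with group homomorphisms. This naturality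
reduces injectivity and exactness on quotients to statements about finitely supported functions. -/
lemma chainSection_bar_map {M N : GrpMod.{u}} (f : M ⟶ N) (m : ℕ) (z : (bar.obj M).X m) :
    N.chainSection m ((bar.map f).f m z) =
      ((M.chainSection m z).mapDomain (f.hom ∘ ·)).mapRange f.coeff (map_zero _) := by
  have : (N.chainSection m).comp ((bar.map f).f m).hom =
      ((Finsupp.mapRange.addMonoidHom f.coeff).comp (Finsupp.mapDomain.addMonoidHom
        (f.hom ∘ ·))).comp (M.chainSection m) :=
    Chain.hom_ext (D := toBarDatum.obj M) fun (x : Fin (m + 1) → M.G) (a : M.A) => by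
      refine (congrArg (N.chainSection m) (bar_map_f_tmul f x a)).trans
        ((N.chainSection_tmul _ _).trans ?_)
      refine Eq.trans ?_ (congrArg ((Finsupp.mapRange.addMonoidHom f.coeff).comp
        (Finsupp.mapDomain.addMonoidHom (f.hom ∘ ·))) (M.chainSection_tmul x a)).symm
      rw [AddMonoidHom.comp_apply, Finsupp.mapDomain.addMonoidHom_apply, Finsupp.mapDomain_single,
        Finsupp.mapRange.addMonoidHom_apply, Finsupp.mapRange_single, f.equivariant, map_inv f.hom]
      congr 1
      funext j
      simp
  exact DFunLike.congr_fun this z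

lemma bar_map_injective {M N : GrpMod.{u}} (f : M ⟶ N) (m : ℕ) (h : Function.Injective f.hom)
    (h' : Function.Injective f.coeff) : Function.Injective ((bar.map f).f m) := by
  intro z w e
  have e := congrArg (N.chainSection m) e
  rw [chainSection_bar_map, chainSection_bar_map] at e
  rw [← M.mk_chainSection m z, ← M.mk_chainSection m w]
  exact congrArg _ (Finsupp.mapDomain_injective h.comp_left
    (Finsupp.mapRange_injective _ (map_zero _) h' e))

lemma bar_map_surjective {M N : GrpMod.{u}} (f : M ⟶ N) (m : ℕ) (h : Function.Surjective f.hom)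
    (h' : Function.Surjective f.coeff) : Function.Surjective ((bar.map f).f m) := by
  intro z
  obtain ⟨v, rfl⟩ := QuotientAddGroup.mk_surjective z
  obtain ⟨v, rfl⟩ := Finsupp.mapRange_surjective f.coeff (map_zero _) h' v
  obtain ⟨v, rfl⟩ := Finsupp.mapDomain_surjective (h.comp_left (α := Fin (m + 1))) v
  exact ⟨_, bar_map_f_mk f m v⟩

lemma bar_map_exact {M N L : GrpMod.{u}} (f : M ⟶ N) (g : N ⟶ L) (m : ℕ)
    (hf : Function.Surjective f.hom) (hg : Function.Injective g.hom)
    (h : ∀ a, g.coeff a = 0 → ∃ b, f.coeff b = a) (z : (bar.obj N).X m)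
    (hz : (bar.map g).f m z = 0) : ∃ w, (bar.map f).f m w = z := by
  have hv (x) : g.coeff (N.chainSection m z x) = 0 := by
    have e := congrArg (L.chainSection m) hz
    rw [chainSection_bar_map] at e
    have e := DFunLike.congr_fun (e.trans (map_zero _)) (g.hom ∘ x)
    rw [Finsupp.mapRange_apply, Finsupp.mapDomain_apply hg.comp_left] at e
    exact e
  -- A set-theoretic choice of preimages suffices, but it must send `0` to `0` to preserve finite
  -- support.
  obtain ⟨s, hs, hs₀⟩ : ∃ s : N.A → M.A, (∀ a, g.coeff a = 0 → f.coeff (s a) = a) ∧ s 0 = 0 := by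
    classical
    choose s hs using h
    exact ⟨fun a => if ha : g.coeff a = 0 ∧ a ≠ 0 then s a ha.1 else 0, fun a ha => by
      by_cases ha' : a = 0 <;> simp [ha, ha', hs], by simp⟩
  obtain ⟨v, hv'⟩ := Finsupp.mapDomain_surjective (hf.comp_left (α := Fin (m + 1)))
    ((N.chainSection m z).mapRange s hs₀)
  refine ⟨_, (bar_map_f_mk f m v).trans ?_⟩
  rw [← N.mk_chainSection m z, hv']
  refine congrArg _ (Finsupp.ext fun x => ?_)
  exact hs _ (hv x)

end GrpMod

/-! ### Exactness on total complexes -/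

namespace HomologicalComplex₂

variable {K L N : HomologicalComplex₂ AddCommGrpCat.{u} (ComplexShape.down ℕ)
  (ComplexShape.down ℕ)}

lemma total_map_injective (φ : K ⟶ L) (h : ∀ p q, Function.Injective ((φ.f p).f q)) (n : ℕ) :
    Function.Injective ((total.map φ (ComplexShape.down ℕ)).f n) := by
  intro x y e
  refine K.total_ext fun p q _ => h p q ?_
  rw [← totalPr_map, ← totalPr_map, e]

lemma total_map_exact (φ : K ⟶ L) (ψ : L ⟶ N)
    (h : ∀ p q x, (ψ.f p).f q x = 0 → ∃ y, (φ.f p).f q y = x) (n : ℕ)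
    (x : (L.total (ComplexShape.down ℕ)).X n)
    (hx : (total.map ψ (ComplexShape.down ℕ)).f n x = 0) :
    ∃ y, (total.map φ (ComplexShape.down ℕ)).f n y = x := by
  have h' (p q) : ∃ y, (φ.f p).f q y = L.totalPr p q n x :=
    h p q _ (by rw [← totalPr_map, hx, map_zero])
  choose y hy using h'
  obtain ⟨z, hz⟩ := K.exists_totalPr_eq n y
  exact ⟨z, L.total_ext fun p q hpq => by rw [totalPr_map, hz p q hpq, hy]⟩

lemma total_map_surjective (φ : K ⟶ L) (h : ∀ p q, Function.Surjective ((φ.f p).f q)) (n : ℕ) :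
    Function.Surjective ((total.map φ (ComplexShape.down ℕ)).f n) := by
  intro x
  choose y hy using fun p q => h p q (L.totalPr p q n x)
  obtain ⟨z, hz⟩ := K.exists_totalPr_eq n y
  exact ⟨z, L.total_ext fun p q hpq => by rw [totalPr_map, hz p q hpq, hy]⟩

lemma total_map_eq_zero (φ : K ⟶ L) (h : ∀ p q x, (φ.f p).f q x = 0) :
    total.map φ (ComplexShape.down ℕ) = 0 := by
  ext n x
  refine L.total_ext fun p q _ => ?_
  rw [totalPr_map, h]
  exact (map_zero _).symm

end HomologicalComplex₂

/-- The map of bicomplexes `B(G_*, A_*)` induced by a map of simplicial groups with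
coefficients. -/
def barBicomplexMap {M N : SimplicialObject GrpMod.{u}} (φ : M ⟶ N) :
    barBicomplex M ⟶ barBicomplex N :=
  (alternatingFaceMapComplex (ChainComplex AddCommGrpCat.{u} ℕ)).map
    (((SimplicialObject.whiskering _ _).obj GrpMod.bar).map φ)

/-- The total complex of `B(G_*, A_*)`. -/
def barTotal : SimplicialObject GrpMod.{u} ⥤ ChainComplex AddCommGrpCat.{u} ℕ where
  obj M := (barBicomplex M).total (ComplexShape.down ℕ)
  map φ := HomologicalComplex₂.total.map (barBicomplexMap φ) (ComplexShape.down ℕ)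
  map_id M := by
    rw [barBicomplexMap, CategoryTheory.Functor.map_id, CategoryTheory.Functor.map_id]
    exact HomologicalComplex₂.total.map_id ..
  map_comp φ ψ := by
    rw [barBicomplexMap, CategoryTheory.Functor.map_comp, CategoryTheory.Functor.map_comp]
    exact HomologicalComplex₂.total.map_comp ..

/-! ### The bicomplex of the extension and its second page -/

namespace GrpExtMod

variable {Φ Ψ Θ : ChainComplex AddCommGrpCat.{u} ℕ ⥤ AddCommGrpCat.{u}}

variable (M : SimplicialObject GrpExtMod.{u})

variable (Φ) in
/-- The simplicial group `Q_*` acting on the value of a functor on `B_*(P_*) ⊗ A_*`. -/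
abbrev quotSimplicial : SimplicialObject GrpMod.{u} :=
  ((SimplicialObject.whiskering _ _).obj (quot Φ)).obj M

/-- Functoriality of `quotSimplicial` in the functor. -/
def quotSimplicialMap (α : Φ ⟶ Ψ) : quotSimplicial Φ M ⟶ quotSimplicial Ψ M :=
  Functor.whiskerLeft M (quotMap α)

variable (Φ) in
/-- The complex computing the homology of `Q_*` with coefficients in the value of a functor on
`B_*(P_*) ⊗ A_*`. -/
def quotTotal : ChainComplex AddCommGrpCat.{u} ℕ := barTotal.obj (quotSimplicial Φ M)

/-- Functoriality of `quotTotal` in the functor. -/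
def quotTotalMap (α : Φ ⟶ Ψ) : quotTotal Φ M ⟶ quotTotal Ψ M :=
  barTotal.map (quotSimplicialMap M α)

lemma quotTotalMap_comp (α : Φ ⟶ Ψ) (β : Ψ ⟶ Θ) :
    quotTotalMap M (α ≫ β) = quotTotalMap M α ≫ quotTotalMap M β :=
  barTotal.map_comp (quotSimplicialMap M α) (quotSimplicialMap M β)

/-- Checked on generators `y ⊗ w`. Together with `quotTotalMap_comp`, this carries the relations
between differentials, cycles and homology over to the total complexes. -/
lemma quotTotalMap_eq_zero (α : Φ ⟶ Ψ) (h : ∀ T x, α.app T x = 0) : quotTotalMap M α = 0 := by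
  refine HomologicalComplex₂.total_map_eq_zero _ fun p q x => ?_
  exact DFunLike.congr_fun (BarDatum.Chain.hom_ext (D := GrpMod.toBarDatum.obj _)
    (f := ((GrpMod.bar.map ((quotMap α).app (M.obj (op ⦋p⦌)))).f q).hom) (g := 0) fun x a =>
      (GrpMod.bar_map_f_tmul ((quotMap α).app (M.obj (op ⦋p⦌))) x a).trans
        ((congrArg _ (h _ a)).trans (BarDatum.Chain.tmul_zero _))) x

lemma quotTotalMap_injective (α : Φ ⟶ Ψ) (h : ∀ T, Function.Injective (α.app T)) (n : ℕ) :
    Function.Injective ((quotTotalMap M α).f n) :=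
  HomologicalComplex₂.total_map_injective _ (fun p q =>
    GrpMod.bar_map_injective ((quotMap α).app (M.obj (op ⦋p⦌))) q Function.injective_id (h _)) n

lemma quotTotalMap_surjective (α : Φ ⟶ Ψ) (h : ∀ T, Function.Surjective (α.app T)) (n : ℕ) :
    Function.Surjective ((quotTotalMap M α).f n) :=
  HomologicalComplex₂.total_map_surjective _ (fun p q =>
    GrpMod.bar_map_surjective ((quotMap α).app (M.obj (op ⦋p⦌))) q Function.surjective_id (h _)) n

lemma quotTotalMap_exact (α : Φ ⟶ Ψ) (β : Ψ ⟶ Θ)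
    (h : ∀ T x, β.app T x = 0 → ∃ y, α.app T y = x) (n : ℕ) (x : (quotTotal Ψ M).X n)
    (hx : (quotTotalMap M β).f n x = 0) : ∃ y, (quotTotalMap M α).f n y = x :=
  HomologicalComplex₂.total_map_exact _ _ (fun p q x hx =>
    GrpMod.bar_map_exact ((quotMap α).app (M.obj (op ⦋p⦌))) ((quotMap β).app (M.obj (op ⦋p⦌))) q
      Function.surjective_id Function.injective_id (h _) x hx) n x hx

/-- The differential of a complex, as a natural transformation. -/
def evalD (i j : ℕ) : HomologicalComplex.eval AddCommGrpCat.{u} (ComplexShape.down ℕ) i ⟶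
    HomologicalComplex.eval AddCommGrpCat.{u} (ComplexShape.down ℕ) j where
  app T := T.d i j
  naturality _ _ f := f.comm i j

/-- The inclusion of the cycles of a complex, as a natural transformation. -/
def cyclesι (i : ℕ) : HomologicalComplex.cyclesFunctor AddCommGrpCat.{u} (ComplexShape.down ℕ) i ⟶
    HomologicalComplex.eval AddCommGrpCat.{u} (ComplexShape.down ℕ) i where
  app T := T.iCycles i
  naturality _ _ f := HomologicalComplex.cyclesMap_i f i

/-- The map from chains to cycles given by the differential, as a natural transformation. -/
def evalToCycles (i j : ℕ) : HomologicalComplex.eval AddCommGrpCat.{u} (ComplexShape.down ℕ) i ⟶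
    HomologicalComplex.cyclesFunctor AddCommGrpCat.{u} (ComplexShape.down ℕ) j where
  app T := T.toCycles i j
  naturality S T f := by
    change f.f i ≫ T.toCycles i j = S.toCycles i j ≫ HomologicalComplex.cyclesMap f j
    simp [← cancel_mono (T.iCycles j)]

/-- The double complex `t ↦ quotTotal (eval t)`. -/
def quotBicomplex :
    HomologicalComplex₂ AddCommGrpCat.{u} (ComplexShape.down ℕ) (ComplexShape.down ℕ) where
  X t := quotTotal (HomologicalComplex.eval _ _ t) M
  d i j := quotTotalMap M (evalD i j)
  shape i j h := quotTotalMap_eq_zero M _ fun T x => by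
    change T.d i j x = 0
    rw [T.shape _ _ h]
    rfl
  d_comp_d' i j k _ _ := by
    rw [← quotTotalMap_comp]
    exact quotTotalMap_eq_zero M _ fun T x => T.d_d_apply i j k x

/-- The second page of the spectral sequence of `quotBicomplex`. -/
theorem nonempty_quotBicomplex_page_two_iso (s t : ℕ) :
    Nonempty (((quotBicomplex M).flip.totalFiltration.page 2).X (s, t) ≅
      simplicialHomology (((SimplicialObject.whiskering _ _).obj (quotHomology t)).obj M) s) := by
  have hι (t j : ℕ) : quotTotalMap M (cyclesι t) ≫ quotTotalMap M (evalD t j) = 0 := by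
    rw [← quotTotalMap_comp]
    exact quotTotalMap_eq_zero M _ fun T x => T.d_iCycles_apply t j x
  have hto : quotTotalMap M (evalToCycles (t + 1) t) ≫ quotTotalMap M (cyclesι t) =
      quotTotalMap M (evalD (t + 1) t) := by
    rw [← quotTotalMap_comp]
    congr 1
    ext T : 2
    exact T.toCycles_i _ _
  have hπ : quotTotalMap M (evalToCycles (t + 1) t) ≫
      quotTotalMap M (HomologicalComplex.natTransHomologyπ _ _ t) = 0 := by
    rw [← quotTotalMap_comp]
    exact quotTotalMap_eq_zero M _ fun T x =>
      ConcreteCategory.congr_hom (T.toCycles_comp_homologyπ (t + 1) t) x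
  have hinj := quotTotalMap_injective M (cyclesι t) (fun T => T.iCycles_injective t)
  have hπ' (p : ℕ) (c) :
      (quotTotalMap M (HomologicalComplex.natTransHomologyπ _ _ t)).f p c = 0 ↔
        ∃ y, (quotTotalMap M (evalD (t + 1) t)).f p y = (quotTotalMap M (cyclesι t)).f p c := by
    constructor
    · intro hc
      obtain ⟨y, rfl⟩ := quotTotalMap_exact M (evalToCycles (t + 1) t)
        (HomologicalComplex.natTransHomologyπ _ _ t) (fun T z hz => by
          obtain ⟨y, hy⟩ := (T.homologyπ_eq_zero_iff t (j := t + 1) (by simp) z).1 hz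
          exact ⟨y, T.iCycles_injective t
            ((ConcreteCategory.congr_hom (T.toCycles_i (t + 1) t) y).trans hy)⟩) p c hc
      exact ⟨y, (ConcreteCategory.congr_hom (congrArg
        (fun f : quotTotal _ M ⟶ quotTotal _ M => f.f p) hto) y).symm⟩
    · rintro ⟨y, hy⟩
      obtain rfl : (quotTotalMap M (evalToCycles (t + 1) t)).f p y = c := hinj p
        ((ConcreteCategory.congr_hom (congrArg
          (fun f : quotTotal _ M ⟶ quotTotal _ M => f.f p) hto) y).trans hy)
      exact ConcreteCategory.congr_hom (congrArg
        (fun f : quotTotal _ M ⟶ quotTotal _ M => f.f p) hπ) y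
  -- By exactness, the total complexes formed from the cycles and from the homology of `B_*(P) ⊗_N
  -- A` serve as vertical cycles and vertical homology of the bicomplex.
  obtain ⟨e⟩ := (quotBicomplex M).flip.nonempty_page_two_iso (q := t)
    (Zc := quotTotal (HomologicalComplex.cyclesFunctor _ _ t) M)
    (Hc := quotTotal (HomologicalComplex.homologyFunctor _ _ t) M)
    (quotTotalMap M (cyclesι t)) (quotTotalMap M (HomologicalComplex.natTransHomologyπ _ _ t))
    (fun p c j => ConcreteCategory.congr_hom
      (congrArg (fun f : quotTotal _ M ⟶ quotTotal _ M => f.f p) (hι t j)) c)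
    (fun p x hx => quotTotalMap_exact M (cyclesι t) (evalD t ((ComplexShape.down ℕ).next t))
      (fun T x hx => T.exists_iCycles_eq t rfl hx) p x (hx _))
    (quotTotalMap_surjective M _ fun T => T.homologyπ_surjective t)
    hπ' s
  exact ⟨e ≪≫ (HomologicalComplex.homologyFunctor _ _ s).mapIso
    (barTotal.mapIso (Functor.isoWhiskerLeft M (quotHomologyIso t))).symm⟩

end GrpExtMod

/-! ### The resolution `B_*(Q) ⊗_Q (B_t(P) ⊗_N A)` of `B_t(P) ⊗_P A` -/

lemma barBicomplex_d_f_apply (M : SimplicialObject GrpMod.{u}) (p q : ℕ)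
    (x : ((barBicomplex M).X (p + 1)).X q) :
    ((barBicomplex M).d (p + 1) p).f q x =
      ∑ i : Fin (p + 2), (-1 : ℤ) ^ (i : ℕ) • (GrpMod.bar.map (M.δ i)).f q x := by
  have h : (barBicomplex M).d (p + 1) p = ∑ i : Fin (p + 2), (-1 : ℤ) ^ (i : ℕ) •
      GrpMod.bar.map (M.δ i) := by
    exact alternatingFaceMapComplex_obj_d _ _
  rw [h]
  let F : ChainComplex AddCommGrpCat.{u} ℕ ⥤ AddCommGrpCat.{u} := HomologicalComplex.eval _ _ q
  change F.map (∑ i : Fin (p + 2), (-1 : ℤ) ^ (i : ℕ) • GrpMod.bar.map (M.δ i)) x = _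
  rw [CategoryTheory.Functor.map_sum]
  exact AddCommGrpCat.sum_apply Finset.univ
    (fun i : Fin (p + 2) => F.map ((-1 : ℤ) ^ (i : ℕ) • GrpMod.bar.map (M.δ i))) x

/-- The homomorphism `a ↦ x ⊗ a`. -/
def BarDatum.Chain.tmulHom (D : BarDatum.{u}) {m : ℕ} (x : Fin (m + 1) → D.X) :
    D.A →+ D.Chain m where
  toFun := Chain.tmul D x
  map_zero' := Chain.tmul_zero x
  map_add' := Chain.tmul_add x

/-- The `i`-th face `(x₀, …, xₘ) ⊗ a ↦ (x₀, …, x̂ᵢ, …, xₘ) ⊗ a`. -/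
def BarDatum.Chain.face (D : BarDatum.{u}) {m : ℕ} (i : Fin (m + 2)) :
    D.Chain (m + 1) →+ D.Chain m :=
  Chain.map (fun x => x ∘ i.succAbove) (AddMonoidHom.id _) fun γ => ⟨γ, fun _ => rfl, fun _ => rfl⟩

namespace GrpExtMod

open BarDatum

variable (X : GrpExtMod.{u})

/-- The projection from `P` as an `N`-set to `P` as a `P`-set. -/
def relBarToBar : relBar.obj X ⟶ GrpMod.toBarDatum.obj (mid.obj X) where
  pts := id
  coeff := AddMonoidHom.id _
  equivariant n := ⟨X.i n, fun _ => rfl, fun _ => rfl⟩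

/-- The projection `B_*(P) ⊗_N A → B_*(P) ⊗_P A`. -/
def relComplexToBar : relComplex.obj X ⟶ GrpMod.bar.obj (mid.obj X) :=
  BarDatum.complex.map (relBarToBar X)

lemma relComplexToBar_f_tmul {m : ℕ} (x : Fin (m + 1) → X.P) (a : X.A) :
    (relComplexToBar X).f m (Chain.tmul (relBar.obj X) x a) =
      Chain.tmul (GrpMod.toBarDatum.obj (mid.obj X)) x a :=
  complex_map_f_tmul (relBarToBar X) x a

lemma relComplexToBar_naturality {X Y : GrpExtMod.{u}} (f : X ⟶ Y) :
    relComplex.map f ≫ relComplexToBar Y = relComplexToBar X ≫ GrpMod.bar.map (mid.map f) :=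
  (BarDatum.complex.map_comp (relBar.map f) (relBarToBar Y)).symm.trans
    (BarDatum.complex.map_comp (relBarToBar X) (GrpMod.toBarDatum.map (mid.map f)))

lemma relComplexAct_f_tmul (g : X.P) {m : ℕ} (x : Fin (m + 1) → X.P) (a : X.A) :
    (relComplexAct X g).f m (Chain.tmul (relBar.obj X) x a) =
      Chain.tmul (relBar.obj X) (fun j => g * x j) (X.ρ g a) :=
  complex_map_f_tmul (act X g) x a

/-- Over `P` one has `gx ⊗ ga = x ⊗ a`; this makes the augmentation well defined on the tensor
product over `Q`. -/
lemma relComplexToBar_relComplexAct (g : X.P) (m : ℕ) (w : (relComplex.obj X).X m) :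
    (relComplexToBar X).f m ((relComplexAct X g).f m w) = (relComplexToBar X).f m w :=
  DFunLike.congr_fun (Chain.hom_ext (D := relBar.obj X)
    (f := ((relComplexToBar X).f m).hom.comp ((relComplexAct X g).f m).hom)
    (g := ((relComplexToBar X).f m).hom) fun x a =>
      (congrArg _ (relComplexAct_f_tmul X g x a)).trans
        ((relComplexToBar_f_tmul X _ _).trans
          ((Chain.tmul_smul (GrpMod.toBarDatum.obj (mid.obj X)) g x a).trans
            (relComplexToBar_f_tmul X x a).symm))) w

variable (t : ℕ)

/-- The group `Q` acting on itself and on `B_t(P) ⊗_N A`. -/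
abbrev quotBar : BarDatum.{u} :=
  GrpMod.toBarDatum.obj ((quot (HomologicalComplex.eval _ _ t)).obj X)

/-- The augmentation `y ⊗ (x ⊗ a) ↦ x ⊗ a` from `B_0(Q) ⊗_Q (B_t(P) ⊗_N A)` to
`B_t(P) ⊗_P A`. -/
def augment : (quotBar X t).Chain 0 →+ (GrpMod.bar.obj (mid.obj X)).X t :=
  Chain.lift (D := quotBar X t) (fun _ => ((relComplexToBar X).f t).hom) fun γ _ w => by
    obtain ⟨g, rfl⟩ := X.surj γ
    exact (congrArg ((relComplexToBar X).f t)
      (DFunLike.congr_fun (quotρ_p (HomologicalComplex.eval _ _ t) X g) w)).trans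
      (relComplexToBar_relComplexAct X g t w)

lemma augment_tmul (y : Fin 1 → X.Q) (w : (relComplex.obj X).X t) :
    augment X t (Chain.tmul (quotBar X t) y w) = (relComplexToBar X).f t w :=
  Chain.lift_tmul (D := quotBar X t) _ _ y w

lemma augment_surjective : Function.Surjective (augment X t) := by
  intro z
  obtain ⟨w, rfl⟩ : ∃ w, (relComplexToBar X).f t w = z := by
    refine Chain.induction (D := GrpMod.toBarDatum.obj (mid.obj X))
      (P := fun z => ∃ w, (relComplexToBar X).f t w = z) z ⟨0, map_zero _⟩
      (fun x a => ⟨_, relComplexToBar_f_tmul X x a⟩) ?_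
    rintro _ _ ⟨z, rfl⟩ ⟨w, rfl⟩
    exact ⟨z + w, map_add _ _ _⟩
  exact ⟨_, augment_tmul X t 1 w⟩

variable {X t} in
lemma quotBar_hom_ext {q : ℕ} {B : Type*} [AddCommGroup B] {f g : (quotBar X t).Chain q →+ B}
    (h : ∀ (y : Fin (q + 1) → X.Q) (x : Fin (t + 1) → X.P) (a : X.A),
      f (Chain.tmul (quotBar X t) y (Chain.tmul (relBar.obj X) x a)) =
        g (Chain.tmul (quotBar X t) y (Chain.tmul (relBar.obj X) x a))) : f = g :=
  Chain.hom_ext fun y => DFunLike.congr_fun (Chain.hom_ext (D := relBar.obj X)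
    (f := f.comp (Chain.tmulHom (quotBar X t) y)) (g := g.comp (Chain.tmulHom (quotBar X t) y))
      (h y))

/-- The homomorphism `x ⊗ a ↦ (p(x₀), y) ⊗ (x ⊗ a)`. -/
def consHom {q : ℕ} (y : Fin q → X.Q) : (relBar.obj X).Chain t →+ (quotBar X t).Chain q :=
  Chain.lift (D := relBar.obj X) (fun (x : Fin (t + 1) → X.P) =>
    (Chain.tmulHom (quotBar X t) (Fin.cons (X.p (x 0)) y : Fin (q + 1) → X.Q)).comp
      (Chain.tmulHom (relBar.obj X) x)) fun (n : X.N) (x : Fin (t + 1) → X.P) (a : X.A) => by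
    -- The new first entry depends only on the class of `x ⊗ a` over `N`, since `p` kills `N`.
    have e : X.p (X.i n * x 0) = X.p (x 0) := by rw [map_mul, p_i, one_mul]
    exact congrArg₂ (fun z w => Chain.tmul (quotBar X t) (Fin.cons z y : Fin (q + 1) → X.Q) w) e
      (Chain.tmul_smul (relBar.obj X) n x a)

lemma consHom_tmul {q : ℕ} (y : Fin q → X.Q) (x : Fin (t + 1) → X.P) (a : X.A) :
    consHom X t y (Chain.tmul (relBar.obj X) x a) =
      Chain.tmul (quotBar X t) (Fin.cons (X.p (x 0)) y : Fin (q + 1) → X.Q)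
        (Chain.tmul (relBar.obj X) x a) :=
  Chain.lift_tmul (D := relBar.obj X) _ _ x a

lemma quotρ_p_tmul (g : X.P) (x : Fin (t + 1) → X.P) (a : X.A) :
    quotρ (HomologicalComplex.eval _ _ t) X (X.p g) (Chain.tmul (relBar.obj X) x a) =
      Chain.tmul (relBar.obj X) (fun j => g * x j) (X.ρ g a) :=
  (DFunLike.congr_fun (quotρ_p (HomologicalComplex.eval _ _ t) X g) _).trans
    (relComplexAct_f_tmul X g x a)

/-- Replacing `x₀` by `g x₀` multiplies the new entry by `p(g)`, as it does the other entries, so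
the contraction descends to the tensor product over `Q`. -/
lemma tmul_consHom_smul {q : ℕ} (g : X.P) (y : Fin q → X.Q) (x : Fin (t + 1) → X.P) (a : X.A) :
    consHom X t (fun j => X.p g * y j) (Chain.tmul (relBar.obj X) (fun j => g * x j) (X.ρ g a)) =
      consHom X t y (Chain.tmul (relBar.obj X) x a) := by
  rw [consHom_tmul, consHom_tmul]
  refine Eq.trans ?_ (Chain.tmul_smul (quotBar X t) (X.p g) _ _)
  refine congrArg₂ (Chain.tmul (quotBar X t)) (funext fun j => ?_) (quotρ_p_tmul X t g x a).symm
  change (Fin.cons (X.p (g * x 0)) (fun j => X.p g * y j) : Fin (q + 1) → X.Q) j =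
    X.p g * (Fin.cons (X.p (x 0)) y : Fin (q + 1) → X.Q) j
  cases j using Fin.cases <;> simp

/-- The contraction `y ⊗ (x ⊗ a) ↦ (p(x₀), y) ⊗ (x ⊗ a)`. -/
def contraction (q : ℕ) : (quotBar X t).Chain q →+ (quotBar X t).Chain (q + 1) :=
  Chain.lift (D := quotBar X t) (fun (y : Fin (q + 1) → X.Q) => consHom X t y)
    fun γ (y : Fin (q + 1) → X.Q) w => by
      obtain ⟨g, rfl⟩ := X.surj γ
      exact DFunLike.congr_fun (Chain.hom_ext (D := relBar.obj X)
        (f := (consHom X t (fun j => X.p g * y j)).comp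
          (quotρ (HomologicalComplex.eval _ _ t) X (X.p g))) (g := consHom X t y) fun x a =>
          (congrArg _ (quotρ_p_tmul X t g x a)).trans (tmul_consHom_smul X t g y x a)) w

lemma contraction_tmul {q : ℕ} (y : Fin (q + 1) → X.Q) (x : Fin (t + 1) → X.P) (a : X.A) :
    contraction X t q (Chain.tmul (quotBar X t) y (Chain.tmul (relBar.obj X) x a)) =
      Chain.tmul (quotBar X t) (Fin.cons (X.p (x 0)) y : Fin (q + 2) → X.Q)
        (Chain.tmul (relBar.obj X) x a) :=
  (Chain.lift_tmul (D := quotBar X t) _ _ y _).trans (consHom_tmul X t y x a)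

/-- The section `x ⊗ a ↦ p(x₀) ⊗ (x ⊗ a)` of the augmentation. -/
def augmentSection : (GrpMod.toBarDatum.obj (mid.obj X)).Chain t →+ (quotBar X t).Chain 0 :=
  Chain.lift (D := GrpMod.toBarDatum.obj (mid.obj X)) (fun (x : Fin (t + 1) → X.P) =>
    (consHom X t Fin.elim0).comp (Chain.tmulHom (relBar.obj X) x))
    fun (g : X.P) (x : Fin (t + 1) → X.P) (a : X.A) => by
      refine Eq.trans ?_ (tmul_consHom_smul X t g Fin.elim0 x a)
      exact congrArg (fun y => consHom X t y (Chain.tmul (relBar.obj X) (fun j => g * x j)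
        (X.ρ g a))) (funext fun j => j.elim0)

lemma face_tmul (D : BarDatum.{u}) {m : ℕ} (i : Fin (m + 2)) (x : Fin (m + 2) → D.X) (a : D.A) :
    Chain.face D i (Chain.tmul D x a) = Chain.tmul D (x ∘ i.succAbove) a :=
  Chain.map_tmul ..

lemma face_zero_contraction {q : ℕ} (z : (quotBar X t).Chain q) :
    Chain.face (quotBar X t) 0 (contraction X t q z) = z :=
  DFunLike.congr_fun (quotBar_hom_ext (f := (Chain.face (quotBar X t) 0).comp (contraction X t q))
    (g := AddMonoidHom.id _) fun y x a => by
      refine (congrArg _ (contraction_tmul X t y x a)).trans ((face_tmul _ _ _ _).trans ?_)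
      refine congrArg (fun y => Chain.tmul (quotBar X t) y _) (funext fun j => ?_)
      change (Fin.cons (X.p (x 0)) y : Fin (q + 2) → X.Q) (Fin.succAbove 0 j) = y j
      simp) z

lemma face_succ_contraction {q : ℕ} (i : Fin (q + 2)) (z : (quotBar X t).Chain (q + 1)) :
    Chain.face (quotBar X t) i.succ (contraction X t (q + 1) z) =
      contraction X t q (Chain.face (quotBar X t) i z) :=
  DFunLike.congr_fun (quotBar_hom_ext
    (f := (Chain.face (quotBar X t) i.succ).comp (contraction X t (q + 1)))
    (g := (contraction X t q).comp (Chain.face (quotBar X t) i)) fun y x a => by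
      refine (congrArg _ (contraction_tmul X t y x a)).trans ((face_tmul _ _ _ _).trans ?_)
      refine Eq.trans ?_ ((congrArg _ (face_tmul _ _ _ _)).trans
        (contraction_tmul X t (y ∘ i.succAbove) x a)).symm
      refine congrArg (fun y => Chain.tmul (quotBar X t) y _) (funext fun j => ?_)
      change (Fin.cons (X.p (x 0)) y : Fin (q + 3) → X.Q) (i.succ.succAbove j) =
        (Fin.cons (X.p (x 0)) (y ∘ i.succAbove) : Fin (q + 2) → X.Q) j
      cases j using Fin.cases <;> simp) z

/-- Dropping the single entry `y` of `(p(x₀), y)` leaves `p(x₀) ⊗ (x ⊗ a)`, which depends only on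
the augmentation. This is the bottom degree of the homotopy. -/
lemma face_one_contraction (z : (quotBar X t).Chain 0) :
    Chain.face (quotBar X t) 1 (contraction X t 0 z) = augmentSection X t (augment X t z) :=
  DFunLike.congr_fun (quotBar_hom_ext (f := (Chain.face (quotBar X t) 1).comp (contraction X t 0))
    (g := (augmentSection X t).comp (augment X t)) fun y x a => by
      refine (congrArg _ (contraction_tmul X t y x a)).trans ((face_tmul _ _ _ _).trans ?_)
      refine Eq.trans ?_ ((congrArg (augmentSection X t) ((augment_tmul X t y _).trans
        (relComplexToBar_f_tmul X x a))).trans ((Chain.lift_tmul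
          (D := GrpMod.toBarDatum.obj (mid.obj X)) _ _ x a).trans
            (consHom_tmul X t Fin.elim0 x a))).symm
      refine congrArg (fun y => Chain.tmul (quotBar X t) y _) (funext fun (j : Fin 1) => ?_)
      obtain rfl : j = 0 := Subsingleton.elim _ _
      rfl) z

/-- The complex `B_*(Q) ⊗_Q (B_t(P) ⊗_N A)`. -/
abbrev quotBarComplex : ChainComplex AddCommGrpCat.{u} ℕ :=
  GrpMod.bar.obj ((quot (HomologicalComplex.eval _ _ t)).obj X)

lemma quotBarComplex_d_apply (q : ℕ) (z : (quotBar X t).Chain (q + 1)) :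
    (quotBarComplex X t).d (q + 1) q z =
      ∑ i : Fin (q + 2), (-1 : ℤ) ^ (i : ℕ) • Chain.face (quotBar X t) i z :=
  complex_d_apply (quotBar X t) q z

lemma augment_d (z : (quotBar X t).Chain 1) :
    augment X t ((quotBarComplex X t).d 1 0 z) = 0 := by
  have h (i : Fin 2) (z) : augment X t (Chain.face (quotBar X t) i z) =
      augment X t (Chain.face (quotBar X t) 0 z) :=
    DFunLike.congr_fun (Chain.hom_ext (D := quotBar X t)
      (f := (augment X t).comp (Chain.face (quotBar X t) i))
      (g := (augment X t).comp (Chain.face (quotBar X t) 0)) fun y w =>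
      (congrArg (augment X t) (face_tmul _ i y w)).trans ((augment_tmul X t _ w).trans
        ((congrArg (augment X t) (face_tmul _ 0 y w)).trans (augment_tmul X t _ w)).symm)) z
  refine (congrArg (augment X t) (quotBarComplex_d_apply X t 0 z)).trans ?_
  rw [map_sum, Fin.sum_univ_two, map_zsmul, map_zsmul, h 1]
  simp

lemma exists_quotBarComplex_d_eq (q : ℕ) (z : (quotBar X t).Chain (q + 1))
    (hz : (quotBarComplex X t).d (q + 1) q z = 0) :
    ∃ w, (quotBarComplex X t).d (q + 2) (q + 1) w = z := by
  -- With `h` the contraction, face `0` of `h z` is `z` and face `i + 1` is `h` of face `i`, so `d h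
  -- = 1 - h d` and a cycle `z` equals `d (h z)`.
  refine ⟨contraction X t (q + 1) z, (quotBarComplex_d_apply X t (q + 1) _).trans ?_⟩
  have hz' := (congrArg (contraction X t q)
    ((quotBarComplex_d_apply X t q z).symm.trans hz)).trans (map_zero _)
  rw [map_sum] at hz'
  rw [Fin.sum_univ_succ]
  simp only [face_zero_contraction, face_succ_contraction, Fin.val_zero, pow_zero, one_smul,
    Fin.val_succ, pow_succ, mul_neg, mul_one, neg_smul, Finset.sum_neg_distrib]
  simp only [map_zsmul] at hz'
  rw [hz', neg_zero, add_zero]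

lemma exists_quotBarComplex_d_eq_of_augment (z : (quotBar X t).Chain 0)
    (hz : augment X t z = 0) : ∃ w, (quotBarComplex X t).d 1 0 w = z := by
  refine ⟨contraction X t 0 z, (quotBarComplex_d_apply X t 0 _).trans ?_⟩
  have hz' : augmentSection X t (augment X t z) = 0 :=
    (congrArg (augmentSection X t) hz).trans (map_zero _)
  rw [Fin.sum_univ_two, face_zero_contraction, face_one_contraction, hz']
  simp
  rfl

end GrpExtMod

/-! ### Transport of convergence along isomorphisms of the abutment -/

/-- An isomorphism identifies subquotients. -/
def AddSubgroup.mapQuotientEquiv {A B : Type*} [AddCommGroup A] [AddCommGroup B] (e : A ≃+ B)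
    (K L : AddSubgroup A) : (L ⧸ K.addSubgroupOf L) ≃+
      (L.map e.toAddMonoidHom ⧸
        (K.map e.toAddMonoidHom).addSubgroupOf (L.map e.toAddMonoidHom)) :=
  QuotientAddGroup.congr _ _ (e.addSubgroupMap L) <| by
    ext x
    obtain ⟨x, rfl⟩ := (e.addSubgroupMap L).surjective x
    change e.addSubgroupMap L x ∈ AddSubgroup.map (e.addSubgroupMap L).toAddMonoidHom _ ↔ _
    simp only [AddSubgroup.mem_map, AddSubgroup.mem_addSubgroupOf]
    constructor
    · rintro ⟨y, hy, h⟩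
      exact ⟨y, hy, congrArg Subtype.val h⟩
    · rintro ⟨y, hy, h⟩
      exact ⟨x, e.injective h ▸ hy, rfl⟩

theorem FirstQuadrantSpectralSequence.ConvergesTo.of_iso {E : FirstQuadrantSpectralSequence.{u}}
    {H H' : ℕ → AddCommGrpCat.{u}} (h : E.ConvergesTo H) (e : ∀ n, H n ≅ H' n) :
    E.ConvergesTo H' := by
  obtain ⟨F, hm, hb, ht, hF⟩ := h
  let φ (n : ℕ) : H n ≃+ H' n := (e n).addCommGroupIsoToAddEquiv
  refine ⟨fun n p => (F n p).map (φ n).toAddMonoidHom, fun n p p' hp =>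
    AddSubgroup.map_mono (hm n hp), fun n p hp => ?_, fun n p hp => ?_, fun p q r hp hq => ?_⟩
  · dsimp only
    rw [hb n p hp, AddSubgroup.map_bot]
  · dsimp only
    rw [ht n p hp]
    exact AddSubgroup.map_top_of_surjective _ (φ n).surjective
  · obtain ⟨f⟩ := hF p q r hp hq
    exact ⟨(AddSubgroup.mapQuotientEquiv (φ (p + q)) _ _).symm.trans f⟩

/-! ### The augmentation to the bicomplex of `P_*` -/

namespace GrpExtMod

open BarDatum

lemma augment_naturality {X Y : GrpExtMod.{u}} (f : X ⟶ Y) (t : ℕ) (z : (quotBar X t).Chain 0) :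
    augment Y t ((GrpMod.bar.map ((quot (HomologicalComplex.eval _ _ t)).map f)).f 0 z) =
      (GrpMod.bar.map (mid.map f)).f t (augment X t z) :=
  DFunLike.congr_fun (Chain.hom_ext (D := quotBar X t)
    (f := (augment Y t).comp
      ((GrpMod.bar.map ((quot (HomologicalComplex.eval _ _ t)).map f)).f 0).hom)
    (g := ((GrpMod.bar.map (mid.map f)).f t).hom.comp (augment X t)) fun y w =>
      (congrArg (augment Y t) (GrpMod.bar_map_f_tmul _ y w)).trans ((augment_tmul Y t _ _).trans
        ((ConcreteCategory.congr_hom (congrArg (fun g => HomologicalComplex.Hom.f g t)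
          (relComplexToBar_naturality f)) w).trans
            (congrArg ((GrpMod.bar.map (mid.map f)).f t) (augment_tmul X t y w)).symm))) z

lemma augment_quotMap_evalD (X : GrpExtMod.{u}) (t t' : ℕ) (z : (quotBar X t).Chain 0) :
    augment X t' ((GrpMod.bar.map ((quotMap (evalD t t')).app X)).f 0 z) =
      (GrpMod.bar.obj (mid.obj X)).d t t' (augment X t z) :=
  DFunLike.congr_fun (Chain.hom_ext (D := quotBar X t)
    (f := (augment X t').comp ((GrpMod.bar.map ((quotMap (evalD t t')).app X)).f 0).hom)
    (g := ((GrpMod.bar.obj (mid.obj X)).d t t').hom.comp (augment X t)) fun y w =>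
      (congrArg (augment X t') (GrpMod.bar_map_f_tmul _ y w)).trans ((augment_tmul X t' _ _).trans
        ((ConeExact.hom_d_apply (relComplexToBar X) t t' w).trans
          (congrArg ((GrpMod.bar.obj (mid.obj X)).d t t') (augment_tmul X t y w)).symm))) z

variable (M : SimplicialObject GrpExtMod.{u})

/-- The simplicial group `P_*` with its coefficients. -/
abbrev midSimplicial : SimplicialObject GrpMod.{u} :=
  ((SimplicialObject.whiskering _ _).obj mid).obj M

lemma augment_barBicomplex_d (t p : ℕ)
    (x : ((barBicomplex (quotSimplicial (HomologicalComplex.eval _ _ t) M)).X (p + 1)).X 0) :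
    augment (M.obj (op ⦋p⦌)) t
      (((barBicomplex (quotSimplicial (HomologicalComplex.eval _ _ t) M)).d (p + 1) p).f 0 x) =
      ((barBicomplex (midSimplicial M)).flip.X t).d (p + 1) p
        (augment (M.obj (op ⦋p + 1⦌)) t x) := by
  refine (congrArg (augment (M.obj (op ⦋p⦌)) t) (barBicomplex_d_f_apply _ p 0 x)).trans
    (Eq.trans ?_ (barBicomplex_d_f_apply (midSimplicial M) p t _).symm)
  refine (map_sum (augment (M.obj (op ⦋p⦌)) t) (fun i : Fin (p + 2) => (-1 : ℤ) ^ (i : ℕ) •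
    ((GrpMod.bar.map ((quot (HomologicalComplex.eval _ _ t)).map (M.δ i))).f 0 x :
      (quotBar (M.obj (op ⦋p⦌)) t).Chain 0)) Finset.univ).trans ?_
  refine Finset.sum_congr rfl fun i _ => (map_zsmul _ _ _).trans ?_
  exact congrArg _ (augment_naturality (M.δ i) t x)

/-- The total complex of `B_*(Q_*) ⊗ (B_t(P_*) ⊗ A_*)` augmented to `B_t(P_*) ⊗ A_*`. -/
def augmentTotal (t : ℕ) : quotTotal (HomologicalComplex.eval _ _ t) M ⟶
    (barBicomplex (midSimplicial M)).flip.X t :=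
  HomologicalComplex₂.totalAugmentation
    (barBicomplex (quotSimplicial (HomologicalComplex.eval _ _ t) M)) _
    (fun p => AddCommGrpCat.ofHom (augment (M.obj (op ⦋p⦌)) t))
    (fun p x => augment_d (M.obj (op ⦋p⦌)) t x) (augment_barBicomplex_d M t)

/-- For fixed `t`, the column of simplicial degree `p` is resolved by the contraction for the
extension in that degree. The contraction need not be compatible with the simplicial faces. -/
lemma coneExact_augmentTotal (t : ℕ) : ConeExact (augmentTotal M t) :=
  HomologicalComplex₂.coneExact_totalAugmentation _ _
    (fun p => augment_surjective (M.obj (op ⦋p⦌)) t)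
    (fun p x hx => exists_quotBarComplex_d_eq_of_augment (M.obj (op ⦋p⦌)) t x hx)
    (fun p q x hx => exists_quotBarComplex_d_eq (M.obj (op ⦋p⦌)) t q x hx)

/-- The augmentation of `quotBicomplex`. -/
def augmentBicomplex : quotBicomplex M ⟶ (barBicomplex (midSimplicial M)).flip where
  f := augmentTotal M
  comm' t t' _ := by
    ext n x
    -- The augmentation in degree `n` sees only the component with `p = n` and `s = 0`, so the
    -- square reduces to the compatibility of `augment` with the differential of `B_*(P)`.
    change (((barBicomplex (midSimplicial M)).X n).d t t') (augment (M.obj (op ⦋n⦌)) t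
        ((barBicomplex (quotSimplicial (HomologicalComplex.eval _ _ t) M)).totalPr n 0 n x)) =
      augment (M.obj (op ⦋n⦌)) t'
        ((barBicomplex (quotSimplicial (HomologicalComplex.eval _ _ t') M)).totalPr n 0 n
          ((HomologicalComplex₂.total.map (barBicomplexMap (quotSimplicialMap M (evalD t t')))
            (ComplexShape.down ℕ)).f n x))
    exact ((congrArg (augment (M.obj (op ⦋n⦌)) t') (HomologicalComplex₂.totalPr_map
      (barBicomplexMap (quotSimplicialMap M (evalD t t'))) n 0 n x)).trans
        (augment_quotMap_evalD (M.obj (op ⦋n⦌)) t t' _)).symm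

/-- The spectral sequence of `quotBicomplex` abuts to the homology of `P_*`. -/
theorem nonempty_quotBicomplex_homology_iso (n : ℕ) :
    Nonempty (((quotBicomplex M).flip.total (ComplexShape.down ℕ)).homology n ≅
      simplicialHomology (midSimplicial M) n) :=
  ((HomologicalComplex₂.coneExact_total_map
    -- After the flip, the rows of this map are the augmentations for fixed `t`.
    (K := (quotBicomplex M).flip) (L := barBicomplex (midSimplicial M))
    ((HomologicalComplex₂.flipFunctor _ _ _).map (augmentBicomplex M))
    (coneExact_augmentTotal M)).nonempty_homology_iso n).map Iso.symm

end GrpExtMod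

end

/-! ### The theorem, for the extension of nerves -/

theorem theorem1 {H' G' H G H'' G'' C A : Type u}
    [Group H'] [Group G'] [MulDistribMulAction G' H']
    [Group H] [Group G] [MulDistribMulAction G H]
    [Group H''] [Group G''] [MulDistribMulAction G'' H'']
    [AddCommGroup C] [AddCommGroup A] [DistribMulAction G C] [DistribMulAction G A]
    (X' : CrossedModule H' G') (X : CrossedModule H G) (X'' : CrossedModule H'' G'')
    (i : X'.Hom X) (p : X.Hom X'') (hip : CrossedModule.IsShortExact i p)
    (M : X.Action C A) :
    ∃ E : FirstQuadrantSpectralSequence.{u},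
      (∀ s t : ℕ, Nonempty
        ((E.page 2).X (s, t) ≅ simplicialHomology (hip.coefficients M t) s)) ∧
      E.ConvergesTo (fun n => M.homology n) :=
  -- The flip puts the degree of the `Q_*`-direction first, so that the filtration by the first
  -- index takes homology in the direction of `t` first.
  ⟨(GrpExtMod.quotBicomplex (hip.nerve M)).flip.totalFiltration.spectralSequence,
    GrpExtMod.nonempty_quotBicomplex_page_two_iso (hip.nerve M),
    (ChainFiltration.convergesTo _).of_iso fun n =>
      (GrpExtMod.nonempty_quotBicomplex_homology_iso (hip.nerve M) n).some⟩
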